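/- **Theorem 6.6 (matrix–vector product complexity of QNPE, strongly monotone setting).** *Setting.* Let $d\ge 1$ and let $F:\mathbb R^d\to\mathbb R^d$ be continuously differentiable, $\mu$-strongly monotone ($\mu>0$) and $L_1$-Lipschitz, with $L_2$-Lipschitz Jacobian in operator norm; let $z^*$ be its unique zero. We consider (i) nonlinear equations $F(z)=0$, where the Jacobian may have a known sparsity pattern $\Omega$ ($\Omega$ = all positions in general); (ii) minimax problems $\min_x\max_y f(x,y)$, $F=(\nabla_xf,-\nabla_yf)$; (iii) minimization problems $\min f$, $F=\nabla f$ (again possibly with sparsity pattern $\Omega$). Let $\mathcal L$ be the space of matrices vanishing off the diagonal outside $\Omega$ in case (i), of matrices $B$ with $JB=B^\top J$, $J=\mathrm{diag}(I,-I)$, in case (ii), of symmetric matrices vanishing off the diagonal outside $\Omega$ in case (iii); let $\mathcal P$ be the Frobenius-orthogonal projection onto $\mathcal L$. *Parameters.* $\alpha_1,\alpha_2\in(0,\frac12)$, $\beta\in(0,1)$, $\sigma_0\ge \frac{\alpha_2\beta}{7.5L_1}$, $p\in(0,1)$, $\rho=\frac1{121}$, $\delta=\frac{\mu}{2L_1}$,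 $q_t=\frac{p}{2.5(t+1)\log^2(t+1)}$ for $t\ge1$. The initial matrix $B_0\in\mathcal L$ satisfies $\mu I\preceq\frac12(B_0+B_0^\top)\preceq L_1I$ and, in cases (i) and (ii), $\|B_0\|_{op}\le L_1$. *Method (QNPE).* Start from $z_0$, $B_0$, $\sigma_0$, $W_0=\frac1{L_1}(B_0-(L_1+\mu)I)$, $t=0$. In iteration $k$: 1. For $\eta=\sigma_k,\sigma_k\beta,\sigma_k\beta^2,\dots$ put $\hat z=z_k+\mathsf{LinearSolver}(I+\eta B_k,\,-\eta F(z_k);\,\alpha_1\sqrt{1+\eta\mu})$, until $\|\hat z-z_k+\eta F(\hat z)\|<(\alpha_1+\alpha_2)\sqrt{1+\eta\mu}\,\|\hat z-z_k\|$. Let $\eta_k,\hat z_k$ be the accepted pair and set $\sigma_{k+1}=\eta_k/\beta$. 2. $z_{k+1}=\theta_k(z_k-\eta_kF(\hat z_k))+(1-\theta_k)\hat z_k$ with $\theta_k=\frac1{1+2\eta_k\mu}$. 3. If $\eta_k=\sigma_k$, keep $B_{k+1}=B_k$. Otherwise let $\tilde z_k$ be the last rejected trial point, $s=\tilde z_k-z_k$,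 $u=F(\tilde z_k)-F(z_k)$, $\ell(B)=\|u-Bs\|^2/\|s\|^2$, $G=\frac1{L_1}\mathcal P\nabla\ell(B_k)$, and $\tilde G=G$ if $t=0$ or $\gamma_t\le1$, $\tilde G=G+\max\{0,-\frac1{\gamma_t}\langle G,W_t\rangle\}S_t$ otherwise. Let $W_{t+1}$ be the projection of $W_t-\rho\tilde G$ onto the Frobenius ball of radius $\sqrt d$ about $0$. Call $\mathsf{ExtEvec}(\frac12(W_{t+1}+W_{t+1}^\top);\delta,\frac{q_{t+1}}2)$ and, in cases (i) and (ii), also $\mathsf{MaxSvec}(W_{t+1};\delta,\frac{q_{t+1}}2)$; let $(\gamma_{t+1},S)$ be the output with the larger first component, $S_{t+1}=\mathcal P S$. Set $B_{k+1}=L_1\hat B+(L_1+\mu)I$ with $\hat B=W_{t+1}/\max\{1,\gamma_{t+1}\}$, and increase $t$ by one. *Oracles.* $\mathsf{LinearSolver}(A,b;\tau)$ runs, from $s_0=0$, CGLS if $A$ is non-symmetric and the conjugate residual method if $A$ is symmetric, and returns the first iterate $s_j$ with $\|b-As_j\|\le\tau\|s_j\|$; it uses one matrix–vector product initially, and then two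 (CGLS) or one (conjugate residuals) per iteration. $\mathsf{ExtEvec}(W;\delta,q)$ runs $\lceil\frac14\sqrt{2(1+1/\delta)}\log\frac{11d}{q^2}+\frac12\rceil$ Lanczos iterations on $\bar W=\frac12(W+W^\top)$ from a uniformly random unit vector. With the resulting largest and smallest Ritz pairs $(\hat\lambda_1,u_1)$, $(\hat\lambda_d,u_d)$ it returns $\gamma=\max\{\hat\lambda_1,-\hat\lambda_d\}$ and $S=0$ if $\gamma\le1$, $S=u_1u_1^\top$ if $\gamma>1$ and $\hat\lambda_1\ge-\hat\lambda_d$, $S=-u_du_d^\top$ otherwise. $\mathsf{MaxSvec}(W;\delta,q)$ runs $\lceil\frac14\sqrt{2(1+1/\delta)}\log\frac{22d}{q^2}+\frac12\rceil$ Lanczos iterations on $\begin{bmatrix}0&W\\W^\top&0\end{bmatrix}$ from a uniformly random unit vector of $\mathbb R^{2d}$. With the resulting largest Ritz pair $(\tilde\lambda,(v,v'))$ it returns $\gamma=\tilde\lambda/3$ and $S=0$ if $\gamma\le1$, $S=\frac23 v v'^\top$ otherwise. A Lanczos iteration costs one matrix–vector product in $\mathsf{ExtEvec}$ and two (one with $W$,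 one with $W^\top$) in $\mathsf{MaxSvec}$. All start vectors are independent. *Claim.* There are an absolute constant $C_0$ and, for all $\alpha_1,\alpha_2,\beta$ and $R$, a constant $C=C(\alpha_1,\alpha_2,\beta,R)$ such that whenever $\sigma_0L_1\le R$ and $\epsilon>0$, the following holds with probability at least $1-p$. The number $N_\epsilon=\min\{N:\|z_N-z^*\|^2\le\epsilon\}$ is finite, and in the first $N_\epsilon$ iterations every line search and every call of $\mathsf{LinearSolver}$ terminates. Moreover: (a) For nonlinear equations and minimax problems, $\mathsf{LinearSolver}$ uses in these iterations at most $$C\,N_\epsilon\,\frac{L_1}{\mu}\,\log\Big(\frac{L_1\|z_0-z^*\|^2}{\mu\epsilon}\Big)$$ matrix–vector products in total, and $\mathsf{ExtEvec}$ and $\mathsf{MaxSvec}$ together use at most $$C_0\,N_\epsilon\sqrt{\frac{L_1}{\mu}}\,\log\Big(\frac{dN_\epsilon^2}{p^2}\Big).$$ (b) For minimization problems, $\mathsf{LinearSolver}$ uses at most $$C\,N_\epsilon\sqrt{\frac{L_1}{\mu}}\,\log\Big(\frac{L_1\|z_0-z^*\|^2}{\mu\epsilon}\Big)$$ matrix–vector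 products in total, and $\mathsf{ExtEvec}$ at most $$C_0\,N_\epsilon\sqrt{\frac{L_1}{\mu}}\,\log\Big(\frac{dN_\epsilon^2}{p^2}\Big).$$ Each bound is asserted whenever the argument of its logarithm is at least $2$. -/

import Mathlib

open MeasureTheory ProbabilityTheory

noncomputable section

namespace QNPE

/-! ### Vectors and matrices -/

/-- Euclidean space with coordinates indexed by `ι`. -/
abbrev Vec (ι : Type) := EuclideanSpace ℝ ι

/-- Real square matrices indexed by `ι`. -/
abbrev Mat (ι : Type) := Matrix ι ι ℝ

/-- The matrix-vector product, with values in Euclidean space. -/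
def matVec {ι : Type} [Fintype ι] (A : Mat ι) (x : Vec ι) : Vec ι :=
  WithLp.toLp 2 (A.mulVec x.ofLp)

/-- The rank-one matrix `x yᵀ`. -/
def outer {ι : Type} (x y : Vec ι) : Mat ι := Matrix.vecMulVec x.ofLp y.ofLp

/-- The Frobenius inner product. -/
def frobInner {ι : Type} [Fintype ι] (A B : Mat ι) : ℝ := ∑ i, ∑ j, A i j * B i j

/-- The Frobenius norm. -/
def frobNorm {ι : Type} [Fintype ι] (A : Mat ι) : ℝ := Real.sqrt (frobInner A A)

/-- The symmetric part `(A + Aᵀ)/2`. -/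
def symPart {ι : Type} (A : Mat ι) : Mat ι := (1 / 2 : ℝ) • (A + A.transpose)

/-! ### Problem classes and the structure imposed on the Jacobian approximations -/

/-- The problem classes.
* `equation Ω`: a nonlinear equation `F z = 0` whose Jacobians have sparsity pattern `Ω`
  (`Ω = Set.univ` is the general nonlinear equation);
* `minimax m`: `min_x max_y f (x, y)`, where `x` consists of the first `m` coordinates;
* `minimization Ω`: `min_z f z`, with Hessians of sparsity pattern `Ω`
  (`Ω = Set.univ` is the general minimization problem). -/
inductive ProblemClass (d : ℕ) where
  | equation (Ω : Set (Fin d × Fin d))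
  | minimax (m : ℕ)
  | minimization (Ω : Set (Fin d × Fin d))

/-- `B` vanishes at the off-diagonal positions outside `Ω`. -/
def HasPattern {d : ℕ} (Ω : Set (Fin d × Fin d)) (B : Mat (Fin d)) : Prop :=
  ∀ i j, (i, j) ∉ Ω → i ≠ j → B i j = 0

/-- The signature matrix `diag(I, -I)` with `m` leading entries `1`. -/
def signature (d m : ℕ) : Mat (Fin d) :=
  Matrix.diagonal fun i => if i.val < m then (1 : ℝ) else -1

/-- The Jacobian matrix of `F` at `z`. -/
def jacobian {d : ℕ} (F : Vec (Fin d) → Vec (Fin d)) (z : Vec (Fin d)) : Mat (Fin d) :=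
  Matrix.of fun i j => fderiv ℝ F z (EuclideanSpace.single j 1) i

/-- `F` is an operator of the given class: the gradient of `f` for minimization, and the
saddle operator `(∇_x f, -∇_y f)` for minimax problems.  (Under the strong monotonicity
assumed of `F`, the function `f` is automatically strongly convex, respectively strongly
convex in `x` and strongly concave in `y`.) -/
def ProblemClass.IsOperator {d : ℕ} : ProblemClass d → (Vec (Fin d) → Vec (Fin d)) → Prop
  | .equation Ω, F => ∀ z, HasPattern Ω (jacobian F z)
  | .minimax m, F => ∃ (f : Vec (Fin d) → ℝ) (g : Vec (Fin d) → Vec (Fin d)),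
      (∀ z, HasGradientAt f (g z) z) ∧
        ∀ z i, F z i = if i.val < m then g z i else -g z i
  | .minimization Ω, F => (∃ f : Vec (Fin d) → ℝ, ∀ z, HasGradientAt f (F z) z) ∧
      ∀ z, HasPattern Ω (jacobian F z)

/-- The class is a minimization problem. -/
def ProblemClass.IsMinimization {d : ℕ} : ProblemClass d → Prop
  | .equation _ => False
  | .minimax _ => False
  | .minimization _ => True

/-- Membership in the linear subspace `𝓛` of structured matrices. -/
def ProblemClass.MemL {d : ℕ} : ProblemClass d → Mat (Fin d) → Prop
  | .equation Ω, B => HasPattern Ω B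
  | .minimax m, B => signature d m * B = B.transpose * signature d m
  | .minimization Ω, B => B.IsSymm ∧ HasPattern Ω B

open scoped Classical in
/-- The orthogonal projection (for the Frobenius inner product) onto `𝓛`. -/
def ProblemClass.proj {d : ℕ} : ProblemClass d → Mat (Fin d) → Mat (Fin d)
  | .equation Ω, W => Matrix.of fun i j => if (i, j) ∈ Ω ∨ i = j then W i j else 0
  | .minimax m, W => (1 / 2 : ℝ) • (W + signature d m * W.transpose * signature d m)
  | .minimization Ω, W => Matrix.of fun i j =>
      if ((i, j) ∈ Ω ∧ (j, i) ∈ Ω) ∨ i = j then (W i j + W j i) / 2 else 0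

/-- The feasible set `𝓩` of the Jacobian approximations:
`μ I ⪯ (B + Bᵀ)/2 ⪯ L₁ I`, `‖B‖_op ≤ L₁`, `B ∈ 𝓛` for equations and minimax problems, and
`μ I ⪯ B ⪯ L₁ I`, `B ∈ 𝓛` (symmetric matrices) for minimization. -/
def ProblemClass.MemZ {d : ℕ} (cls : ProblemClass d) (μ L₁ : ℝ) (B : Mat (Fin d)) : Prop :=
  (symPart B - μ • (1 : Mat (Fin d))).PosSemidef ∧
    (L₁ • (1 : Mat (Fin d)) - symPart B).PosSemidef ∧
    (¬ cls.IsMinimization → ∀ x, ‖matVec B x‖ ≤ L₁ * ‖x‖) ∧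
    cls.MemL B

/-! ### `LinearSolver`: CGLS (non-symmetric matrices), conjugate residuals (symmetric ones) -/

/-- The vectors and the scalar kept by the linear solver. -/
structure SolverState (ι : Type) where
  s : Vec ι
  r : Vec ι
  v : Vec ι
  p : Vec ι
  q : Vec ι
  γ : ℝ

/-- The iterates of CGLS.  Here `q` is `A p` for the current direction `p`. -/
def cgls {ι : Type} [Fintype ι] (A : Mat ι) (b : Vec ι) : ℕ → SolverState ι
  | 0 =>
      let v := matVec A.transpose b
      { s := 0, r := b, v := v, p := v, q := matVec A v, γ := inner ℝ v v }
  | k + 1 =>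
      let c := cgls A b k
      let α := c.γ / ‖c.q‖ ^ 2
      let r := c.r - α • c.q
      let v := matVec A.transpose r
      let γ := ‖v‖ ^ 2
      let p := v + (γ / c.γ) • c.p
      { s := c.s + α • c.p, r := r, v := v, p := p, q := matVec A p, γ := γ }

/-- The iterates of the conjugate residual method; `q = A p` is updated without an additional
matrix-vector product. -/
def conjRes {ι : Type} [Fintype ι] (A : Mat ι) (b : Vec ι) : ℕ → SolverState ι
  | 0 =>
      let v := matVec A.transpose b
      { s := 0, r := b, v := v, p := b, q := v, γ := inner ℝ v b }
  | k + 1 =>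
      let c := conjRes A b k
      let α := c.γ / ‖c.q‖ ^ 2
      let r := c.r - α • c.q
      let v := matVec A r
      let γ := inner ℝ v r
      { s := c.s + α • c.p, r := r, v := v, p := r + (γ / c.γ) • c.p,
        q := v + (γ / c.γ) • c.q, γ := γ }

open scoped Classical in
/-- The iterates of `LinearSolver`. -/
def solverIter {ι : Type} [Fintype ι] (A : Mat ι) (b : Vec ι) (k : ℕ) : SolverState ι :=
  if A.IsSymm then conjRes A b k else cgls A b k

/-- The iterations at which the stopping test of `LinearSolver(A, b; ρ)` holds. -/
def solverStops {ι : Type} [Fintype ι] (A : Mat ι) (b : Vec ι) (ρ : ℝ) : Set ℕ :=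
  {k | ‖(solverIter A b k).r‖ ≤ ρ * ‖(solverIter A b k).s‖}

/-- The output of `LinearSolver(A, b; ρ)`: the iterate at the first iteration that passes the
stopping test. -/
def linearSolver {ι : Type} [Fintype ι] (A : Mat ι) (b : Vec ι) (ρ : ℝ) : Vec ι :=
  (solverIter A b (sInf (solverStops A b ρ))).s

open scoped Classical in
/-- The number of matrix-vector products computed by `LinearSolver(A, b; ρ)`: one in the
initialization, then in each iteration one if `A` is symmetric and two otherwise.  It is `⊤`
if the solver never stops. -/
def linearSolverMV {ι : Type} [Fintype ι] (A : Mat ι) (b : Vec ι) (ρ : ℝ) : ℕ∞ :=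
  if (solverStops A b ρ).Nonempty then
    ((1 + (if A.IsSymm then 1 else 2) * sInf (solverStops A b ρ) : ℕ) : ℕ∞)
  else ⊤

/-! ### The Lanczos method with a given unit start vector -/

/-- The last two Lanczos vectors, and the off-diagonal coefficient linking them. -/
structure LanczosState (ι : Type) where
  prev : Vec ι
  cur : Vec ι
  β : ℝ

/-- The diagonal Lanczos coefficient at a state. -/
def LanczosState.α {ι : Type} [Fintype ι] (M : Mat ι) (c : LanczosState ι) : ℝ :=
  inner ℝ (matVec M c.cur - c.β • c.prev) c.cur

/-- The Lanczos recurrence; the state with index `k` holds `v_k, v_{k+1}, β_{k+1}` in the usual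
numbering `v_0 = 0`, `v_1 = v`.  If the recurrence breaks down (`β_{k+1} = 0`) then all later
Lanczos vectors and coefficients are zero, as if the method had been stopped there; this does
not affect the outputs of the two oracles below. -/
def lanczos {ι : Type} [Fintype ι] (M : Mat ι) (v : Vec ι) : ℕ → LanczosState ι
  | 0 => { prev := 0, cur := v, β := 0 }
  | k + 1 =>
      let c := lanczos M v k
      let w := matVec M c.cur - c.β • c.prev - c.α M • c.cur
      { prev := c.cur, cur := ‖w‖⁻¹ • w, β := ‖w‖ }

/-- The tridiagonal matrix produced by `N` Lanczos iterations. -/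
def lanczosT {ι : Type} [Fintype ι] (M : Mat ι) (v : Vec ι) (N : ℕ) : Mat (Fin N) :=
  Matrix.of fun i j =>
    if i = j then (lanczos M v i.val).α M
    else if i.val + 1 = j.val then (lanczos M v j.val).β
    else if j.val + 1 = i.val then (lanczos M v i.val).β
    else 0

/-- The set of real eigenvalues. -/
def eigenvalueSet {ι : Type} [Fintype ι] [DecidableEq ι] (T : Mat ι) : Set ℝ :=
  {x | Module.End.HasEigenvalue (Matrix.toLin' T) x}

open scoped Classical in
/-- A unit eigenvector of `T` for the eigenvalue `x`. -/
def unitEvec {ι : Type} [Fintype ι] (T : Mat ι) (x : ℝ) : Vec ι :=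
  if h : ∃ z : Vec ι, ‖z‖ = 1 ∧ matVec T z = x • z then h.choose else 0

/-- The approximate largest eigenvalue of `M` after `N` Lanczos iterations. -/
def lanczosMax {ι : Type} [Fintype ι] (M : Mat ι) (v : Vec ι) (N : ℕ) : ℝ :=
  sSup (eigenvalueSet (lanczosT M v N))

/-- The approximate smallest eigenvalue of `M` after `N` Lanczos iterations. -/
def lanczosMin {ι : Type} [Fintype ι] (M : Mat ι) (v : Vec ι) (N : ℕ) : ℝ :=
  sInf (eigenvalueSet (lanczosT M v N))

/-- The approximate eigenvector `∑ z_k v_k` of `M`, for the unit eigenvector `z` of the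
tridiagonal matrix with eigenvalue `x`. -/
def lanczosVec {ι : Type} [Fintype ι] (M : Mat ι) (v : Vec ι) (N : ℕ) (x : ℝ) : Vec ι :=
  ∑ k : Fin N, (unitEvec (lanczosT M v N) x) k • (lanczos M v k.val).cur

/-- The number of Lanczos iterations for a matrix of size `n`, accuracy `δ` and failure
probability `q`: the smallest integer that is at least
`(1/4) √(2 (1 + 1/δ)) log (11 n / q²) + 1/2`. -/
def lanczosSteps (n : ℕ) (δ q : ℝ) : ℕ :=
  ⌈1 / 4 * Real.sqrt (2 * (1 + 1 / δ)) * Real.log (11 * n / q ^ 2) + 1 / 2⌉₊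

/-- The oracle `ExtEvec(W; δ, q)`, run with start vector `v`. -/
def extEvec {d : ℕ} (W : Mat (Fin d)) (δ q : ℝ) (v : Vec (Fin d)) : ℝ × Mat (Fin d) :=
  let M := symPart W
  let N := lanczosSteps d δ q
  let l₁ := lanczosMax M v N
  let l₂ := lanczosMin M v N
  let γ := max l₁ (-l₂)
  let u₁ := lanczosVec M v N l₁
  let u₂ := lanczosVec M v N l₂
  (γ, if γ ≤ 1 then 0 else if -l₂ ≤ l₁ then outer u₁ u₁ else -outer u₂ u₂)

/-- The number of matrix-vector products of `ExtEvec(W; δ, q)`: one with `(W + Wᵀ)/2` in each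
Lanczos iteration. -/
def extEvecMV (d : ℕ) (δ q : ℝ) : ℕ := lanczosSteps d δ q

/-- The oracle `MaxSvec(W; δ, q)`, run with start vector `v`: the Lanczos method for the largest
eigenvalue of the symmetric matrix `[0, W; Wᵀ, 0]`. -/
def maxSvec {d : ℕ} (W : Mat (Fin d)) (δ q : ℝ) (v : Vec (Fin d ⊕ Fin d)) :
    ℝ × Mat (Fin d) :=
  let M : Mat (Fin d ⊕ Fin d) := Matrix.fromBlocks 0 W W.transpose 0
  let N := lanczosSteps (2 * d) δ q
  let l₁ := lanczosMax M v N
  let u := lanczosVec M v N l₁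
  let x : Vec (Fin d) := WithLp.toLp 2 fun i => u (Sum.inl i)
  let y : Vec (Fin d) := WithLp.toLp 2 fun i => u (Sum.inr i)
  let γ := l₁ / 3
  (γ, if γ ≤ 1 then 0 else (2 / 3 : ℝ) • outer x y)

/-- The number of matrix-vector products of `MaxSvec(W; δ, q)`: in each Lanczos iteration one
with `W` and one with `Wᵀ`. -/
def maxSvecMV (d : ℕ) (δ q : ℝ) : ℕ := 2 * lanczosSteps (2 * d) δ q

/-! ### Random start vectors -/

/-- The unit sphere of Euclidean space. -/
abbrev UnitSphere (ι : Type) [Fintype ι] := Metric.sphere (0 : Vec ι) 1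

/-- The uniform probability measure on the unit sphere (normalized surface measure). -/
def uniformSphere (ι : Type) [Fintype ι] : Measure (UnitSphere ι) :=
  ((volume : Measure (Vec ι)).toSphere Set.univ)⁻¹ • (volume : Measure (Vec ι)).toSphere

/-- A pair of start vectors, for `ExtEvec` and for `MaxSvec`. -/
abbrev Draw (d : ℕ) := UnitSphere (Fin d) × UnitSphere (Fin d ⊕ Fin d)

/-- The law of the start vectors: uniform on the two spheres and independent. -/
def drawLaw (d : ℕ) : Measure (Draw d) :=
  (uniformSphere (Fin d)).prod (uniformSphere (Fin d ⊕ Fin d))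

/-! ### The QNPE method -/

/-- The inputs of the method: problem class, operator, initial point and initial Jacobian
approximation, strong monotonicity and Lipschitz parameters, line search parameters, initial
trial step size, and failure probability. -/
structure Input (d : ℕ) where
  cls : ProblemClass d
  F : Vec (Fin d) → Vec (Fin d)
  z₀ : Vec (Fin d)
  B₀ : Mat (Fin d)
  μ : ℝ
  L₁ : ℝ
  α₁ : ℝ
  α₂ : ℝ
  β : ℝ
  σ₀ : ℝ
  p : ℝ

/-- The step size of the online learning update. -/
def olStep : ℝ := 1 / 121

variable {d : ℕ}

/-- The accuracy of the two separation oracles. -/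
def Input.δ (I : Input d) : ℝ := I.μ / (2 * I.L₁)

/-- The failure probability of round `t ≥ 1`. -/
def Input.q (I : Input d) (t : ℕ) : ℝ :=
  I.p / (2.5 * (t + 1) * Real.log (t + 1) ^ 2)

/-- The state at the beginning of an iteration: the iterate `z`, the trial step size `σ`, the
Jacobian approximation `B`, and the variables `W_t, γ_t, S_t` of the current round `t` of the
online learning algorithm (`t` is the number of earlier iterations that backtracked). -/
structure State (d : ℕ) where
  z : Vec (Fin d)
  σ : ℝ
  B : Mat (Fin d)
  W : Mat (Fin d)
  γ : ℝ
  S : Mat (Fin d)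
  t : ℕ

/-- The initial state.  Round `0` makes no oracle call; `γ = 1` encodes that its surrogate
gradient is the plain gradient. -/
def Input.init (I : Input d) : State d where
  z := I.z₀
  σ := I.σ₀
  B := I.B₀
  W := (1 / I.L₁) • (I.B₀ - (I.L₁ + I.μ) • (1 : Mat (Fin d)))
  γ := 1
  S := 0
  t := 0

/-- The `i`-th trial step size `σ βⁱ` of the line search. -/
def Input.trialStep (I : Input d) (c : State d) (i : ℕ) : ℝ := c.σ * I.β ^ i

/-- The matrix of the linear system solved at the `i`-th trial. -/
def Input.trialA (I : Input d) (c : State d) (i : ℕ) : Mat (Fin d) :=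
  1 + I.trialStep c i • c.B

/-- The right-hand side of the linear system solved at the `i`-th trial. -/
def Input.trialRhs (I : Input d) (c : State d) (i : ℕ) : Vec (Fin d) :=
  -(I.trialStep c i • I.F c.z)

/-- The accuracy demanded from the linear solver at the `i`-th trial. -/
def Input.trialTol (I : Input d) (c : State d) (i : ℕ) : ℝ :=
  I.α₁ * Real.sqrt (1 + I.trialStep c i * I.μ)

/-- The `i`-th trial point of the line search. -/
def Input.trialPoint (I : Input d) (c : State d) (i : ℕ) : Vec (Fin d) :=
  c.z + linearSolver (I.trialA c i) (I.trialRhs c i) (I.trialTol c i)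

/-- The trials that the line search accepts. -/
def Input.accepted (I : Input d) (c : State d) : Set ℕ :=
  {i | ‖I.trialPoint c i - c.z + I.trialStep c i • I.F (I.trialPoint c i)‖ <
    (I.α₁ + I.α₂) * Real.sqrt (1 + I.trialStep c i * I.μ) * ‖I.trialPoint c i - c.z‖}

/-- The index of the first accepted trial (the number of backtracking steps). -/
def Input.lsIndex (I : Input d) (c : State d) : ℕ := sInf (I.accepted c)

/-- The loss of the current Jacobian approximation, `ℓ(B) = ‖u - B s‖² / ‖s‖²`, has the gradient
`-2 (u - B s) sᵀ / ‖s‖²` for the Frobenius inner product; here `s = z̃ - z` and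
`u = F z̃ - F z`, with `z̃` the last rejected trial point of the line search. -/
def Input.lossGrad (I : Input d) (c : State d) : Mat (Fin d) :=
  let zt := I.trialPoint c (I.lsIndex c - 1)
  let s := zt - c.z
  let u := I.F zt - I.F c.z
  (-2 / ‖s‖ ^ 2) • outer (u - matVec c.B s) s

open scoped Classical in
/-- The separation oracle of round `t`: `ExtEvec` alone for minimization, and otherwise the output
of `ExtEvec` or `MaxSvec` with the larger first component; the matrix is projected onto `𝓛`. -/
def Input.sepOracle (I : Input d) (W : Mat (Fin d)) (t : ℕ) (ξ : Draw d) : ℝ × Mat (Fin d) :=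
  let o₁ := extEvec (symPart W) I.δ (I.q t / 2) ξ.1.val
  let o₂ := maxSvec W I.δ (I.q t / 2) ξ.2.val
  let o := if I.cls.IsMinimization ∨ o₂.1 ≤ o₁.1 then o₁ else o₂
  (o.1, I.cls.proj o.2)

/-- One iteration of QNPE.  The start vectors `ξ` are used only if the line search backtracks. -/
def Input.step (I : Input d) (c : State d) (ξ : Draw d) : State d :=
  let η := I.trialStep c (I.lsIndex c)
  let zh := I.trialPoint c (I.lsIndex c)
  let θ := 1 / (1 + 2 * η * I.μ)
  let z' := θ • (c.z - η • I.F zh) + (1 - θ) • zh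
  let σ' := η / I.β
  if I.lsIndex c = 0 then
    { c with z := z', σ := σ' }
  else
    let G := (1 / I.L₁) • I.cls.proj (I.lossGrad c)
    let Gt := if c.γ ≤ 1 then G else G + max 0 (-(1 / c.γ) * frobInner G c.W) • c.S
    let V := c.W - olStep • Gt
    let W' := (Real.sqrt d / max (Real.sqrt d) (frobNorm V)) • V
    let o := I.sepOracle W' (c.t + 1) ξ
    let Bh := if o.1 ≤ 1 then W' else (1 / o.1) • W'
    { z := z', σ := σ', B := I.L₁ • Bh + (I.L₁ + I.μ) • (1 : Mat (Fin d)), W := W',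
      γ := o.1, S := o.2, t := c.t + 1 }

/-- The states visited by QNPE, for a given sequence of start vectors. -/
def Input.run (I : Input d) (ξ : ℕ → Draw d) : ℕ → State d
  | 0 => I.init
  | k + 1 => I.step (Input.run I ξ k) (ξ k)

/-! ### Matrix-vector products -/

open scoped Classical in
/-- The number of matrix-vector products used by `LinearSolver` in one iteration: the sum over all
trials of the line search up to the accepted one (`⊤` if no trial is accepted). -/
def Input.iterSolverMV (I : Input d) (c : State d) : ℕ∞ :=
  if (I.accepted c).Nonempty then
    ∑ i ∈ Finset.range (I.lsIndex c + 1),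
      linearSolverMV (I.trialA c i) (I.trialRhs c i) (I.trialTol c i)
  else ⊤

open scoped Classical in
/-- The number of matrix-vector products used by `ExtEvec` and `MaxSvec` in one iteration. -/
def Input.iterOracleMV (I : Input d) (c : State d) : ℕ :=
  if I.lsIndex c = 0 then 0
  else extEvecMV d I.δ (I.q (c.t + 1) / 2) +
    if I.cls.IsMinimization then 0 else maxSvecMV d I.δ (I.q (c.t + 1) / 2)

/-- The number of matrix-vector products used by `LinearSolver` in the first `N` iterations. -/
def Input.solverMV (I : Input d) (ξ : ℕ → Draw d) (N : ℕ) : ℕ∞ :=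
  ∑ k ∈ Finset.range N, I.iterSolverMV (I.run ξ k)

/-- The number of matrix-vector products used by `ExtEvec` and `MaxSvec` in the first `N`
iterations. -/
def Input.oracleMV (I : Input d) (ξ : ℕ → Draw d) (N : ℕ) : ℕ :=
  ∑ k ∈ Finset.range N, I.iterOracleMV (I.run ξ k)

/-! ### Assumptions -/

/-- The strongly monotone setting: `F` is a continuously differentiable operator of the given
class, `μ`-strongly monotone, `L₁`-Lipschitz, and with `L₂`-Lipschitz Jacobian. -/
structure Input.StronglyMonotoneSetting (I : Input d) (L₂ : ℝ) : Prop where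
  μ_pos : 0 < I.μ
  isOperator : I.cls.IsOperator I.F
  contDiff : ContDiff ℝ 1 I.F
  stronglyMonotone : ∀ z z', I.μ * ‖z - z'‖ ^ 2 ≤ inner ℝ (I.F z - I.F z') (z - z')
  lipschitz : ∀ z z', ‖I.F z - I.F z'‖ ≤ I.L₁ * ‖z - z'‖
  jacobianLipschitz : ∀ z z', ‖fderiv ℝ I.F z - fderiv ℝ I.F z'‖ ≤ L₂ * ‖z - z'‖

/-- The conditions on the parameters of the method. -/
structure Input.ValidParameters (I : Input d) : Prop where
  α₁_mem : I.α₁ ∈ Set.Ioo (0 : ℝ) (1 / 2)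
  α₂_mem : I.α₂ ∈ Set.Ioo (0 : ℝ) (1 / 2)
  β_mem : I.β ∈ Set.Ioo (0 : ℝ) 1
  σ₀_ge : I.α₂ * I.β / (7.5 * I.L₁) ≤ I.σ₀
  p_mem : I.p ∈ Set.Ioo (0 : ℝ) 1
  B₀_mem : I.cls.MemZ I.μ I.L₁ I.B₀

end QNPE

end

/-! The costs are counted relative to `N_ε`, so neither a convergence rate nor a regret bound is
needed. It suffices that the Jacobian approximations stay well conditioned, that every iteration
contracts the error, and that all backtracking steps can be counted.

Randomness enters only through the start vectors of the Lanczos runs. A run reaches relative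
accuracy `1 + δ` unless its start vector lies in a thin slab around the hyperplane orthogonal to an
extremal eigenvector (`krylov_eigenvalue_bound`); a uniform vector does so with probability at most
`q_t / 2` (`uniformSphere_slab_le`). The matrix handed to the oracles depends on earlier draws only,
so conditioning on them and summing over rounds bounds the probability of any failure by `∑ q_t ≤ p`
(`measure_not_allOraclesSucceed_le`). Conditioning requires the whole run to be measurable, although
Ritz vectors are selected by choice.

Off the failure event everything is deterministic. Each `B_k` is `μ/2`-coercive with norm at most `7
L₁` (`run_regular`). So `I + η B_k` has condition number at most `14 L₁ / μ` for every `η > 0`, and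
Chebyshev bounds for conjugate residuals, in which CGLS is included via `A Aᵀ`, give `√(L₁/μ)` or
`L₁/μ` times a logarithm per linear system. A trial with `8 η L₁ < α₂` is always accepted, which
bounds the steps below. An accepted step contracts the squared error by `1 / (1 + 2 η μ)`, so `N_ε`
is finite. The same contraction bounds the steps above: before accuracy `ε` is reached, `1 + σ μ` is
at most a constant times `‖z₀ - z*‖² / ε`, whence the argument of the logarithm. Since each step
multiplies `σ` by a power of `β` and divides once by `β`, telescoping `log σ` bounds the total
number of trials by a constant times `N_ε` (`solverMV_le`). The oracle bound (`oracleMV_le`) follows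
from `q_t ≥ p / (5 N³)` for the rounds that occur. -/

noncomputable section

/-! ### Linear solvers: optimality of conjugate residuals and the resulting iteration counts. -/

namespace QNPE

open Polynomial

/-! ### Matrix-vector products as linear maps -/

section MatVec

variable {ι : Type} [Fintype ι]

/-- The linear map `x ↦ A x`. -/
def matLin (A : Mat ι) : Module.End ℝ (Vec ι) where
  toFun := matVec A
  map_add' x y := by simp [matVec, Matrix.mulVec_add]
  map_smul' c x := by simp [matVec, Matrix.mulVec_smul]

@[simp] theorem matLin_apply (A : Mat ι) (x : Vec ι) : matLin A x = matVec A x := rfl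

theorem matVec_apply (A : Mat ι) (x : Vec ι) (i : ι) : matVec A x i = ∑ j, A i j * x j := rfl

theorem matVec_vadd (A : Mat ι) (x y : Vec ι) : matVec A (x + y) = matVec A x + matVec A y :=
  (matLin A).map_add x y

theorem matVec_vsmul (A : Mat ι) (c : ℝ) (x : Vec ι) : matVec A (c • x) = c • matVec A x :=
  (matLin A).map_smul c x

@[simp] theorem matVec_vzero (A : Mat ι) : matVec A 0 = 0 := (matLin A).map_zero

theorem matVec_madd (A B : Mat ι) (x : Vec ι) : matVec (A + B) x = matVec A x + matVec B x := by
  simp [matVec, Matrix.add_mulVec]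

theorem matVec_msmul (c : ℝ) (A : Mat ι) (x : Vec ι) : matVec (c • A) x = c • matVec A x := by
  simp [matVec, Matrix.smul_mulVec]

theorem matVec_mneg (A : Mat ι) (x : Vec ι) : matVec (-A) x = -matVec A x := by
  simp [matVec, Matrix.neg_mulVec]

theorem matVec_msub (A B : Mat ι) (x : Vec ι) : matVec (A - B) x = matVec A x - matVec B x := by
  simp [matVec, Matrix.sub_mulVec]

theorem matVec_one [DecidableEq ι] (x : Vec ι) : matVec 1 x = x := by
  simp [matVec]

theorem matVec_mul (A B : Mat ι) (x : Vec ι) : matVec (A * B) x = matVec A (matVec B x) := by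
  simp [matVec]

theorem inner_eq_dotProduct (x y : Vec ι) : inner ℝ x y = x.ofLp ⬝ᵥ y.ofLp := by
  simp [PiLp.inner_apply, dotProduct, mul_comm]

theorem inner_matVec (A : Mat ι) (x y : Vec ι) :
    inner ℝ (matVec A x) y = inner ℝ x (matVec A.transpose y) := by
  simp only [inner_eq_dotProduct, matVec, Matrix.mulVec_transpose]
  rw [dotProduct_comm, Matrix.dotProduct_mulVec, dotProduct_comm]

theorem matLin_isSymmetric {A : Mat ι} (hA : A.IsSymm) : (matLin A).IsSymmetric := by
  intro x y
  simp only [matLin_apply]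
  rw [inner_matVec, hA.eq]

end MatVec

/-! ### Polynomials of symmetric operators -/

section Symmetric

variable {E : Type*} [NormedAddCommGroup E] [InnerProductSpace ℝ E] [FiniteDimensional ℝ E]
  {n : ℕ}

theorem inner_eigenvectorBasis_aeval {K : Module.End ℝ E} (hK : K.IsSymmetric)
    (hn : Module.finrank ℝ E = n) (P : ℝ[X]) (x : E) (i : Fin n) :
    inner ℝ (hK.eigenvectorBasis hn i) (aeval K P x) =
      P.eval (hK.eigenvalues hn i) * inner ℝ (hK.eigenvectorBasis hn i) x := by
  induction P using Polynomial.induction_on' with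
  | add p q hp hq => simp [inner_add_right, hp, hq, add_mul]
  | monomial k a =>
    simp only [aeval_monomial, eval_monomial, Module.End.mul_apply,
      Module.algebraMap_end_apply, inner_smul_right]
    rw [mul_assoc]
    congr 1
    induction k with
    | zero => simp
    | succ k ih =>
      rw [pow_succ', Module.End.mul_apply, ← hK, hK.apply_eigenvectorBasis, inner_smul_left, ih]
      simp [pow_succ']
      ring

omit [FiniteDimensional ℝ E] in
theorem sum_sq_inner_basis {m : ℕ} (e : OrthonormalBasis (Fin m) ℝ E) (x : E) :
    ∑ i, inner ℝ (e i) x ^ 2 = ‖x‖ ^ 2 := by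
  have := e.sum_sq_norm_inner_right x
  simpa using this

/-- In an orthonormal eigenbasis the operator acts by multiplication with the values of `P` at the
eigenvalues, and testing the quadratic form on the basis places these in `[m, M]`. -/
theorem norm_aeval_le {K : Module.End ℝ E} (hK : K.IsSymmetric) {P : ℝ[X]} {m M c : ℝ}
    (hm : ∀ x, m * ‖x‖ ^ 2 ≤ inner ℝ (K x) x) (hM : ∀ x, inner ℝ (K x) x ≤ M * ‖x‖ ^ 2)
    (hc : 0 ≤ c) (hP : ∀ t ∈ Set.Icc m M, |P.eval t| ≤ c) (x : E) :
    ‖aeval K P x‖ ≤ c * ‖x‖ := by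
  obtain ⟨n, hn⟩ : ∃ n, Module.finrank ℝ E = n := ⟨_, rfl⟩
  set e := hK.eigenvectorBasis hn
  have hl : ∀ i, inner ℝ (K (e i)) (e i) = hK.eigenvalues hn i := fun i => by
    rw [hK.apply_eigenvectorBasis, inner_smul_left]
    simp [e]
  refine abs_le_of_sq_le_sq' ?_ (by positivity) |>.2
  rw [mul_pow, ← sum_sq_inner_basis e, ← sum_sq_inner_basis e x, Finset.mul_sum]
  refine Finset.sum_le_sum fun i _ => ?_
  rw [inner_eigenvectorBasis_aeval, mul_pow]
  have h1 := hm (e i)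
  have h2 := hM (e i)
  rw [hl, e.norm_eq_one] at h1 h2
  have h3 := abs_le.1 (hP _ ⟨by linarith, by linarith⟩ : |P.eval (hK.eigenvalues hn i)| ≤ c)
  exact mul_le_mul_of_nonneg_right (sq_le_sq' h3.1 h3.2) (sq_nonneg _)

end Symmetric

/-! ### Optimality of conjugate residuals -/

section ConjugateResiduals

variable {E : Type*} [NormedAddCommGroup E] [InnerProductSpace ℝ E]

/-- The recursion of the conjugate residual method for an operator `K`, in terms of the residuals
`r`, the images `q` of the search directions, and the scalars `γ`. -/
structure IsConjResSeq (K : Module.End ℝ E) (r q : ℕ → E) (γ : ℕ → ℝ) : Prop where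
  q_zero : q 0 = K (r 0)
  γ_eq : ∀ k, γ k = inner ℝ (K (r k)) (r k)
  r_succ : ∀ k, r (k + 1) = r k - (γ k / ‖q k‖ ^ 2) • q k
  q_succ : ∀ k, q (k + 1) = K (r (k + 1)) + (γ (k + 1) / γ k) • q k

namespace IsConjResSeq

variable {K : Module.End ℝ E} {r q : ℕ → E} {γ : ℕ → ℝ}

theorem r_eq_zero_of_le (h : IsConjResSeq K r q γ) {j k : ℕ} (hjk : j ≤ k) (hj : r j = 0) :
    r k = 0 := by
  induction k, hjk using Nat.le_induction with
  | base => exact hj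
  | succ k _ ih => rw [h.r_succ, h.γ_eq, ih]; simp

/-- The four relations only close under a joint induction: the last makes `γ k / ‖q k‖ ^ 2` the
exact minimizing step along `q k`, the first then yields `K`-conjugacy of the residuals, and both
yield orthogonality of the `q j`. Nonzero residuals keep every `γ j` and `q j` nonzero, so all
divisions are genuine. -/
theorem orthogonality (h : IsConjResSeq K r q γ) (hK : K.IsSymmetric)
    (hpos : ∀ x, x ≠ 0 → 0 < inner ℝ (K x) x) (k : ℕ) (hr : ∀ j ≤ k, r j ≠ 0) :
    (∀ j < k, inner ℝ (r k) (q j) = 0) ∧ (∀ j < k, inner ℝ (K (r k)) (r j) = 0) ∧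
      (∀ j < k, inner ℝ (q k) (q j) = 0) ∧ ∀ j ≤ k, inner ℝ (r j) (q j) = γ j := by
  induction k with
  | zero =>
    refine ⟨by simp, by simp, by simp, ?_⟩
    intro j hj
    rw [Nat.le_zero.1 hj, h.q_zero, h.γ_eq, real_inner_comm]
  | succ k ih =>
    obtain ⟨h1, h2, h3, h4⟩ := ih fun j hj => hr j (by omega)
    have hγpos : ∀ j ≤ k + 1, 0 < γ j := fun j hj => by rw [h.γ_eq]; exact hpos _ (hr j hj)
    have hq : ∀ j ≤ k, ‖q j‖ ^ 2 ≠ 0 := fun j hj h0 => by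
      have := hγpos j (by omega)
      rw [← h4 j hj, show q j = 0 by simpa using h0, inner_zero_right] at this
      exact lt_irrefl _ this
    have a1 : ∀ j < k + 1, inner ℝ (r (k + 1)) (q j) = 0 := fun j hj => by
      rw [h.r_succ, inner_sub_left, inner_smul_left]
      rcases Nat.lt_succ_iff_lt_or_eq.1 hj with hj | rfl
      · rw [h1 j hj, h3 j hj]; simp
      · have := hq j le_rfl
        rw [h4 j le_rfl, real_inner_self_eq_norm_sq]
        rw [conj_trivial, div_mul_cancel₀ _ this, sub_self]
    have a2 : ∀ j < k + 1, inner ℝ (K (r (k + 1))) (r j) = 0 := fun j hj => by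
      rw [hK]
      cases j with
      | zero => rw [← h.q_zero]; exact a1 0 hj
      | succ j =>
        rw [show K (r (j + 1)) = q (j + 1) - (γ (j + 1) / γ j) • q j by rw [h.q_succ]; abel,
          inner_sub_right, inner_smul_right, a1 _ hj, a1 j (by omega)]
        simp
    refine ⟨a1, a2, fun j hj => ?_, fun j hj => ?_⟩
    · rw [h.q_succ, inner_add_left, inner_smul_left]
      simp only [conj_trivial]
      -- A direction is a multiple of a difference of residuals, so products with `q j` reduce to
      -- the conjugacy relations `a2`.
      have e1 : q j = (‖q j‖ ^ 2 / γ j) • (r j - r (j + 1)) := by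
        rw [h.r_succ, sub_sub_cancel, smul_smul, div_mul_div_cancel₀ (hγpos j (by omega)).ne',
          div_self (hq j (by omega)), one_smul]
      rcases Nat.lt_succ_iff_lt_or_eq.1 hj with hj' | rfl
      · rw [h3 j hj', e1, inner_smul_right, inner_sub_right, a2 j hj, a2 (j + 1) (by omega)]
        simp
      · have e2 : inner ℝ (K (r (j + 1))) (q j) = -(γ (j + 1) * ‖q j‖ ^ 2 / γ j) := by
          conv_lhs => rw [e1]
          rw [inner_smul_right, inner_sub_right, a2 j hj, ← h.γ_eq]
          ring
        rw [e2, real_inner_self_eq_norm_sq]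
        ring
    · rcases Nat.lt_succ_iff_lt_or_eq.1 (Nat.lt_succ_of_le hj) with hj' | rfl
      · exact h4 j (by omega)
      · rw [h.q_succ, inner_add_right, inner_smul_right, a1 k (by omega), h.γ_eq, real_inner_comm]
        simp

/-- `K (q j)` is a combination of `K (r j)` and `K (r (j + 1))`, and each `K (r i)` is a combination
of `q i` and `q (i - 1)`; applying `K` thus enlarges the span by one direction. -/
theorem krylov_mem_span (h : IsConjResSeq K r q γ) (hK : K.IsSymmetric)
    (hpos : ∀ x, x ≠ 0 → 0 < inner ℝ (K x) x) {k : ℕ} (hr : ∀ j ≤ k, r j ≠ 0) (i : ℕ)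
    (hi : i < k) : (K ^ (i + 1)) (r 0) ∈ Submodule.span ℝ (q '' Set.Iio (i + 1)) := by
  induction i with
  | zero =>
    rw [zero_add, pow_one, ← h.q_zero]
    exact Submodule.subset_span ⟨0, by simp, rfl⟩
  | succ i ih =>
    rw [pow_succ', Module.End.mul_apply]
    have hKr : ∀ j < i + 2, K (r j) ∈ Submodule.span ℝ (q '' Set.Iio (i + 2)) := fun j hj => by
      cases j with
      | zero => rw [← h.q_zero]; exact Submodule.subset_span ⟨0, by simp, rfl⟩
      | succ j =>
        rw [show K (r (j + 1)) = q (j + 1) - (γ (j + 1) / γ j) • q j by rw [h.q_succ]; abel]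
        exact Submodule.sub_mem _ (Submodule.subset_span ⟨j + 1, hj, rfl⟩)
          (Submodule.smul_mem _ _ (Submodule.subset_span ⟨j, by simp at *; omega, rfl⟩))
    have hmap : (Submodule.span ℝ (q '' Set.Iio (i + 1))) ≤
        (Submodule.span ℝ (q '' Set.Iio (i + 2))).comap K := by
      rw [Submodule.span_le]
      rintro _ ⟨j, hj, rfl⟩
      simp only [Set.mem_Iio] at hj
      have hγ : 0 < γ j := by rw [h.γ_eq]; exact hpos _ (hr j (by omega))
      have hq : ‖q j‖ ^ 2 ≠ 0 := fun h0 => by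
        have := (h.orthogonality hK hpos k hr).2.2.2 j (by omega)
        rw [show q j = 0 by simpa using h0, inner_zero_right] at this
        exact hγ.ne this
      have e1 : q j = (‖q j‖ ^ 2 / γ j) • (r j - r (j + 1)) := by
        rw [h.r_succ, sub_sub_cancel, smul_smul, div_mul_div_cancel₀ hγ.ne', div_self hq, one_smul]
      simp only [Submodule.comap_coe, Set.mem_preimage, SetLike.mem_coe]
      rw [e1, map_smul, map_sub]
      exact Submodule.smul_mem _ _ (Submodule.sub_mem _ (hKr j (by omega)) (hKr _ (by omega)))
    exact hmap (ih (by omega))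

/-- With `S` the span of the first `k` directions, `r k` is orthogonal to `S`, while both `r 0 - r
k` and `P(K) (r 0) - r 0` lie in `S`, the latter because `P(0) = 1`. Pythagoras concludes. If some
earlier residual vanishes, so does `r k`. -/
theorem norm_le_norm_aeval (h : IsConjResSeq K r q γ) (hK : K.IsSymmetric)
    (hpos : ∀ x, x ≠ 0 → 0 < inner ℝ (K x) x) {k : ℕ} {P : ℝ[X]} (hP : P.eval 0 = 1)
    (hdeg : P.natDegree ≤ k) : ‖r k‖ ≤ ‖aeval K P (r 0)‖ := by
  by_cases hr : ∀ j ≤ k, r j ≠ 0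
  swap
  · push Not at hr
    obtain ⟨j, hj, hj0⟩ := hr
    rw [h.r_eq_zero_of_le hj hj0, norm_zero]
    exact norm_nonneg _
  set S := Submodule.span ℝ (q '' Set.Iio k) with hS
  have hmono : ∀ i ≤ k, Submodule.span ℝ (q '' Set.Iio i) ≤ S := fun i hi =>
    Submodule.span_mono (Set.image_mono (Set.Iio_subset_Iio hi))
  have hperp : ∀ y ∈ S, inner ℝ (r k) y = 0 := fun y hy => by
    induction hy using Submodule.span_induction with
    | mem x hx =>
      obtain ⟨j, hj, rfl⟩ := hx
      exact (h.orthogonality hK hpos k hr).1 j hj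
    | zero => simp
    | add x y _ _ hx hy => rw [inner_add_right, hx, hy, add_zero]
    | smul a x _ hx => rw [inner_smul_right, hx, mul_zero]
  have hres : ∀ j ≤ k, r 0 - r j ∈ S := fun j hj => by
    induction j with
    | zero => simp
    | succ j ih =>
      rw [h.r_succ, ← sub_add]
      exact S.add_mem (ih (by omega)) (S.smul_mem _ (Submodule.subset_span ⟨j, hj, rfl⟩))
  have hpoly : aeval K P (r 0) - r 0 ∈ S := by
    rw [aeval_eq_sum_range' (Nat.lt_succ_of_le hdeg), Finset.sum_range_succ']
    simp only [LinearMap.add_apply, LinearMap.sum_apply, LinearMap.smul_apply, pow_zero,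
      Module.End.one_apply]
    rw [coeff_zero_eq_eval_zero, hP, one_smul, add_sub_cancel_right]
    refine S.sum_mem fun i hi => S.smul_mem _ ?_
    have hi' := Finset.mem_range.1 hi
    exact hmono _ hi' (h.krylov_mem_span hK hpos hr i hi')
  have hdiff : aeval K P (r 0) - r k ∈ S := by
    have := S.add_mem hpoly (hres k le_rfl)
    rwa [sub_add_sub_cancel] at this
  have h0 := hperp _ hdiff
  have hsq : ‖r k‖ ^ 2 ≤ ‖aeval K P (r 0)‖ ^ 2 := by
    rw [show aeval K P (r 0) = r k + (aeval K P (r 0) - r k) by abel, norm_add_sq_real, h0]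
    nlinarith [sq_nonneg ‖aeval K P (r 0) - r k‖]
  exact abs_le_of_sq_le_sq' hsq (norm_nonneg _) |>.2

end IsConjResSeq

end ConjugateResiduals

/-! ### The Chebyshev bound -/

/-- This is `tanh s ≤ s`. It allows a convenient explicit `s` in both Chebyshev arguments in place
of the optimal one defined through `tanh`. -/
theorem sinh_le_mul_cosh {s : ℝ} (hs : 0 ≤ s) : Real.sinh s ≤ s * Real.cosh s := by
  have hmono : MonotoneOn (fun x => x * Real.cosh x - Real.sinh x) (Set.Ici 0) := by
    refine monotoneOn_of_deriv_nonneg (convex_Ici 0) (by fun_prop) (by fun_prop) fun x hx => ?_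
    have hd : HasDerivAt (fun x => x * Real.cosh x - Real.sinh x)
        (1 * Real.cosh x + x * Real.sinh x - Real.cosh x) x :=
      ((hasDerivAt_id x).mul (Real.hasDerivAt_cosh x)).sub (Real.hasDerivAt_sinh x)
    rw [hd.deriv]
    rw [interior_Ici] at hx
    have := Real.sinh_nonneg_iff.2 (le_of_lt hx)
    have hx' : (0 : ℝ) < x := hx
    nlinarith [mul_nonneg hx'.le this]
  have := hmono (Set.mem_Ici.2 le_rfl) (Set.mem_Ici.2 hs) hs
  simp only [zero_mul, Real.sinh_zero, sub_zero] at this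
  linarith

theorem sinh_sq_le {s : ℝ} (hs : 0 ≤ s) : Real.sinh s ^ 2 ≤ s ^ 2 * Real.cosh s ^ 2 := by
  rw [← mul_pow]
  exact pow_le_pow_left₀ (Real.sinh_nonneg_iff.2 hs) (sinh_le_mul_cosh hs) 2

theorem half_exp_le_cosh (x : ℝ) : Real.exp x / 2 ≤ Real.cosh x := by
  rw [Real.cosh_eq]
  have := Real.exp_pos (-x)
  linarith

/-- The test polynomial is `T_k(a - b t) / T_k(a)` with `a = cosh (2 s)`. The affine map sends `0`
to `a` and `m` to `1`; it sends `M` to at least `-1` because `tanh² s ≤ s² ≤ m / M`. So `|P| ≤ 1 /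
cosh (2 k s)` on `[m, M]`. -/
theorem IsConjResSeq.norm_le_exp {E : Type*} [NormedAddCommGroup E] [InnerProductSpace ℝ E]
    [FiniteDimensional ℝ E] {K : Module.End ℝ E} {r q : ℕ → E} {γ : ℕ → ℝ}
    (h : IsConjResSeq K r q γ) (hK : K.IsSymmetric) {m M s : ℝ} (hm0 : 0 < m) (hs0 : 0 < s)
    (hs : s ^ 2 * M ≤ m) (hm : ∀ x, m * ‖x‖ ^ 2 ≤ inner ℝ (K x) x)
    (hM : ∀ x, inner ℝ (K x) x ≤ M * ‖x‖ ^ 2) (k : ℕ) :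
    ‖r k‖ ≤ 2 * Real.exp (-(2 * s * k)) * ‖r 0‖ := by
  set a := Real.cosh (2 * s) with ha
  set b := 2 * Real.sinh s ^ 2 / m with hb
  set c := Real.cosh (k * (2 * s)) with hc
  have hcpos : 0 < c := Real.cosh_pos _
  set P : ℝ[X] := C c⁻¹ * (Chebyshev.T ℝ k).comp (C a - C b * X) with hPdef
  have hP0 : P.eval 0 = 1 := by
    simp only [hPdef, eval_mul, eval_C, eval_comp, eval_sub, eval_X, mul_zero, sub_zero]
    have := Chebyshev.T_real_cosh (2 * s) k
    rw [ha, this, hc]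
    push_cast
    exact inv_mul_cancel₀ (Real.cosh_pos _).ne'
  have hdeg : P.natDegree ≤ k := by
    refine natDegree_C_mul_le _ _ |>.trans ?_
    rw [natDegree_comp]
    have h1 : (Chebyshev.T ℝ (k : ℤ)).natDegree = k := by simp
    have h2 : (C a - C b * X : ℝ[X]).natDegree ≤ 1 := by compute_degree
    rw [h1]
    nlinarith
  have hpos : ∀ x, x ≠ 0 → 0 < inner ℝ (K x) x := fun x hx =>
    lt_of_lt_of_le (by positivity) (hm x)
  refine (h.norm_le_norm_aeval hK hpos hP0 hdeg).trans ?_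
  have hbd : ∀ t ∈ Set.Icc m M, |P.eval t| ≤ c⁻¹ := fun t ht => by
    simp only [hPdef, eval_mul, eval_C, eval_comp, eval_sub, eval_X]
    rw [abs_mul, abs_of_pos (inv_pos.2 hcpos)]
    refine mul_le_of_le_one_right (inv_pos.2 hcpos).le ?_
    refine Chebyshev.abs_eval_T_real_le_one _ ?_
    have hcs : a = 1 + 2 * Real.sinh s ^ 2 := by
      rw [ha, Real.cosh_two_mul, Real.cosh_sq]; ring
    have hbm : b * m = 2 * Real.sinh s ^ 2 := by rw [hb]; field_simp
    have hb0 : 0 ≤ b := by positivity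
    have hM0 : 0 ≤ M := by linarith [ht.1, ht.2]
    rw [abs_le]
    constructor
    · have h1 : b * t ≤ b * M := by gcongr; exact ht.2
      have h2 : b * M * m ≤ 2 * m * Real.cosh s ^ 2 := by
        calc b * M * m = 2 * Real.sinh s ^ 2 * M := by rw [mul_right_comm, hbm]
          _ ≤ 2 * (s ^ 2 * Real.cosh s ^ 2) * M := by gcongr; exact sinh_sq_le hs0.le
          _ = 2 * (s ^ 2 * M) * Real.cosh s ^ 2 := by ring
          _ ≤ 2 * m * Real.cosh s ^ 2 := by gcongr
      have h3 : b * M ≤ 2 * Real.cosh s ^ 2 := by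
        refine le_of_mul_le_mul_right ?_ hm0
        linarith
      have := Real.cosh_sq s
      linarith
    · have h1 : b * m ≤ b * t := by gcongr; exact ht.1
      linarith
  refine (norm_aeval_le hK hm hM (inv_pos.2 hcpos).le hbd _).trans ?_
  gcongr
  rw [inv_le_comm₀ hcpos (by positivity), mul_inv, ← Real.exp_neg, neg_neg]
  calc 2⁻¹ * Real.exp (2 * s * k) = Real.exp (k * (2 * s)) / 2 := by rw [mul_comm (k : ℝ)]; ring
    _ ≤ c := half_exp_le_cosh _

/-! ### The linear solvers -/

section Solver

variable {ι : Type} [Fintype ι]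

theorem cgls_residual (A : Mat ι) (b : Vec ι) (k : ℕ) :
    (cgls A b k).r = b - matVec A (cgls A b k).s ∧ (cgls A b k).q = matVec A (cgls A b k).p ∧
      (cgls A b k).v = matVec A.transpose (cgls A b k).r ∧
      (cgls A b k).γ = ‖(cgls A b k).v‖ ^ 2 := by
  induction k with
  | zero => simp [cgls]
  | succ k ih =>
    obtain ⟨h1, h2, h3, h4⟩ := ih
    refine ⟨?_, rfl, rfl, rfl⟩
    simp only [cgls]
    rw [matVec_vadd, matVec_vsmul, ← h2, h1]
    abel

theorem conjRes_residual (A : Mat ι) (hA : A.IsSymm) (b : Vec ι) (k : ℕ) :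
    (conjRes A b k).r = b - matVec A (conjRes A b k).s ∧
      (conjRes A b k).q = matVec A (conjRes A b k).p ∧
      (conjRes A b k).γ = inner ℝ (matVec A (conjRes A b k).r) (conjRes A b k).r := by
  induction k with
  | zero => simp [conjRes, hA.eq]
  | succ k ih =>
    obtain ⟨h1, h2, h3⟩ := ih
    refine ⟨?_, ?_, rfl⟩
    · simp only [conjRes]
      rw [matVec_vadd, matVec_vsmul, ← h2, h1]
      abel
    · simp only [conjRes]
      rw [matVec_vadd, matVec_vsmul, ← h2]

/-- CGLS minimizes the residual over the Krylov space of `A Aᵀ`: since `q = A p` and `v = Aᵀ r`, its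
recursion for `r` and `q` is the conjugate residual recursion for `A Aᵀ`, and one convergence proof
serves both solvers. -/
theorem cgls_isConjResSeq (A : Mat ι) (b : Vec ι) :
    IsConjResSeq (matLin (A * A.transpose)) (fun k => (cgls A b k).r) (fun k => (cgls A b k).q)
      (fun k => (cgls A b k).γ) where
  q_zero := by simp [cgls, matVec_mul]
  γ_eq k := by
    obtain ⟨-, -, h3, h4⟩ := cgls_residual A b k
    simp only [matLin_apply, matVec_mul]
    rw [inner_matVec, h4, h3, real_inner_self_eq_norm_sq]
  r_succ k := rfl
  q_succ k := by
    obtain ⟨-, h2, -, -⟩ := cgls_residual A b k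
    simp only [cgls, matLin_apply, matVec_mul]
    rw [matVec_vadd, matVec_vsmul, ← h2]

theorem conjRes_isConjResSeq (A : Mat ι) (hA : A.IsSymm) (b : Vec ι) :
    IsConjResSeq (matLin A) (fun k => (conjRes A b k).r) (fun k => (conjRes A b k).q)
      (fun k => (conjRes A b k).γ) where
  q_zero := by simp [conjRes, hA.eq]
  γ_eq k := (conjRes_residual A hA b k).2.2
  r_succ k := rfl
  q_succ k := rfl

theorem solverIter_residual (A : Mat ι) (b : Vec ι) (k : ℕ) :
    (solverIter A b k).r = b - matVec A (solverIter A b k).s := by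
  unfold solverIter
  split_ifs with hA
  · exact (conjRes_residual A hA b k).1
  · exact (cgls_residual A b k).1

/-- The reciprocal of the square root of the condition number that governs the solver. -/
def solverRate (A : Mat ι) (m M : ℝ) : ℝ :=
  open scoped Classical in if A.IsSymm then √(m / M) else m / M

theorem norm_matVec_transpose_le {A : Mat ι} {M : ℝ} (hA : ∀ x, ‖matVec A x‖ ≤ M * ‖x‖)
    (x : Vec ι) : ‖matVec A.transpose x‖ ≤ M * ‖x‖ := by
  rcases eq_or_ne (matVec A.transpose x) 0 with h0 | h0
  · have := (norm_nonneg _).trans (hA x)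
    rw [h0, norm_zero]
    exact this
  · have h1 : ‖matVec A.transpose x‖ ^ 2 ≤ M * ‖x‖ * ‖matVec A.transpose x‖ := by
      rw [← real_inner_self_eq_norm_sq, ← inner_matVec]
      calc _ ≤ ‖matVec A (matVec A.transpose x)‖ * ‖x‖ := real_inner_le_norm _ _
        _ ≤ M * ‖matVec A.transpose x‖ * ‖x‖ := by gcongr; exact hA _
        _ = _ := by ring
    have h2 : 0 < ‖matVec A.transpose x‖ := norm_pos_iff.2 h0
    nlinarith

/-- For CGLS the form of `A Aᵀ` is `‖Aᵀ x‖ ^ 2`, between `m ^ 2` and `M ^ 2` times `‖x‖ ^ 2`; the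
lower bound passes coercivity of `A` to `Aᵀ`. Squaring the condition number is why the square root
is lost there. -/
theorem solverIter_norm_le {A : Mat ι} {m M : ℝ} (hm0 : 0 < m) (hM0 : 0 < M)
    (hm : ∀ x, m * ‖x‖ ^ 2 ≤ inner ℝ (matVec A x) x) (hM : ∀ x, ‖matVec A x‖ ≤ M * ‖x‖)
    (b : Vec ι) (k : ℕ) :
    ‖(solverIter A b k).r‖ ≤ 2 * Real.exp (-(2 * solverRate A m M * k)) * ‖b‖ := by
  unfold solverIter solverRate
  split_ifs with hA
  · refine (conjRes_isConjResSeq A hA b).norm_le_exp (matLin_isSymmetric hA) (M := M) hm0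
      (by positivity) ?_ hm (fun x => ?_) k
    · rw [Real.sq_sqrt (by positivity), div_mul_cancel₀ _ hM0.ne']
    · calc _ ≤ ‖matVec A x‖ * ‖x‖ := real_inner_le_norm _ _
        _ ≤ M * ‖x‖ * ‖x‖ := by gcongr; exact hM x
        _ = _ := by ring
  · refine (cgls_isConjResSeq A b).norm_le_exp (m := m ^ 2) (M := M ^ 2) (matLin_isSymmetric ?_)
      (by positivity) (by positivity) ?_ (fun x => ?_) (fun x => ?_) k
    · rw [Matrix.IsSymm, Matrix.transpose_mul, Matrix.transpose_transpose]
    · rw [div_pow, div_mul_cancel₀ _ (by positivity)]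
    · rw [matLin_apply, matVec_mul, inner_matVec, real_inner_self_eq_norm_sq, ← mul_pow]
      have h1 : m * ‖x‖ ^ 2 ≤ ‖x‖ * ‖matVec A.transpose x‖ := by
        refine (hm x).trans ?_
        rw [inner_matVec]
        exact real_inner_le_norm _ _
      gcongr
      rcases eq_or_ne x 0 with rfl | hx
      · simp
      · have : 0 < ‖x‖ := norm_pos_iff.2 hx
        nlinarith
    · rw [matLin_apply, matVec_mul, inner_matVec, real_inner_self_eq_norm_sq, ← mul_pow]
      gcongr
      exact norm_matVec_transpose_le hM x

/-- The stopping test is relative to the iterate `s`, so `‖s‖` must be bounded below. Once the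
residual is at most `2 ‖b‖ / Λ ≤ ‖b‖ / 2`, the equation `b = r + A s` forces `‖b‖ ≤ 2 M ‖s‖`, and `Λ
τ ≥ 4 M` makes the test succeed. -/
theorem solverStops_bound {A : Mat ι} {m M τ Λ : ℝ} (hm0 : 0 < m) (hM0 : 0 < M)
    (hm : ∀ x, m * ‖x‖ ^ 2 ≤ inner ℝ (matVec A x) x) (hM : ∀ x, ‖matVec A x‖ ≤ M * ‖x‖)
    (b : Vec ι) (hΛ2 : 4 ≤ Λ) (hΛ : 4 * M ≤ Λ * τ) :
    (solverStops A b τ).Nonempty ∧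
      ((sInf (solverStops A b τ) : ℕ) : ℝ) ≤ Real.log Λ / (2 * solverRate A m M) + 1 := by
  have hs : 0 < solverRate A m M := by
    unfold solverRate; split_ifs <;> positivity
  set x := Real.log Λ / (2 * solverRate A m M) with hx
  have hx0 : 0 ≤ x := div_nonneg (Real.log_nonneg (by linarith)) (by positivity)
  have hmem : ⌈x⌉₊ ∈ solverStops A b τ := by
    simp only [solverStops, Set.mem_ofPred_eq]
    set k := ⌈x⌉₊
    have hk : x ≤ k := Nat.le_ceil _
    have h1 := solverIter_norm_le hm0 hM0 hm hM b k
    have h2 : Real.exp (-(2 * solverRate A m M * k)) ≤ Λ⁻¹ := by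
      rw [Real.exp_neg]
      gcongr
      rw [← Real.log_le_iff_le_exp (by linarith)]
      rw [hx, div_le_iff₀ (by positivity)] at hk
      linarith
    have hΛ0 : 0 < Λ := by linarith
    have h3 : Λ * ‖(solverIter A b k).r‖ ≤ 2 * ‖b‖ := by
      calc Λ * ‖(solverIter A b k).r‖ ≤ Λ * (2 * Λ⁻¹ * ‖b‖) := by
            gcongr
            exact h1.trans (by gcongr)
        _ = 2 * ‖b‖ := by field_simp
    have h4 : ‖b‖ ≤ ‖(solverIter A b k).r‖ + M * ‖(solverIter A b k).s‖ := by
      have := solverIter_residual A b k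
      calc ‖b‖ = ‖(solverIter A b k).r + matVec A (solverIter A b k).s‖ := by rw [this]; simp
        _ ≤ _ := (norm_add_le _ _).trans (by gcongr; exact hM _)
    have hr := norm_nonneg (solverIter A b k).r
    have hb := norm_nonneg b
    have h5 : ‖b‖ ≤ 2 * M * ‖(solverIter A b k).s‖ := by nlinarith
    refine le_of_mul_le_mul_left ?_ hΛ0
    calc Λ * ‖(solverIter A b k).r‖ ≤ 4 * M * ‖(solverIter A b k).s‖ := by linarith
      _ ≤ Λ * τ * ‖(solverIter A b k).s‖ := by gcongr
      _ = _ := by ring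
  refine ⟨⟨_, hmem⟩, ?_⟩
  calc ((sInf (solverStops A b τ) : ℕ) : ℝ) ≤ (⌈x⌉₊ : ℝ) := by exact_mod_cast Nat.sInf_le hmem
    _ ≤ x + 1 := (Nat.ceil_lt_add_one hx0).le

theorem linearSolver_residual {A : Mat ι} {b : Vec ι} {τ : ℝ} (h : (solverStops A b τ).Nonempty) :
    ‖b - matVec A (linearSolver A b τ)‖ ≤ τ * ‖linearSolver A b τ‖ := by
  have := Nat.sInf_mem h
  simp only [solverStops, Set.mem_ofPred_eq] at this
  rwa [solverIter_residual] at this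

end Solver

end QNPE

/-! ### Krylov approximation of an extremal eigenvalue. -/

namespace QNPE

open Polynomial

/-! ### Chebyshev polynomials of the fourth kind -/

/-- The Chebyshev polynomials of the fourth kind. -/
def chebW : ℕ → ℝ[X]
  | 0 => 1
  | 1 => 2 * X + 1
  | n + 2 => 2 * X * chebW (n + 1) - chebW n

theorem natDegree_chebW_le (n : ℕ) : (chebW n).natDegree ≤ n := by
  induction n using Nat.twoStepInduction with
  | zero => simp [chebW]
  | one => simp only [chebW]; compute_degree
  | more n h1 h2 =>
    rw [chebW]
    refine (natDegree_sub_le _ _).trans (max_le ?_ (by omega))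
    refine natDegree_mul_le.trans ?_
    have : (2 * X : ℝ[X]).natDegree ≤ 1 := by compute_degree
    omega

theorem chebW_eval_cos (n : ℕ) (x : ℝ) :
    (chebW n).eval (Real.cos (2 * x)) * Real.sin x = Real.sin ((2 * n + 1) * x) := by
  induction n using Nat.twoStepInduction with
  | zero => simp [chebW]
  | one =>
    simp only [chebW, eval_add, eval_mul, eval_X, eval_one, eval_ofNat]
    rw [show (2 * ((1 : ℕ) : ℝ) + 1) * x = 2 * x + x by push_cast; ring, Real.sin_add,
      Real.sin_two_mul, Real.cos_two_mul]
    ring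
  | more n h1 h2 =>
    simp only [chebW, eval_sub, eval_mul, eval_X, eval_ofNat]
    rw [sub_mul, h1, mul_assoc, h2]
    push_cast
    rw [show (2 * ((n : ℝ) + 2) + 1) * x = (2 * (n + 1) + 1) * x + 2 * x by ring,
      show (2 * (n : ℝ) + 1) * x = (2 * (n + 1) + 1) * x - 2 * x by ring, Real.sin_add,
      Real.sin_sub]
    ring

theorem chebW_eval_cosh (n : ℕ) (x : ℝ) :
    (chebW n).eval (Real.cosh (2 * x)) * Real.sinh x = Real.sinh ((2 * n + 1) * x) := by
  induction n using Nat.twoStepInduction with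
  | zero => simp [chebW]
  | one =>
    simp only [chebW, eval_add, eval_mul, eval_X, eval_one, eval_ofNat]
    rw [show (2 * ((1 : ℕ) : ℝ) + 1) * x = 2 * x + x by push_cast; ring, Real.sinh_add,
      Real.sinh_two_mul, Real.cosh_two_mul, Real.cosh_sq]
    ring_nf
    rw [Real.cosh_sq]
    ring
  | more n h1 h2 =>
    simp only [chebW, eval_sub, eval_mul, eval_X, eval_ofNat]
    rw [sub_mul, h1, mul_assoc, h2]
    push_cast
    rw [show (2 * ((n : ℝ) + 2) + 1) * x = (2 * (n + 1) + 1) * x + 2 * x by ring,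
      show (2 * (n : ℝ) + 1) * x = (2 * (n + 1) + 1) * x - 2 * x by ring, Real.sinh_add,
      Real.sinh_sub]
    ring

/-- For `y = cos (2 x)` the weight `(1 - y) / 2` is `sin² x`, and the product is `sin² ((2 n + 1)
x)`. This weight is the factor `τ - t` in the eigenvalue bound, which is why the fourth kind is
used. -/
theorem chebW_bound (n : ℕ) {y : ℝ} (h1 : -1 ≤ y) (h2 : y ≤ 1) :
    (1 - y) / 2 * (chebW n).eval y ^ 2 ≤ 1 := by
  have hy : Real.cos (2 * (Real.arccos y / 2)) = y := by
    rw [mul_div_cancel₀ _ (two_ne_zero' ℝ), Real.cos_arccos h1 h2]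
  have h := chebW_eval_cos n (Real.arccos y / 2)
  have hs : Real.sin (Real.arccos y / 2) ^ 2 = (1 - y) / 2 := by
    have := Real.cos_two_mul (Real.arccos y / 2)
    have h3 := Real.sin_sq_add_cos_sq (Real.arccos y / 2)
    rw [hy] at this
    linarith
  rw [hy] at h
  rw [← hs, mul_comm, ← mul_pow, h]
  exact Real.sin_sq_le_one _

/-! ### The error bound for Krylov approximations of an extremal eigenvalue -/

section Krylov

variable {E : Type*} [NormedAddCommGroup E] [InnerProductSpace ℝ E]

theorem inner_aeval_left {K : Module.End ℝ E} (hK : K.IsSymmetric) (P : ℝ[X]) (x y : E) :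
    inner ℝ (aeval K P x) y = inner ℝ x (aeval K P y) := by
  induction P using Polynomial.induction_on' with
  | add p q hp hq => simp [inner_add_right, inner_add_left, hp, hq]
  | monomial k a =>
    simp only [aeval_monomial, Module.End.mul_apply, Module.algebraMap_end_apply,
      inner_smul_right, inner_smul_left, conj_trivial]
    congr 1
    induction k generalizing x y with
    | zero => simp
    | succ k ih =>
      rw [pow_succ, Module.End.mul_apply, ih, hK]
      simp only [← Module.End.mul_apply, ← pow_succ', ← pow_succ]

theorem aeval_apply_eigenvector {K : Module.End ℝ E} {e : E} {L : ℝ} (he : K e = L • e)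
    (P : ℝ[X]) : aeval K P e = P.eval L • e := by
  induction P using Polynomial.induction_on' with
  | add p q hp hq => simp [hp, hq, add_smul]
  | monomial k a =>
    simp only [aeval_monomial, Module.End.mul_apply, Module.algebraMap_end_apply, eval_monomial,
      mul_smul]
    congr 1
    induction k with
    | zero => simp
    | succ k ih => rw [pow_succ, Module.End.mul_apply, he, map_smul, ih, smul_smul, ← pow_succ']

variable [FiniteDimensional ℝ E]

theorem inner_aeval_self_le {K : Module.End ℝ E} (hK : K.IsSymmetric) {Q : ℝ[X]} {m M c : ℝ}
    (hm : ∀ x, m * ‖x‖ ^ 2 ≤ inner ℝ (K x) x) (hM : ∀ x, inner ℝ (K x) x ≤ M * ‖x‖ ^ 2)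
    (hQ : ∀ t ∈ Set.Icc m M, Q.eval t ≤ c) (x : E) :
    inner ℝ (aeval K Q x) x ≤ c * ‖x‖ ^ 2 := by
  obtain ⟨n, hn⟩ : ∃ n, Module.finrank ℝ E = n := ⟨_, rfl⟩
  set e := hK.eigenvectorBasis hn
  have hl : ∀ i, inner ℝ (K (e i)) (e i) = hK.eigenvalues hn i := fun i => by
    rw [hK.apply_eigenvectorBasis, inner_smul_left]
    simp [e]
  rw [← sum_sq_inner_basis e, Finset.mul_sum, ← e.sum_inner_mul_inner]
  refine Finset.sum_le_sum fun i _ => ?_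
  rw [real_inner_comm, inner_eigenvectorBasis_aeval, mul_assoc, ← sq]
  have h1 := hm (e i)
  have h2 := hM (e i)
  rw [hl, e.norm_eq_one] at h1 h2
  exact mul_le_mul_of_nonneg_right (hQ _ ⟨by linarith, by linarith⟩) (sq_nonneg _)

/-- If all Rayleigh quotients on the Krylov space stay below `τ = L (1 - 2 s²)`, then `(τ - K)
P(K)²` has nonnegative form at `v` for every admissible `P`. Split `v = a e + w` with `w ⟂ e`. For
the fourth-kind polynomial rescaled so that `τ ↦ 1` and `L ↦ cosh (2 s)`, the part along `e`
contributes `-c a² sinh² ((2 n + 1) s)` and `w` at most `c (1 - a²)`. Hence `a² cosh² ≤ 1`: the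
start vector is almost orthogonal to `e`. -/
theorem krylov_eigenvalue_bound {K : Module.End ℝ E} (hK : K.IsSymmetric) {L s θ : ℝ} {e v : E}
    {n : ℕ} (hL : 0 < L) (hs : 0 < s) (hKL : ∀ x, |inner ℝ (K x) x| ≤ L * ‖x‖ ^ 2)
    (he : K e = L • e) (he1 : ‖e‖ = 1) (hv : ‖v‖ = 1)
    (hθ : ∀ P : ℝ[X], P.natDegree ≤ n →
      inner ℝ (K (aeval K P v)) (aeval K P v) ≤ θ * ‖aeval K P v‖ ^ 2)
    (hfail : θ < L * (1 - 2 * s ^ 2)) :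
    |inner ℝ e v| * Real.cosh ((2 * n + 1) * s) ≤ 1 := by
  set τ := L * (1 - 2 * s ^ 2) with hτ
  set a := inner ℝ e v with ha
  set w := v - a • e with hw
  have hLτ : 0 < L - τ := by rw [hτ]; nlinarith [mul_pos hL (pow_pos hs 2)]
  have hsinh : 0 < Real.sinh s := Real.sinh_pos_iff.2 hs
  set b := 2 * Real.sinh s ^ 2 / (L - τ) with hb
  set P : ℝ[X] := (chebW n).comp (C (1 - b * τ) + C b * X) with hP
  have hPeval : ∀ t, P.eval t = (chebW n).eval (1 - b * τ + b * t) := fun t => by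
    simp [hP, eval_comp]
  have hdeg : P.natDegree ≤ n := by
    rw [hP, natDegree_comp]
    have h2 : (C (1 - b * τ) + C b * X : ℝ[X]).natDegree ≤ 1 := by compute_degree
    nlinarith [natDegree_chebW_le n]
  have hbL : b * (L - τ) = 2 * Real.sinh s ^ 2 := by rw [hb]; field_simp
  have hb0 : 0 < b := by positivity
  have hew : inner ℝ e w = 0 := by
    rw [hw, inner_sub_right, inner_smul_right, real_inner_self_eq_norm_sq, he1, ← ha]; ring
  have hvw : v = a • e + w := by rw [hw]; abel
  have hnw : ‖w‖ ^ 2 = 1 - a ^ 2 := by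
    have := norm_add_sq_real (a • e) w
    rw [← hvw, hv, inner_smul_left, hew, norm_smul, he1, mul_one, Real.norm_eq_abs, sq_abs] at this
    simp only [conj_trivial, mul_zero, add_zero] at this
    linarith
  -- the form of `τ - K` at `P(K) v`
  set Q : ℝ[X] := (C τ - X) * P ^ 2 with hQ
  have hform : ∀ x, inner ℝ (aeval K Q x) x =
      τ * ‖aeval K P x‖ ^ 2 - inner ℝ (K (aeval K P x)) (aeval K P x) := fun x => by
    have : aeval K Q x = aeval K P (τ • aeval K P x - K (aeval K P x)) := by
      rw [hQ, sq, mul_comm, mul_assoc, mul_comm P (C τ - X), map_mul, map_mul,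
        Module.End.mul_apply, Module.End.mul_apply]
      simp [Module.algebraMap_end_apply]
    rw [this, inner_aeval_left hK, inner_sub_left, inner_smul_left, real_inner_self_eq_norm_sq]
    simp
  have h1 : 0 ≤ inner ℝ (aeval K Q v) v := by
    rw [hform]
    have := hθ P hdeg
    nlinarith [sq_nonneg ‖aeval K P v‖]
  have h2 : inner ℝ (aeval K Q v) v = a ^ 2 * Q.eval L + inner ℝ (aeval K Q w) w := by
    have h3 : inner ℝ e (aeval K Q w) = 0 := by
      rw [← inner_aeval_left hK, aeval_apply_eigenvector he, inner_smul_left, hew, mul_zero]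
    conv_lhs => rw [hvw]
    rw [map_add, map_smul, aeval_apply_eigenvector he, inner_add_left, inner_add_right,
      inner_add_right]
    simp only [inner_smul_left, inner_smul_right, conj_trivial]
    rw [hew, real_inner_comm e (aeval K Q w), h3, real_inner_self_eq_norm_sq, he1]
    ring
  set c := (L - τ) / Real.sinh s ^ 2 with hc
  have hc0 : 0 < c := by positivity
  have hbc : b * c = 2 := by rw [hb, hc]; field_simp
  have h3 : inner ℝ (aeval K Q w) w ≤ c * ‖w‖ ^ 2 := by
    refine inner_aeval_self_le hK (m := -L) (M := L) (fun x => ?_) (fun x => ?_) (fun t ht => ?_) w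
    · have := (abs_le.1 (hKL x)).1
      linarith
    · exact (abs_le.1 (hKL x)).2
    · rw [hQ]
      simp only [eval_mul, eval_sub, eval_C, eval_X, eval_pow]
      rcases le_total t τ with htτ | htτ
      swap
      -- Beyond `τ` the factor `τ - t` is nonpositive, so the size of `P` does not matter there.
      · nlinarith [sq_nonneg (P.eval t)]
      have hy1 : 1 - b * τ + b * t ≤ 1 := by nlinarith
      -- The far end `-L` is mapped to at least `-1` exactly when `sinh² s (1 - s²) ≤ s²`, which
      -- rearranges to `tanh² s ≤ s²`.
      have hy2 : -1 ≤ 1 - b * τ + b * t := by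
        have h4 : b * (-L) ≤ b * t := by gcongr; exact ht.1
        have h5 : b * (L + τ) * (L - τ) ≤ 2 * (L - τ) := by
          rw [mul_right_comm, hbL]
          have h6 := sinh_sq_le hs.le
          rw [Real.cosh_sq] at h6
          have h7 : Real.sinh s ^ 2 * (1 - s ^ 2) ≤ s ^ 2 := by linarith
          rw [hτ]
          nlinarith
        have h6 : b * (L + τ) ≤ 2 := le_of_mul_le_mul_right h5 hLτ
        linarith
      have := chebW_bound n hy2 hy1
      rw [← hPeval] at this
      have h4 : τ - t = c * ((1 - (1 - b * τ + b * t)) / 2) := by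
        rw [show c * ((1 - (1 - b * τ + b * t)) / 2) = b * c * (τ - t) / 2 by ring, hbc]; ring
      rw [h4, mul_assoc]
      nlinarith
  have h4 : Q.eval L = - (c * Real.sinh ((2 * n + 1) * s) ^ 2) := by
    rw [hQ]
    simp only [eval_mul, eval_sub, eval_C, eval_X, eval_pow]
    rw [hPeval, show 1 - b * τ + b * L = Real.cosh (2 * s) by
      rw [Real.cosh_two_mul, Real.cosh_sq]; linarith, ← chebW_eval_cosh, hc]
    field_simp
    ring
  rw [h2, h4] at h1
  rw [hnw] at h3
  have h5 : c * (a ^ 2 * Real.cosh ((2 * n + 1) * s) ^ 2) ≤ c * 1 := by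
    rw [Real.cosh_sq]
    linarith
  have h6 := le_of_mul_le_mul_left h5 hc0
  rw [← mul_pow] at h6
  have := (sq_le_one_iff_abs_le_one _).1 h6
  rwa [abs_mul, abs_of_pos (Real.cosh_pos _)] at this

end Krylov

/-! ### Eigenvalues of symmetric matrices -/

section Eigenvalues

variable {ι : Type} [Fintype ι] [DecidableEq ι]

theorem mem_eigenvalueSet {T : Mat ι} {x : ℝ} :
    x ∈ eigenvalueSet T ↔ ∃ z : Vec ι, z ≠ 0 ∧ matVec T z = x • z := by
  constructor
  · intro h
    obtain ⟨z, hz⟩ := Module.End.HasEigenvalue.exists_hasEigenvector h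
    refine ⟨WithLp.toLp 2 z, by simpa using hz.2, ?_⟩
    have := hz.apply_eq_smul
    rw [Matrix.toLin'_apply] at this
    simp [matVec, this]
  · rintro ⟨z, hz, h⟩
    refine Module.End.hasEigenvalue_of_hasEigenvector (x := z.ofLp)
      ⟨Module.End.mem_eigenspace_iff.2 ?_, by simpa using hz⟩
    rw [Matrix.toLin'_apply]
    exact congrArg WithLp.ofLp h

theorem eigenvalueSet_neg (T : Mat ι) : eigenvalueSet (-T) = -eigenvalueSet T := by
  ext x
  rw [Set.mem_neg, mem_eigenvalueSet, mem_eigenvalueSet]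
  refine exists_congr fun z => and_congr_right fun _ => ?_
  rw [matVec_mneg, neg_smul, neg_eq_iff_eq_neg]

omit [Fintype ι] [DecidableEq ι] in
theorem isHermitian_of_isSymm {T : Mat ι} (hT : T.IsSymm) : T.IsHermitian := by
  rw [Matrix.IsHermitian, Matrix.conjTranspose_eq_transpose_of_trivial]; exact hT

/-- An orthonormal eigenbasis of a symmetric matrix. -/
theorem exists_eigenbasis {T : Mat ι} (hT : T.IsSymm) :
    ∃ (e : OrthonormalBasis ι ℝ (Vec ι)) (l : ι → ℝ), ∀ i, matVec T (e i) = l i • e i :=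
  ⟨(isHermitian_of_isSymm hT).eigenvectorBasis, (isHermitian_of_isSymm hT).eigenvalues, fun i => by
    have := (isHermitian_of_isSymm hT).mulVec_eigenvectorBasis i
    simp [matVec, this]⟩

omit [DecidableEq ι] in
theorem inner_matVec_eq_sum {T : Mat ι} (hT : T.IsSymm) {e : OrthonormalBasis ι ℝ (Vec ι)}
    {l : ι → ℝ} (h : ∀ i, matVec T (e i) = l i • e i) (x : Vec ι) :
    inner ℝ (matVec T x) x = ∑ i, l i * inner ℝ (e i) x ^ 2 := by
  rw [← e.sum_inner_mul_inner]
  refine Finset.sum_congr rfl fun i _ => ?_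
  rw [inner_matVec, hT.eq, h, inner_smul_right, real_inner_comm]
  ring

omit [DecidableEq ι] in
theorem norm_sq_eq_sum (e : OrthonormalBasis ι ℝ (Vec ι)) (x : Vec ι) :
    ‖x‖ ^ 2 = ∑ i, inner ℝ (e i) x ^ 2 := by
  have := e.sum_sq_norm_inner_right x
  simpa using this.symm

theorem eigenvalueSet_subset_range {T : Mat ι} (hT : T.IsSymm)
    {e : OrthonormalBasis ι ℝ (Vec ι)} {l : ι → ℝ} (h : ∀ i, matVec T (e i) = l i • e i) :
    eigenvalueSet T ⊆ Set.range l := by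
  intro x hx
  obtain ⟨z, hz, hTz⟩ := mem_eigenvalueSet.1 hx
  by_contra hne
  refine hz ?_
  rw [← norm_eq_zero, ← sq_eq_zero_iff, norm_sq_eq_sum e]
  refine Finset.sum_eq_zero fun i _ => ?_
  have h1 : inner ℝ (matVec T (e i)) z = inner ℝ (e i) (matVec T z) := by
    rw [inner_matVec, hT.eq]
  rw [h, hTz, inner_smul_left, inner_smul_right, conj_trivial] at h1
  have h2 : l i ≠ x := fun h2 => hne ⟨i, h2⟩
  have h3 : (l i - x) * inner ℝ (e i) z = 0 := by linarith
  simpa [sub_ne_zero.2 h2] using h3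

theorem finite_eigenvalueSet {T : Mat ι} (hT : T.IsSymm) : (eigenvalueSet T).Finite := by
  obtain ⟨e, l, h⟩ := exists_eigenbasis hT
  exact (Set.finite_range l).subset (eigenvalueSet_subset_range hT h)

theorem eigenvalueSet_nonempty [Nonempty ι] {T : Mat ι} (hT : T.IsSymm) :
    (eigenvalueSet T).Nonempty := by
  obtain ⟨e, l, h⟩ := exists_eigenbasis hT
  obtain ⟨i⟩ := ‹Nonempty ι›
  exact ⟨l i, mem_eigenvalueSet.2 ⟨e i, e.orthonormal.ne_zero i, h i⟩⟩

theorem inner_matVec_le_sSup {T : Mat ι} (hT : T.IsSymm) (x : Vec ι) :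
    inner ℝ (matVec T x) x ≤ sSup (eigenvalueSet T) * ‖x‖ ^ 2 := by
  obtain ⟨e, l, h⟩ := exists_eigenbasis hT
  rw [inner_matVec_eq_sum hT h, norm_sq_eq_sum e, Finset.mul_sum]
  refine Finset.sum_le_sum fun i _ => mul_le_mul_of_nonneg_right ?_ (sq_nonneg _)
  exact le_csSup (finite_eigenvalueSet hT).bddAbove
    (mem_eigenvalueSet.2 ⟨e i, e.orthonormal.ne_zero i, h i⟩)

theorem sSup_eigenvalueSet_le_iff [Nonempty ι] {T : Mat ι} (hT : T.IsSymm) {a : ℝ} :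
    sSup (eigenvalueSet T) ≤ a ↔ ∀ x, inner ℝ (matVec T x) x ≤ a * ‖x‖ ^ 2 := by
  refine ⟨fun h x => (inner_matVec_le_sSup hT x).trans (by gcongr), fun h => ?_⟩
  refine csSup_le (eigenvalueSet_nonempty hT) fun y hy => ?_
  obtain ⟨z, hz, hTz⟩ := mem_eigenvalueSet.1 hy
  have := h z
  rw [hTz, inner_smul_left, real_inner_self_eq_norm_sq, conj_trivial] at this
  exact le_of_mul_le_mul_right this (by positivity)

theorem sInf_eigenvalueSet (T : Mat ι) :
    sInf (eigenvalueSet T) = -sSup (eigenvalueSet (-T)) := by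
  rw [Real.sInf_def, eigenvalueSet_neg]

/-- A symmetric matrix attains its numerical radius at a unit eigenvector. -/
theorem exists_extremal_eigenvector [Nonempty ι] {T : Mat ι} (hT : T.IsSymm) :
    ∃ (L : ℝ) (e : Vec ι), 0 ≤ L ∧ ‖e‖ = 1 ∧ (matVec T e = L • e ∨ matVec (-T) e = L • e) ∧
      ∀ x, |inner ℝ (matVec T x) x| ≤ L * ‖x‖ ^ 2 := by
  obtain ⟨e, l, h⟩ := exists_eigenbasis hT
  obtain ⟨i, -, hi⟩ := Finset.exists_max_image Finset.univ (fun i => |l i|) Finset.univ_nonempty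
  refine ⟨|l i|, e i, abs_nonneg _, e.norm_eq_one i, ?_, fun x => ?_⟩
  · rcases abs_choice (l i) with h' | h' <;> rw [h']
    · exact Or.inl (h i)
    · exact Or.inr (by rw [matVec_mneg, h, neg_smul])
  · rw [inner_matVec_eq_sum hT h, norm_sq_eq_sum e, Finset.mul_sum]
    refine (Finset.abs_sum_le_sum_abs _ _).trans (Finset.sum_le_sum fun j _ => ?_)
    rw [abs_mul, abs_of_nonneg (sq_nonneg (inner ℝ (e j) x))]
    exact mul_le_mul_of_nonneg_right (hi j (Finset.mem_univ j)) (sq_nonneg _)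

end Eigenvalues

end QNPE

/-! ### The Lanczos method and the accuracy of the two separation oracles. -/

namespace QNPE

open Polynomial

/-! ### The Lanczos method -/

section Lanczos

variable {ι : Type} [Fintype ι]

theorem lanczos_prev_succ (M : Mat ι) (v : Vec ι) (k : ℕ) :
    (lanczos M v (k + 1)).prev = (lanczos M v k).cur := rfl

/-- At breakdown the coefficient and the unnormalized vector `w` vanish together, so the three-term
recurrence needs no exception. -/
theorem matVec_lanczos (M : Mat ι) (v : Vec ι) (k : ℕ) :
    matVec M (lanczos M v k).cur = (lanczos M v (k + 1)).β • (lanczos M v (k + 1)).cur +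
      (lanczos M v k).α M • (lanczos M v k).cur + (lanczos M v k).β • (lanczos M v k).prev := by
  simp only [lanczos]
  set w := matVec M (lanczos M v k).cur - (lanczos M v k).β • (lanczos M v k).prev -
    (lanczos M v k).α M • (lanczos M v k).cur with hw
  rw [smul_smul]
  rcases eq_or_ne w 0 with h | h
  · rw [h, norm_zero, zero_mul, zero_smul, zero_add]
    rw [h] at hw
    rw [← sub_eq_zero, hw]
    abel
  · rw [mul_inv_cancel₀ (norm_ne_zero_iff.2 h), one_smul, hw]
    abel

theorem lanczos_norm_cur {M : Mat ι} {v : Vec ι} (hv : ‖v‖ = 1) (k : ℕ) :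
    ‖(lanczos M v k).cur‖ = 1 ∨ ((lanczos M v k).cur = 0 ∧ (lanczos M v k).β = 0) := by
  cases k with
  | zero => exact Or.inl hv
  | succ k =>
    simp only [lanczos]
    set w := matVec M (lanczos M v k).cur - (lanczos M v k).β • (lanczos M v k).prev -
      (lanczos M v k).α M • (lanczos M v k).cur with hw
    rcases eq_or_ne w 0 with h | h
    · right; simp [h]
    · left
      rw [norm_smul, norm_inv, norm_norm, inv_mul_cancel₀ (norm_ne_zero_iff.2 h)]

theorem lanczos_β_smul_norm {M : Mat ι} {v : Vec ι} (hv : ‖v‖ = 1) (k : ℕ) :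
    (lanczos M v k).β * ‖(lanczos M v k).cur‖ ^ 2 = (lanczos M v k).β := by
  rcases lanczos_norm_cur (M := M) hv k with h | h
  · simp [h]
  · simp [h.2]

theorem lanczos_β_zero_of_cur {M : Mat ι} {v : Vec ι} (hv : ‖v‖ = 1) {k : ℕ}
    (h : (lanczos M v k).cur = 0) : (lanczos M v k).β = 0 ∧ (lanczos M v (k + 1)).β = 0 ∧
      (lanczos M v (k + 1)).cur = 0 := by
  have hβ : (lanczos M v k).β = 0 := by
    rcases lanczos_norm_cur (M := M) hv k with h' | h'
    · rw [h, norm_zero] at h'; exact absurd h' zero_ne_one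
    · exact h'.2
  exact ⟨hβ, by simp [lanczos, h, hβ], by simp [lanczos, h, hβ]⟩

theorem lanczos_β_succ_mul_norm {M : Mat ι} {v : Vec ι} (hv : ‖v‖ = 1) (k : ℕ) :
    (lanczos M v (k + 1)).β * ‖(lanczos M v k).cur‖ ^ 2 = (lanczos M v (k + 1)).β := by
  rcases lanczos_norm_cur (M := M) hv k with h | h
  · simp [h]
  · simp [(lanczos_β_zero_of_cur (M := M) hv h.1).2.1]

/-- Symmetry moves `M` onto the `j`-th vector, where the recurrence leaves only neighbours; the two
subtracted terms cancel the overlaps with the last two vectors. Vectors after breakdown are zero,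
and the `β` identities above cover that case. -/
theorem lanczos_orthogonal {M : Mat ι} (hM : M.IsSymm) {v : Vec ι} (hv : ‖v‖ = 1) (k : ℕ) :
    ∀ j < k, inner ℝ (lanczos M v k).cur (lanczos M v j).cur = 0 := by
  induction k using Nat.strong_induction_on with
  | _ k ih =>
    intro j hj
    obtain ⟨k, rfl⟩ := Nat.exists_eq_succ_of_ne_zero (Nat.ne_zero_of_lt hj)
    have ihs : ∀ a b, a ≤ k → b ≤ k → a ≠ b →
        inner ℝ (lanczos M v a).cur (lanczos M v b).cur = 0 := fun a b ha hb hab => by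
      rcases lt_or_gt_of_ne hab with h | h
      · rw [real_inner_comm]; exact ih b (by omega) a h
      · exact ih a (by omega) b h
    simp only [lanczos]
    rw [inner_smul_left]
    refine mul_eq_zero_of_right _ ?_
    rw [inner_sub_left, inner_smul_left, conj_trivial]
    rcases Nat.lt_succ_iff_lt_or_eq.1 hj with hjk | rfl
    · rw [ihs k j le_rfl (by omega) (by omega), mul_zero, sub_zero, inner_sub_left, inner_smul_left,
        conj_trivial, inner_matVec, hM.eq, matVec_lanczos, inner_add_right, inner_add_right,
        inner_smul_right, inner_smul_right, inner_smul_right,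
        ihs k j le_rfl (by omega) (by omega)]
      have h1 : (lanczos M v j).β * inner ℝ (lanczos M v k).cur (lanczos M v j).prev = 0 := by
        cases j with
        | zero => simp [lanczos]
        | succ j => rw [lanczos_prev_succ, ihs k j le_rfl (by omega) (by omega), mul_zero]
      rw [h1]
      obtain ⟨k, rfl⟩ := Nat.exists_eq_succ_of_ne_zero (Nat.ne_zero_of_lt hjk)
      rw [Nat.succ_eq_add_one, lanczos_prev_succ]
      rcases Nat.lt_succ_iff_lt_or_eq.1 hjk with hjk' | rfl
      · rw [ihs (k + 1) (j + 1) (by omega) (by omega) (by omega),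
          ihs k j (by omega) (by omega) (by omega)]
        simp
      · rw [real_inner_self_eq_norm_sq, real_inner_self_eq_norm_sq, lanczos_β_smul_norm hv,
          lanczos_β_succ_mul_norm hv]
        simp
    · rw [real_inner_self_eq_norm_sq]
      rcases lanczos_norm_cur (M := M) hv j with h | h
      · rw [h]; simp [LanczosState.α]
      · simp [h.1]

theorem lanczos_orthogonal_of_ne {M : Mat ι} (hM : M.IsSymm) {v : Vec ι} (hv : ‖v‖ = 1)
    {i j : ℕ} (hij : i ≠ j) : inner ℝ (lanczos M v i).cur (lanczos M v j).cur = 0 := by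
  rcases lt_or_gt_of_ne hij with h | h
  · rw [real_inner_comm]; exact lanczos_orthogonal hM hv j i h
  · exact lanczos_orthogonal hM hv i j h

theorem lanczosT_isSymm (M : Mat ι) (v : Vec ι) (N : ℕ) : (lanczosT M v N).IsSymm := by
  ext i j
  simp only [lanczosT, Matrix.transpose_apply, Matrix.of_apply]
  rcases eq_or_ne i j with rfl | hij
  · rfl
  · rw [if_neg hij, if_neg hij.symm]
    by_cases h1 : i.val + 1 = j.val
    · rw [if_pos h1, if_neg (by omega), if_pos h1]
    · rw [if_neg h1]
      by_cases h2 : j.val + 1 = i.val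
      · rw [if_pos h2, if_neg h1]
      · rw [if_neg h2, if_neg h1]

/-- The tridiagonal matrix is the compression of `M` to the Lanczos vectors; after breakdown both
sides are zero. -/
theorem inner_matVec_lanczos {M : Mat ι} (hM : M.IsSymm) {v : Vec ι} (hv : ‖v‖ = 1) {N : ℕ}
    (i j : Fin N) :
    inner ℝ (matVec M (lanczos M v i).cur) (lanczos M v j).cur = lanczosT M v N i j := by
  have key : ∀ a b : ℕ, a < b → inner ℝ (matVec M (lanczos M v a).cur) (lanczos M v b).cur =
      if a + 1 = b then (lanczos M v b).β else 0 := fun a b hab => by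
    rw [matVec_lanczos, inner_add_left, inner_add_left, inner_smul_left, inner_smul_left,
      inner_smul_left, lanczos_orthogonal_of_ne hM hv hab.ne]
    have h1 : (lanczos M v a).β * inner ℝ (lanczos M v a).prev (lanczos M v b).cur = 0 := by
      cases a with
      | zero => simp [lanczos]
      | succ a => rw [lanczos_prev_succ, lanczos_orthogonal_of_ne hM hv (by omega), mul_zero]
    simp only [conj_trivial]
    rw [h1]
    split_ifs with h
    · rw [h, real_inner_self_eq_norm_sq, lanczos_β_smul_norm hv]; ring
    · rw [lanczos_orthogonal_of_ne hM hv h]; ring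
  simp only [lanczosT, Matrix.of_apply]
  rcases lt_trichotomy i.val j.val with h | h | h
  · rw [key _ _ h, if_neg (fun h' : i = j => by rw [h'] at h; exact lt_irrefl _ h)]
    split_ifs <;> first | rfl | omega
  · have hij : i = j := Fin.ext h
    subst hij
    rw [if_pos rfl]
    rcases lanczos_norm_cur (M := M) hv i with h | h
    · simp only [LanczosState.α]
      rw [inner_sub_left, inner_smul_left]
      have h1 : (lanczos M v i).β * inner ℝ (lanczos M v i).prev (lanczos M v i).cur = 0 := by
        obtain ⟨i, hi⟩ := i
        cases i with
        | zero => simp [lanczos]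
        | succ a => rw [lanczos_prev_succ, lanczos_orthogonal_of_ne hM hv (by simp), mul_zero]
      rw [conj_trivial, h1, sub_zero]
    · simp [h.1, LanczosState.α]
  · rw [inner_matVec, hM.eq, real_inner_comm, key _ _ h, if_neg (fun h' : i = j => by rw [h'] at h; exact lt_irrefl _ h)]
    split_ifs <;> first | rfl | omega

theorem krylov_mem_span_lanczos (M : Mat ι) (v : Vec ι) (k : ℕ) :
    (matLin M ^ k) v ∈ Submodule.span ℝ ((fun j => (lanczos M v j).cur) '' Set.Iio (k + 1)) := by
  induction k with
  | zero => exact Submodule.subset_span ⟨0, by simp, rfl⟩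
  | succ k ih =>
    rw [pow_succ', Module.End.mul_apply]
    have hle : Submodule.span ℝ ((fun j => (lanczos M v j).cur) '' Set.Iio (k + 1)) ≤
        (Submodule.span ℝ ((fun j => (lanczos M v j).cur) '' Set.Iio (k + 2))).comap (matLin M) := by
      rw [Submodule.span_le]
      rintro _ ⟨j, hj, rfl⟩
      simp only [Set.mem_Iio] at hj
      have hsub : ∀ i < k + 2, (lanczos M v i).cur ∈
          Submodule.span ℝ ((fun j => (lanczos M v j).cur) '' Set.Iio (k + 2)) := fun i hi =>
        Submodule.subset_span ⟨i, hi, rfl⟩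
      simp only [Submodule.comap_coe, Set.mem_preimage, SetLike.mem_coe, matLin_apply]
      rw [matVec_lanczos]
      refine Submodule.add_mem _ (Submodule.add_mem _ (Submodule.smul_mem _ _ (hsub _ (by omega)))
        (Submodule.smul_mem _ _ (hsub _ (by omega)))) ?_
      cases j with
      | zero => simp [lanczos]
      | succ j => rw [lanczos_prev_succ]; exact Submodule.smul_mem _ _ (hsub _ (by omega))
    exact hle ih

/-- Krylov vectors have the same quadratic form as their coordinates in the Lanczos basis. -/
theorem exists_lanczos_coordinates {M : Mat ι} (hM : M.IsSymm) {v : Vec ι} (hv : ‖v‖ = 1) {N : ℕ}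
    {P : ℝ[X]} (hP : P.natDegree < N) :
    ∃ c : Vec (Fin N), ‖c‖ = ‖aeval (matLin M) P v‖ ∧
      inner ℝ (matVec M (aeval (matLin M) P v)) (aeval (matLin M) P v) =
        inner ℝ (matVec (lanczosT M v N) c) c := by
  set x := aeval (matLin M) P v with hx
  set u : Fin N → Vec ι := fun k => (lanczos M v k).cur with hu
  have hmem : x ∈ Submodule.span ℝ (Set.range u) := by
    rw [hx, aeval_eq_sum_range' hP, LinearMap.sum_apply]
    refine Submodule.sum_mem _ fun i hi => ?_
    rw [LinearMap.smul_apply]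
    refine Submodule.smul_mem _ _ ?_
    refine Submodule.span_mono ?_ (krylov_mem_span_lanczos M v i)
    rintro _ ⟨j, hj, rfl⟩
    simp only [Finset.mem_range, Set.mem_Iio] at hi hj
    exact ⟨⟨j, by omega⟩, rfl⟩
  obtain ⟨c₀, hc₀⟩ := (Submodule.mem_span_range_iff_exists_fun ℝ).1 hmem
  set c : Vec (Fin N) := WithLp.toLp 2 fun k => c₀ k * ‖u k‖ ^ 2 with hc
  have hnorm : ∀ k, ‖u k‖ = 1 ∨ u k = 0 := fun k =>
    (lanczos_norm_cur (M := M) hv k).imp id And.left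
  have horth : ∀ i j, i ≠ j → inner ℝ (u i) (u j) = 0 := fun i j hij =>
    lanczos_orthogonal_of_ne hM hv (fun h => hij (Fin.ext h))
  have hcx : x = ∑ k, c k • u k := by
    rw [← hc₀]
    refine Finset.sum_congr rfl fun k _ => ?_
    rcases hnorm k with h | h <;> simp [hc, h]
  refine ⟨c, ?_, ?_⟩
  · rw [← abs_of_nonneg (norm_nonneg c), ← abs_of_nonneg (norm_nonneg x), ← sq_eq_sq_iff_abs_eq_abs,
      ← real_inner_self_eq_norm_sq x, EuclideanSpace.norm_sq_eq]
    conv_rhs => rw [hcx]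
    rw [sum_inner]
    refine Finset.sum_congr rfl fun k _ => ?_
    rw [inner_sum, Finset.sum_eq_single k]
    · rw [inner_smul_left, inner_smul_right, real_inner_self_eq_norm_sq]
      rcases hnorm k with h | h
      · rw [h]; simp [sq]
      · simp [hc, h]
    · intro j _ hj
      rw [inner_smul_left, inner_smul_right, horth _ _ hj.symm]; simp
    · simp
  · conv_lhs => rw [hcx]
    rw [← matLin_apply, map_sum, sum_inner]
    rw [PiLp.inner_apply]
    refine Finset.sum_congr rfl fun i _ => ?_
    rw [inner_sum, matVec_apply]
    simp only [RCLike.inner_apply, conj_trivial]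
    rw [Finset.mul_sum]
    refine Finset.sum_congr rfl fun j _ => ?_
    rw [map_smul, inner_smul_left, inner_smul_right, matLin_apply, hu,
      inner_matVec_lanczos hM hv i j, conj_trivial]
    ring

theorem rayleigh_le_lanczosMax {M : Mat ι} (hM : M.IsSymm) {v : Vec ι} (hv : ‖v‖ = 1) {N : ℕ}
    {P : ℝ[X]} (hP : P.natDegree < N) :
    inner ℝ (matVec M (aeval (matLin M) P v)) (aeval (matLin M) P v) ≤
      lanczosMax M v N * ‖aeval (matLin M) P v‖ ^ 2 := by
  obtain ⟨c, hc, h⟩ := exists_lanczos_coordinates hM hv hP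
  rw [h, ← hc]
  exact inner_matVec_le_sSup (lanczosT_isSymm M v N) c

theorem rayleigh_neg_le_lanczosMin {M : Mat ι} (hM : M.IsSymm) {v : Vec ι} (hv : ‖v‖ = 1) {N : ℕ}
    {P : ℝ[X]} (hP : P.natDegree < N) :
    inner ℝ (matVec (-M) (aeval (matLin M) P v)) (aeval (matLin M) P v) ≤
      -lanczosMin M v N * ‖aeval (matLin M) P v‖ ^ 2 := by
  obtain ⟨c, hc, h⟩ := exists_lanczos_coordinates hM hv hP
  rw [matVec_mneg, inner_neg_left, h, ← hc, lanczosMin, sInf_eigenvalueSet, neg_neg,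
    ← inner_neg_left, ← matVec_mneg]
  refine inner_matVec_le_sSup ?_ c
  rw [Matrix.IsSymm, Matrix.transpose_neg, (lanczosT_isSymm M v N).eq]

/-! ### Accuracy of the Lanczos method -/

/-- With `s = √(δ / (2 (1 + δ)))` one has `√(2 (1 + 1/δ)) = 1 / s`. `N` iterations allow degree `N -
1`, hence `2 (N - 1) + 1 = 2 N - 1`; this accounts for the `1/2` in the step count. -/
theorem lanczosSteps_spec {n : ℕ} {δ q : ℝ} (hn : 0 < n) (hδ : 0 < δ) (hq0 : 0 < q) (hq1 : q ≤ 1) :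
    1 ≤ lanczosSteps n δ q ∧
      Real.log (√(11 * n) / q) ≤ (2 * ((lanczosSteps n δ q - 1 : ℕ) : ℝ) + 1) * √(δ / (2 * (1 + δ))) := by
  have hn' : (1 : ℝ) ≤ n := by exact_mod_cast hn
  have hq2 : q ^ 2 ≤ 1 := by nlinarith
  have hlog : 0 < Real.log (11 * n / q ^ 2) := by
    refine Real.log_pos ?_
    rw [one_lt_div (by positivity)]
    nlinarith
  have hle : 1 / 4 * √(2 * (1 + 1 / δ)) * Real.log (11 * n / q ^ 2) + 1 / 2 ≤ lanczosSteps n δ q :=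
    Nat.le_ceil _
  have hpos : 0 < 1 / 4 * √(2 * (1 + 1 / δ)) * Real.log (11 * n / q ^ 2) := by positivity
  have h1 : 1 ≤ lanczosSteps n δ q := by
    have : (0 : ℝ) < lanczosSteps n δ q := by linarith
    exact_mod_cast this
  refine ⟨h1, ?_⟩
  rw [Nat.cast_sub h1]
  have hs : √(2 * (1 + 1 / δ)) * √(δ / (2 * (1 + δ))) = 1 := by
    rw [← Real.sqrt_mul (by positivity), show 2 * (1 + 1 / δ) * (δ / (2 * (1 + δ))) = 1 by field_simp; ring,
      Real.sqrt_one]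
  have h2 : Real.log (√(11 * n) / q) = 1 / 2 * Real.log (11 * n / q ^ 2) := by
    rw [Real.log_div (by positivity) (by positivity), Real.log_div (by positivity) (by positivity),
      Real.log_sqrt (by positivity), Real.log_pow]
    push_cast
    ring
  rw [h2]
  set s := √(δ / (2 * (1 + δ)))
  have hs0 : 0 ≤ s := Real.sqrt_nonneg _
  calc 1 / 2 * Real.log (11 * n / q ^ 2)
      = 2 * (1 / 4 * √(2 * (1 + 1 / δ)) * Real.log (11 * n / q ^ 2)) * s := by
        linear_combination (-1 / 2 * Real.log (11 * n / q ^ 2)) * hs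
    _ ≤ (2 * ((lanczosSteps n δ q : ℝ) - (1 : ℕ)) + 1) * s := by
        gcongr
        push_cast
        linarith

/-- The value of `s` is fixed by `1 - 2 s² = 1 / (1 + δ)`. Were the accuracy missed,
`krylov_eigenvalue_bound` would bound `|⟨e, v⟩|` by `1 / cosh`, and the step count makes this at
most `2 q / √(11 n)`. -/
theorem krylov_accuracy {M : Mat ι} (hM : M.IsSymm) {v e : Vec ι} (hv : ‖v‖ = 1) {L θ δ q : ℝ}
    {n : ℕ} (hn : 0 < n) (hδ : 0 < δ) (hq0 : 0 < q) (hq1 : q ≤ 1) (hL : 0 ≤ L)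
    (hML : ∀ x, |inner ℝ (matVec M x) x| ≤ L * ‖x‖ ^ 2) (he : matVec M e = L • e) (he1 : ‖e‖ = 1)
    (hθ : ∀ P : ℝ[X], P.natDegree < lanczosSteps n δ q →
      inner ℝ (matVec M (aeval (matLin M) P v)) (aeval (matLin M) P v) ≤
        θ * ‖aeval (matLin M) P v‖ ^ 2)
    (hev : 2 * q / √(11 * n) < |inner ℝ e v|) : L ≤ (1 + δ) * θ := by
  obtain ⟨hN, hlog⟩ := lanczosSteps_spec hn hδ hq0 hq1
  rcases hL.eq_or_lt with rfl | hL
  · have h1 := hθ 1 (by simp; omega)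
    have h2 := hML v
    simp only [map_one, Module.End.one_apply, hv] at h1 h2
    have h3 := (abs_le.1 h2).1
    have : 0 ≤ θ := by linarith
    positivity
  by_contra! hlt
  have hn' : (0 : ℝ) < n := by exact_mod_cast hn
  set s := √(δ / (2 * (1 + δ))) with hs
  have hs0 : 0 < s := by positivity
  have hs2 : s ^ 2 = δ / (2 * (1 + δ)) := Real.sq_sqrt (by positivity)
  have hfail : θ < L * (1 - 2 * s ^ 2) := by
    rw [hs2, show L * (1 - 2 * (δ / (2 * (1 + δ)))) = L / (1 + δ) by field_simp; ring,
      lt_div_iff₀ (by positivity)]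
    linarith
  have h := krylov_eigenvalue_bound (matLin_isSymmetric hM) hL hs0 hML he he1 hv
    (n := lanczosSteps n δ q - 1) (fun P hP => hθ P (by omega)) hfail
  have hcosh : √(11 * n) / (2 * q) ≤
      Real.cosh ((2 * ((lanczosSteps n δ q - 1 : ℕ) : ℝ) + 1) * s) := by
    refine le_trans ?_ (half_exp_le_cosh _)
    rw [Real.log_le_iff_le_exp (by positivity)] at hlog
    rw [mul_comm 2 q, ← div_div]
    gcongr
  have h4 : 2 * q / √(11 * n) * (√(11 * n) / (2 * q)) = 1 := by field_simp
  have h5 : 2 * q / √(11 * n) * (√(11 * n) / (2 * q)) <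
      |inner ℝ e v| * Real.cosh ((2 * ((lanczosSteps n δ q - 1 : ℕ) : ℝ) + 1) * s) := by
    have h6 : 0 < √(11 * n) / (2 * q) := by positivity
    calc _ < |inner ℝ e v| * (√(11 * n) / (2 * q)) := by gcongr
      _ ≤ _ := by gcongr
  linarith

/-- `M` and `-M` have the same Krylov spaces, so one Lanczos run controls both ends of the spectrum.
-/
theorem aeval_matLin_neg (M : Mat ι) (P : ℝ[X]) (v : Vec ι) :
    aeval (matLin (-M)) P v = aeval (matLin M) (P.comp (-X)) v := by
  have : matLin (-M) = -matLin M := LinearMap.ext fun x => matVec_mneg M x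
  rw [aeval_comp, this]
  simp

end Lanczos

/-! ### Accuracy of the separation oracles -/

theorem symPart_isSymm {ι : Type} (W : Mat ι) : (symPart W).IsSymm := by
  rw [Matrix.IsSymm, symPart, Matrix.transpose_smul, Matrix.transpose_add,
    Matrix.transpose_transpose, add_comm]

theorem symPart_eq_self {ι : Type} {W : Mat ι} (hW : W.IsSymm) : symPart W = W := by
  rw [symPart, hW.eq, ← two_smul ℝ W, smul_smul]
  norm_num

theorem inner_symPart {ι : Type} [Fintype ι] (W : Mat ι) (x : Vec ι) :
    inner ℝ (matVec (symPart W) x) x = inner ℝ (matVec W x) x := by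
  rw [symPart, matVec_msmul, matVec_madd, inner_smul_left, inner_add_left,
    inner_matVec W.transpose, Matrix.transpose_transpose, real_inner_comm (matVec W x) x, conj_trivial]
  ring

/-- Away from a thin slab of start vectors, `ExtEvec` bounds the numerical radius. -/
theorem extEvec_accuracy {d : ℕ} (hd : 0 < d) (W : Mat (Fin d)) {δ q : ℝ} (hδ : 0 < δ)
    (hq0 : 0 < q) (hq1 : q ≤ 1) :
    ∃ e : Vec (Fin d), ‖e‖ = 1 ∧ ∀ v : Vec (Fin d), ‖v‖ = 1 →
      2 * q / √(11 * d) < |inner ℝ e v| →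
      ∀ x, |inner ℝ (matVec W x) x| ≤ (1 + δ) * (extEvec W δ q v).1 * ‖x‖ ^ 2 := by
  have : Nonempty (Fin d) := ⟨⟨0, hd⟩⟩
  obtain ⟨L, e, hL, he1, he, hLM⟩ := exists_extremal_eigenvector (symPart_isSymm W)
  refine ⟨e, he1, fun v hv hev => ?_⟩
  have hM := symPart_isSymm W
  suffices h : L ≤ (1 + δ) * (extEvec W δ q v).1 from fun x => by
    rw [← inner_symPart]
    exact (hLM x).trans (by gcongr)
  rcases he with he | he
  · refine (krylov_accuracy hM hv hd hδ hq0 hq1 hL hLM he he1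
      (fun P hP => rayleigh_le_lanczosMax hM hv hP) hev).trans ?_
    gcongr
    exact le_max_left _ _
  · have hM' : (-symPart W).IsSymm := by rw [Matrix.IsSymm, Matrix.transpose_neg, hM.eq]
    refine (krylov_accuracy hM' hv hd hδ hq0 hq1 hL (fun x => ?_) he he1
      (θ := -lanczosMin (symPart W) v (lanczosSteps d δ q)) (fun P hP => ?_) hev).trans ?_
    · rw [matVec_mneg, inner_neg_left, abs_neg]; exact hLM x
    · rw [aeval_matLin_neg]
      refine rayleigh_neg_le_lanczosMin hM hv ?_
      rw [natDegree_comp]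
      simpa using hP
    · gcongr
      exact le_max_right _ _

section Dilation

variable {d : ℕ}

/-- The symmetric dilation `[0, W; Wᵀ, 0]`. -/
def dilation (W : Mat (Fin d)) : Mat (Fin d ⊕ Fin d) := Matrix.fromBlocks 0 W W.transpose 0

theorem dilation_isSymm (W : Mat (Fin d)) : (dilation W).IsSymm := by
  rw [Matrix.IsSymm, dilation, Matrix.fromBlocks_transpose]
  simp

/-- The vector with blocks `x` and `y`. -/
def joinVec (x y : Vec (Fin d)) : Vec (Fin d ⊕ Fin d) := WithLp.toLp 2 (Sum.elim x.ofLp y.ofLp)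

theorem matVec_dilation_join (W : Mat (Fin d)) (x y : Vec (Fin d)) :
    matVec (dilation W) (joinVec x y) = joinVec (matVec W y) (matVec W.transpose x) := by
  simp [matVec, dilation, joinVec, Matrix.fromBlocks_mulVec]

theorem inner_joinVec (x y x' y' : Vec (Fin d)) :
    inner ℝ (joinVec x y) (joinVec x' y') = inner ℝ x x' + inner ℝ y y' := by
  simp [joinVec, PiLp.inner_apply]

theorem exists_joinVec (u : Vec (Fin d ⊕ Fin d)) : ∃ x y, u = joinVec x y :=
  ⟨WithLp.toLp 2 fun i => u (Sum.inl i), WithLp.toLp 2 fun i => u (Sum.inr i), by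
    ext i; cases i <;> rfl⟩

/-- The form is tested on the vector whose blocks are `W x`, rescaled to length `‖x‖`, and `x`: its
value is `2 ‖x‖ ‖W x‖`, against `2 L ‖x‖ ^ 2`. -/
theorem norm_matVec_le_of_dilation {W : Mat (Fin d)} {L : ℝ} (hL : 0 ≤ L)
    (h : ∀ u, |inner ℝ (matVec (dilation W) u) u| ≤ L * ‖u‖ ^ 2) (x : Vec (Fin d)) :
    ‖matVec W x‖ ≤ L * ‖x‖ := by
  rcases eq_or_ne (matVec W x) 0 with h0 | h0
  · rw [h0, norm_zero]; positivity
  have hx : x ≠ 0 := fun hx => h0 (by rw [hx, matVec_vzero])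
  have hxn : 0 < ‖x‖ := norm_pos_iff.2 hx
  have hwn : 0 < ‖matVec W x‖ := norm_pos_iff.2 h0
  have h1 := (abs_le.1 (h (joinVec ((‖x‖ / ‖matVec W x‖) • matVec W x) x))).2
  rw [matVec_dilation_join, inner_joinVec, inner_matVec W.transpose, Matrix.transpose_transpose,
    ← real_inner_self_eq_norm_sq, inner_joinVec, inner_smul_left, inner_smul_right, inner_smul_right,
    inner_smul_left] at h1
  simp only [real_inner_self_eq_norm_sq, conj_trivial] at h1
  field_simp at h1
  nlinarith

/-- Away from a thin slab of start vectors, `MaxSvec` bounds the operator norm. -/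
theorem maxSvec_accuracy (hd : 0 < d) (W : Mat (Fin d)) {δ q : ℝ} (hδ : 0 < δ)
    (hq0 : 0 < q) (hq1 : q ≤ 1) :
    ∃ e : Vec (Fin d ⊕ Fin d), ‖e‖ = 1 ∧ ∀ v : Vec (Fin d ⊕ Fin d), ‖v‖ = 1 →
      2 * q / √(11 * (2 * d : ℕ)) < |inner ℝ e v| →
      ∀ x, ‖matVec W x‖ ≤ (1 + δ) * (3 * (maxSvec W δ q v).1) * ‖x‖ := by
  have : Nonempty (Fin d) := ⟨⟨0, hd⟩⟩
  have hM := dilation_isSymm W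
  obtain ⟨L, e', hL, he1', he', hLM⟩ := exists_extremal_eigenvector hM
  obtain ⟨e, he1, he⟩ : ∃ e, ‖e‖ = 1 ∧ matVec (dilation W) e = L • e := by
    rcases he' with he' | he'
    · exact ⟨e', he1', he'⟩
    -- The spectrum of the dilation is symmetric: changing the sign of the second block turns an
    -- eigenvector for `-L` into one for `L`, so the largest Ritz value alone suffices.
    · obtain ⟨x, y, rfl⟩ := exists_joinVec e'
      refine ⟨joinVec x (-y), ?_, ?_⟩
      · rw [← he1', ← abs_of_nonneg (norm_nonneg _), ← abs_of_nonneg (norm_nonneg (joinVec x y)),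
          ← sq_eq_sq_iff_abs_eq_abs, ← real_inner_self_eq_norm_sq, ← real_inner_self_eq_norm_sq,
          inner_joinVec, inner_joinVec]
        simp
      · rw [matVec_mneg, matVec_dilation_join] at he'
        rw [matVec_dilation_join]
        ext i
        have := congrArg (fun u => u i) he'
        cases i with
        | inl i =>
          simp only [joinVec, PiLp.neg_apply, PiLp.smul_apply, Sum.elim_inl] at this ⊢
          rw [← this]
          simp [matVec, Matrix.mulVec_neg]
        | inr i =>
          simp only [joinVec, PiLp.neg_apply, PiLp.smul_apply, Sum.elim_inr, smul_eq_mul] at this ⊢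
          simp only [mul_neg]
          linarith
  refine ⟨e, he1, fun v hv hev => ?_⟩
  have h : L ≤ (1 + δ) * lanczosMax (dilation W) v (lanczosSteps (2 * d) δ q) :=
    krylov_accuracy hM hv (by omega) hδ hq0 hq1 hL hLM he he1
      (fun P hP => rayleigh_le_lanczosMax hM hv hP) hev
  have h3 : 3 * (maxSvec W δ q v).1 = lanczosMax (dilation W) v (lanczosSteps (2 * d) δ q) := by
    simp only [maxSvec, dilation]
    ring
  intro x
  rw [h3]
  exact (norm_matVec_le_of_dilation hL hLM x).trans (by gcongr)

end Dilation

end QNPE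

/-! ### Probability that a uniform start vector falls in a bad slab, and the sum over rounds. -/

namespace QNPE

open scoped Pointwise

/-! ### Slabs of the unit ball and of the unit sphere -/

theorem volume_pi_unit_ball_le (m : ℕ) :
    volume {y : Fin m → ℝ | ‖(WithLp.toLp 2 y : EuclideanSpace ℝ (Fin m))‖ < 1} ≤
      ENNReal.ofReal (√Real.pi ^ m / Real.Gamma (m / 2 + 1)) := by
  cases m with
  | zero =>
    refine (measure_mono (Set.subset_univ _)).trans ?_
    simp [volume_pi]
  | succ m =>
    have h := (PiLp.volume_preserving_toLp (Fin (m + 1))).measure_preimage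
      (s := Metric.ball 0 1) Metric.isOpen_ball.measurableSet.nullMeasurableSet
    have h2 := EuclideanSpace.volume_ball (Fin (m + 1)) 0 1
    rw [h2] at h
    have h3 : {y : Fin (m + 1) → ℝ | ‖(WithLp.toLp 2 y : EuclideanSpace ℝ (Fin (m + 1)))‖ < 1} =
        (WithLp.toLp 2) ⁻¹' (Metric.ball (0 : EuclideanSpace ℝ (Fin (m + 1))) 1) := by
      ext y; simp
    rw [h3, h]
    simp

/-- In an orthonormal basis starting with `e`, the slab inside the unit ball is contained in an
interval of length `2 a` times the unit ball of one dimension less. -/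
theorem volume_slab_le {E : Type*} [NormedAddCommGroup E] [InnerProductSpace ℝ E]
    [FiniteDimensional ℝ E] [MeasurableSpace E] [BorelSpace E] {m : ℕ}
    (hE : Module.finrank ℝ E = m + 1) {e : E} (he : ‖e‖ = 1) {a : ℝ} (ha : 0 ≤ a) :
    volume {x : E | ‖x‖ < 1 ∧ |inner ℝ e x| ≤ a} ≤
      ENNReal.ofReal (2 * a * (√Real.pi ^ m / Real.Gamma (m / 2 + 1))) := by
  obtain ⟨b, hb⟩ := Orthonormal.exists_orthonormalBasis_extension_of_card_eq (𝕜 := ℝ)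
    (ι := Fin (m + 1)) (v := fun _ => e) (s := {0}) (by simpa using hE)
    ⟨fun i => he, fun i j hij => absurd (Subsingleton.elim i j) hij⟩
  have hb0 : b 0 = e := hb 0 rfl
  set f : E → ℝ × (Fin m → ℝ) := fun x =>
    MeasurableEquiv.piFinSuccAbove (fun _ => ℝ) 0 (WithLp.ofLp (b.repr x)) with hf
  have hmp : MeasurePreserving f := by
    have h1 : MeasurePreserving (fun x : E => WithLp.ofLp (b.repr x)) :=
      (PiLp.volume_preserving_ofLp (Fin (m + 1))).comp b.measurePreserving_repr
    exact (volume_preserving_piFinSuccAbove (fun _ : Fin (m + 1) => ℝ) 0).comp h1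
  set S := {y : Fin m → ℝ | ‖(WithLp.toLp 2 y : EuclideanSpace ℝ (Fin m))‖ < 1} with hS
  have hSm : MeasurableSet S := by
    have hc : Continuous fun y : Fin m → ℝ => ‖(WithLp.toLp 2 y : EuclideanSpace ℝ (Fin m))‖ :=
      (PiLp.continuous_toLp 2 _).norm
    exact (isOpen_lt hc continuous_const).measurableSet
  have hsub : {x : E | ‖x‖ < 1 ∧ |inner ℝ e x| ≤ a} ⊆ f ⁻¹' (Set.Icc (-a) a ×ˢ S) := by
    rintro x ⟨hx1, hx2⟩
    refine ⟨?_, ?_⟩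
    · have : (f x).1 = inner ℝ e x := by
        simp [hf, b.repr_apply_apply, hb0]
      rw [this]
      exact abs_le.1 hx2
    · have h1 : ‖b.repr x‖ ^ 2 < 1 := by
        rw [LinearIsometryEquiv.norm_map]
        nlinarith [norm_nonneg x]
      rw [EuclideanSpace.norm_sq_eq, Fin.sum_univ_succ] at h1
      have h2 : ‖(WithLp.toLp 2 (f x).2 : EuclideanSpace ℝ (Fin m))‖ ^ 2 < 1 := by
        rw [EuclideanSpace.norm_sq_eq]
        refine lt_of_le_of_lt ?_ h1
        refine le_trans (le_of_eq ?_) (le_add_of_nonneg_left (sq_nonneg _))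
        refine Finset.sum_congr rfl fun i _ => ?_
        simp [hf, Fin.tail]
      have := (sq_lt_one_iff_abs_lt_one _).1 h2
      rwa [abs_norm] at this
  refine (measure_mono hsub).trans ?_
  rw [hmp.measure_preimage (measurableSet_Icc.prod hSm).nullMeasurableSet, Measure.volume_eq_prod,
    Measure.prod_prod, Real.volume_Icc, ENNReal.ofReal_mul (by positivity)]
  gcongr
  · linarith
  · exact volume_pi_unit_ball_le m

/-- Log-convexity of `Γ` at the midpoint of `x + 1/2` and `x + 3/2`. It bounds the ratio of unit
ball volumes in consecutive dimensions. -/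
theorem Gamma_add_one_le {x : ℝ} (hx : 0 < x) :
    Real.Gamma (x + 1) ≤ √(x + 1 / 2) * Real.Gamma (x + 1 / 2) := by
  have h := Real.Gamma_mul_add_mul_le_rpow_Gamma_mul_rpow_Gamma (s := x + 1 / 2)
    (t := x + 1 / 2 + 1) (a := 1 / 2) (b := 1 / 2) (by linarith) (by linarith) (by norm_num)
    (by norm_num) (by norm_num)
  rw [show 1 / 2 * (x + 1 / 2) + 1 / 2 * (x + 1 / 2 + 1) = x + 1 by ring, ← Real.sqrt_eq_rpow,
    ← Real.sqrt_eq_rpow, Real.Gamma_add_one (s := x + 1 / 2) (by linarith)] at h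
  have hG : 0 < Real.Gamma (x + 1 / 2) := Real.Gamma_pos_of_pos (by linarith)
  rw [Real.sqrt_mul (by linarith)] at h
  calc _ ≤ _ := h
    _ = √(x + 1 / 2) * (√(Real.Gamma (x + 1 / 2)) * √(Real.Gamma (x + 1 / 2))) := by ring
    _ = _ := by rw [Real.mul_self_sqrt hG.le]

section Sphere

variable {ι : Type} [Fintype ι] [Nonempty ι]

instance isProbabilityMeasure_uniformSphere : IsProbabilityMeasure (uniformSphere ι) where
  measure_univ := by
    have : Nontrivial (Vec ι) := by
      obtain ⟨i⟩ := ‹Nonempty ι›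
      classical
      exact ⟨EuclideanSpace.single i 1, 0, by simp⟩
    rw [uniformSphere, Measure.smul_apply, smul_eq_mul]
    refine ENNReal.inv_mul_cancel ?_ (measure_ne_top _ _)
    rw [Ne, Measure.measure_univ_eq_zero]
    exact Measure.toSphere_ne_zero _

/-- Surface measure is the dimension times the volume of the cone over a set. The cone over a
spherical slab lies in the slab of the ball, so the probability is at most a ratio of volumes. -/
theorem uniformSphere_slab_le {e : Vec ι} (he : ‖e‖ = 1) {q : ℝ} (hq : 0 ≤ q) :
    uniformSphere ι {v | |inner ℝ e v.val| ≤ 2 * q / √(11 * Fintype.card ι)} ≤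
      ENNReal.ofReal q := by
  obtain ⟨m, hm⟩ : ∃ m, Fintype.card ι = m + 1 :=
    Nat.exists_eq_succ_of_ne_zero Fintype.card_ne_zero
  have hE : Module.finrank ℝ (Vec ι) = m + 1 := by simp [hm]
  set a := 2 * q / √(11 * Fintype.card ι) with ha
  have ha0 : 0 ≤ a := by positivity
  set G := √Real.pi ^ m / Real.Gamma (m / 2 + 1) with hG
  set V := √Real.pi ^ (m + 1) / Real.Gamma ((m + 1 : ℕ) / 2 + 1) with hV
  have hΓ1 : 0 < Real.Gamma ((m : ℝ) / 2 + 1) := Real.Gamma_pos_of_pos (by positivity)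
  have hΓ2 : 0 < Real.Gamma (((m + 1 : ℕ) : ℝ) / 2 + 1) := Real.Gamma_pos_of_pos (by positivity)
  have hV0 : 0 < V := by positivity
  have hball : volume (Metric.ball (0 : Vec ι) 1) = ENNReal.ofReal V := by
    rw [EuclideanSpace.volume_ball, hm]; simp [hV]
  have hratio : 2 * a * G ≤ q * V := by
    have h1 := Gamma_add_one_le (x := ((m + 1 : ℕ) : ℝ) / 2) (by positivity)
    rw [show ((m + 1 : ℕ) : ℝ) / 2 + 1 / 2 = (m : ℝ) / 2 + 1 by push_cast; ring] at h1
    have h2 : a * 2 * √((m : ℝ) / 2 + 1) ≤ q * √Real.pi := by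
      rw [ha, hm, show 2 * q / √(11 * ((m + 1 : ℕ) : ℝ)) * 2 * √((m : ℝ) / 2 + 1) =
        q * (4 * √((m : ℝ) / 2 + 1) / √(11 * ((m + 1 : ℕ) : ℝ))) by ring]
      refine mul_le_mul_of_nonneg_left ?_ hq
      rw [div_le_iff₀ (by positivity), ← Real.sqrt_mul Real.pi_pos.le]
      -- What remains is `16 (m/2 + 1) ≤ 11 π (m + 1)`; the constant `11` leaves ample room.
      refine Real.le_sqrt_of_sq_le ?_
      rw [mul_pow, Real.sq_sqrt (by positivity)]
      push_cast
      have hm0 : (0 : ℝ) ≤ m := Nat.cast_nonneg m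
      nlinarith [Real.pi_gt_three]
    rw [hG, hV, pow_succ, ← mul_div_assoc (2 * a), ← mul_div_assoc q, div_le_div_iff₀ hΓ1 hΓ2]
    have hp : 0 ≤ √Real.pi ^ m := by positivity
    calc 2 * a * √Real.pi ^ m * Real.Gamma (((m + 1 : ℕ) : ℝ) / 2 + 1)
        ≤ 2 * a * √Real.pi ^ m * (√((m : ℝ) / 2 + 1) * Real.Gamma ((m : ℝ) / 2 + 1)) := by gcongr
      _ = √Real.pi ^ m * Real.Gamma ((m : ℝ) / 2 + 1) * (a * 2 * √((m : ℝ) / 2 + 1)) := by ring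
      _ ≤ √Real.pi ^ m * Real.Gamma ((m : ℝ) / 2 + 1) * (q * √Real.pi) := by gcongr
      _ = _ := by ring
  have hmeas : MeasurableSet {v : UnitSphere ι | |inner ℝ e v.val| ≤ a} := by
    have hc : Continuous fun v : UnitSphere ι => |inner ℝ e v.val| :=
      (continuous_const.inner continuous_subtype_val).abs
    exact (isClosed_le hc continuous_const).measurableSet
  rw [uniformSphere, Measure.smul_apply, smul_eq_mul, Measure.toSphere_apply_univ,
    Measure.toSphere_apply' _ hmeas, hball, hE]
  have hsub : Set.Ioo (0 : ℝ) 1 • ((↑) '' {v : UnitSphere ι | |inner ℝ e v.val| ≤ a} : Set (Vec ι))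
      ⊆ {x : Vec ι | ‖x‖ < 1 ∧ |inner ℝ e x| ≤ a} := by
    rintro _ ⟨t, ht, _, ⟨v, hv, rfl⟩, rfl⟩
    have hvn : ‖v.val‖ = 1 := by simp
    refine ⟨?_, ?_⟩
    · simp only [norm_smul, hvn, mul_one, Real.norm_eq_abs, abs_of_pos ht.1]
      exact ht.2
    · simp only [inner_smul_right, abs_mul, abs_of_pos ht.1]
      calc t * |inner ℝ e v.val| ≤ 1 * a := mul_le_mul ht.2.le hv (abs_nonneg _) zero_le_one
        _ = a := one_mul a
  have h3 : volume (Set.Ioo (0 : ℝ) 1 •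
      ((↑) '' {v : UnitSphere ι | |inner ℝ e v.val| ≤ a} : Set (Vec ι))) ≤
      ENNReal.ofReal q * ENNReal.ofReal V := by
    refine (measure_mono hsub).trans ((volume_slab_le hE he ha0).trans ?_)
    rw [← ENNReal.ofReal_mul hq]
    exact ENNReal.ofReal_le_ofReal hratio
  have hVne : ENNReal.ofReal V ≠ 0 := by simpa using hV0
  calc _ ≤ (((m + 1 : ℕ) : ENNReal) * ENNReal.ofReal V)⁻¹ *
        (((m + 1 : ℕ) : ENNReal) * (ENNReal.ofReal q * ENNReal.ofReal V)) := by gcongr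
    _ = ENNReal.ofReal q * ((((m + 1 : ℕ) : ENNReal) * ENNReal.ofReal V)⁻¹ *
        (((m + 1 : ℕ) : ENNReal) * ENNReal.ofReal V)) := by ring
    _ = ENNReal.ofReal q := by
      rw [ENNReal.inv_mul_cancel, mul_one]
      · exact mul_ne_zero (by simp) hVne
      · exact ENNReal.mul_ne_top (by simp) (by simp)

end Sphere

/-! ### The failure probabilities -/

/-- Each term after the first is at most a difference of consecutive values of `1 / log`, as in the
integral test. The telescoped bound `1 / (2 log² 2) + 1 / log 2` is just below `2.5`, the constant
in `q_t`. -/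
theorem sum_inv_mul_log_sq_le (n : ℕ) :
    ∑ j ∈ Finset.range n, 1 / (((j : ℝ) + 2) * Real.log (j + 2) ^ 2) ≤ 2.5 := by
  have hstep : ∀ k : ℕ, ∑ j ∈ Finset.range (k + 1), 1 / (((j : ℝ) + 2) * Real.log (j + 2) ^ 2) ≤
      1 / (2 * Real.log 2 ^ 2) + 1 / Real.log 2 - 1 / Real.log (k + 2) := by
    intro k
    induction k with
    | zero => simp
    | succ k ih =>
      rw [Finset.sum_range_succ]
      push_cast at ih ⊢
      have hk : (0 : ℝ) ≤ k := Nat.cast_nonneg k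
      have h1 : 0 < Real.log ((k : ℝ) + 2) := Real.log_pos (by linarith)
      have h2 : Real.log ((k : ℝ) + 2) ≤ Real.log ((k : ℝ) + 1 + 2) :=
        Real.log_le_log (by linarith) (by linarith)
      have h2' : 0 < Real.log ((k : ℝ) + 1 + 2) := h1.trans_le h2
      have h3 : 1 / ((k : ℝ) + 1 + 2) ≤ Real.log ((k : ℝ) + 1 + 2) - Real.log ((k : ℝ) + 2) := by
        have := Real.log_le_sub_one_of_pos (x := ((k : ℝ) + 2) / ((k : ℝ) + 1 + 2)) (by positivity)
        rw [Real.log_div (by positivity) (by positivity)] at this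
        have h4 : ((k : ℝ) + 2) / ((k : ℝ) + 1 + 2) - 1 = -(1 / ((k : ℝ) + 1 + 2)) := by
          field_simp; ring
        linarith
      have h4 : 1 / (((k : ℝ) + 1 + 2) * Real.log ((k : ℝ) + 1 + 2) ^ 2) ≤
          1 / Real.log ((k : ℝ) + 2) - 1 / Real.log ((k : ℝ) + 1 + 2) := by
        rw [div_sub_div _ _ h1.ne' h2'.ne', one_mul, mul_one, ← div_div]
        refine div_le_div₀ ?_ h3 (by positivity) ?_
        · linarith
        · rw [sq]; gcongr
      linarith
  cases n with
  | zero => norm_num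
  | succ k =>
    refine (hstep k).trans ?_
    have hk : (0 : ℝ) ≤ k := Nat.cast_nonneg k
    have h1 : 0 ≤ 1 / Real.log ((k : ℝ) + 2) := by
      have := Real.log_pos (x := (k : ℝ) + 2) (by linarith)
      positivity
    have h2 := Real.log_two_gt_d9
    have h3 : 1 / Real.log 2 ≤ 1.4428 := by
      rw [div_le_iff₀ (by linarith)]; linarith
    have h4 : 1 / (2 * Real.log 2 ^ 2) ≤ 1.041 := by
      rw [div_le_iff₀ (by positivity)]; nlinarith
    linarith

theorem Input.q_succ_eq {d : ℕ} (I : Input d) (j : ℕ) :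
    I.q (j + 1) = I.p / 2.5 * (1 / (((j : ℝ) + 2) * Real.log (j + 2) ^ 2)) := by
  simp only [Input.q]
  push_cast
  rw [show (j : ℝ) + 1 + 1 = j + 2 by ring]
  rw [div_mul_div_comm, mul_one, mul_assoc]

theorem Input.q_succ_pos {d : ℕ} (I : Input d) (hp : 0 < I.p) (j : ℕ) : 0 < I.q (j + 1) := by
  rw [I.q_succ_eq]
  have hk : (0 : ℝ) ≤ j := Nat.cast_nonneg j
  have := Real.log_pos (x := (j : ℝ) + 2) (by linarith)
  positivity

theorem Input.sum_q_le {d : ℕ} (I : Input d) (hp : 0 < I.p) (n : ℕ) :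
    ∑ j ∈ Finset.range n, I.q (j + 1) ≤ I.p := by
  simp only [I.q_succ_eq]
  rw [← Finset.mul_sum]
  have := sum_inv_mul_log_sq_le n
  calc _ ≤ I.p / 2.5 * 2.5 := by gcongr
    _ = I.p := by norm_num

theorem Input.q_succ_le_one {d : ℕ} (I : Input d) (hp : 0 < I.p) (hp1 : I.p ≤ 1) (j : ℕ) :
    I.q (j + 1) ≤ 1 := by
  refine le_trans ?_ ((I.sum_q_le hp (j + 1)).trans hp1)
  exact Finset.single_le_sum (f := fun j => I.q (j + 1)) (fun i _ => (I.q_succ_pos hp i).le)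
    (Finset.mem_range.2 j.lt_succ_self)

theorem Input.tsum_q_le {d : ℕ} (I : Input d) (hp : 0 < I.p) :
    ∑' j : ℕ, ENNReal.ofReal (I.q (j + 1)) ≤ ENNReal.ofReal I.p := by
  refine ENNReal.tsum_le_of_sum_range_le fun n => ?_
  rw [← ENNReal.ofReal_sum_of_nonneg fun i _ => (I.q_succ_pos hp i).le]
  exact ENNReal.ofReal_le_ofReal (I.sum_q_le hp n)

end QNPE

/-! ### Measurability of the solvers, the Lanczos method and the oracles. -/

namespace QNPE

/-! ### Measurability of linear algebra operations -/

section Measurability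

variable {X : Type*} [MeasurableSpace X] {ι : Type} [Fintype ι]

theorem measurable_sInf_nat {S : X → Set ℕ} (h : ∀ n, MeasurableSet {x | n ∈ S x}) :
    Measurable fun x => sInf (S x) := by
  refine measurable_to_countable' fun n => ?_
  -- The second set accounts for the convention `sInf ∅ = 0`.
  have : (fun x => sInf (S x)) ⁻¹' {n} =
      ({x | n ∈ S x} ∩ ⋂ m : Fin n, {x | (m : ℕ) ∈ S x}ᶜ) ∪
        ({x | n = 0} ∩ ⋂ m : ℕ, {x | m ∈ S x}ᶜ) := by
    ext x
    simp only [Set.mem_preimage, Set.mem_singleton_iff, Set.mem_union, Set.mem_inter_iff,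
      Set.mem_iInter, Set.mem_compl_iff, Set.mem_ofPred_eq]
    constructor
    · rintro rfl
      rcases (S x).eq_empty_or_nonempty with h0 | h0
      · right; simp [h0]
      · left
        exact ⟨Nat.sInf_mem h0, fun m => Nat.notMem_of_lt_sInf m.2⟩
    · rintro (⟨h1, h2⟩ | ⟨h1, h2⟩)
      · refine le_antisymm (Nat.sInf_le h1) ?_
        by_contra! hlt
        exact h2 ⟨_, hlt⟩ (Nat.sInf_mem ⟨n, h1⟩)
      · rw [h1, Nat.sInf_eq_zero]
        exact Or.inr (Set.eq_empty_of_forall_notMem h2)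
  rw [this]
  exact ((h n).inter (MeasurableSet.iInter fun m : Fin n => (h m).compl)).union
    ((MeasurableSet.const _).inter (MeasurableSet.iInter fun m => (h m).compl))

theorem measurable_countable_index {Y : Type*} [MeasurableSpace Y] {f : ℕ → X → Y} {N : X → ℕ}
    (hf : ∀ n, Measurable (f n)) (hN : Measurable N) : Measurable fun x => f (N x) x :=
  (measurable_from_prod_countable_right (f := fun p : ℕ × X => f p.1 p.2) hf).comp
    (hN.prodMk measurable_id)

omit [Fintype ι] in
theorem measurable_vec {f : X → Vec ι} (h : ∀ i, Measurable fun x => f x i) : Measurable f :=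
  (WithLp.measurable_toLp 2 (ι → ℝ)).comp (measurable_pi_iff.2 h)

omit [Fintype ι] in
theorem measurable_vec_apply {f : X → Vec ι} (h : Measurable f) (i : ι) :
    Measurable fun x => f x i :=
  measurable_pi_iff.1 ((WithLp.measurable_ofLp 2 (ι → ℝ)).comp h) i

omit [Fintype ι] in
/-- Entrywise measurability of a matrix-valued function. -/
def MeasurableMat (A : X → Mat ι) : Prop := ∀ i j, Measurable fun x => A x i j

namespace MeasurableMat

variable {A B : X → Mat ι}

omit [Fintype ι] in
theorem add (hA : MeasurableMat A) (hB : MeasurableMat B) : MeasurableMat fun x => A x + B x :=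
  fun i j => (hA i j).add (hB i j)

omit [Fintype ι] in
theorem sub (hA : MeasurableMat A) (hB : MeasurableMat B) : MeasurableMat fun x => A x - B x :=
  fun i j => (hA i j).sub (hB i j)

omit [Fintype ι] in
theorem neg (hA : MeasurableMat A) : MeasurableMat fun x => -A x := fun i j => (hA i j).neg

omit [Fintype ι] in
theorem smul {c : X → ℝ} (hc : Measurable c) (hA : MeasurableMat A) :
    MeasurableMat fun x => c x • A x := fun i j => hc.mul (hA i j)

omit [Fintype ι] in
theorem transpose (hA : MeasurableMat A) : MeasurableMat fun x => (A x).transpose :=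
  fun i j => hA j i

omit [Fintype ι] in
theorem const (C : Mat ι) : MeasurableMat fun _ : X => C := fun _ _ => measurable_const

omit [Fintype ι] in
theorem symPart (hA : MeasurableMat A) : MeasurableMat fun x => symPart (A x) :=
  smul measurable_const (hA.add hA.transpose)

omit [Fintype ι] in
theorem ite {p : X → Prop} [DecidablePred p] (hp : MeasurableSet {x | p x}) (hA : MeasurableMat A)
    (hB : MeasurableMat B) : MeasurableMat fun x => if p x then A x else B x := fun i j => by
  have : (fun x => (if p x then A x else B x) i j) = fun x => if p x then A x i j else B x i j := by
    ext x; split_ifs <;> rfl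
  rw [this]
  exact Measurable.ite hp (hA i j) (hB i j)

theorem mul (hA : MeasurableMat A) (hB : MeasurableMat B) : MeasurableMat fun x => A x * B x :=
  fun i j => by
    simp only [Matrix.mul_apply]
    exact Finset.measurable_sum _ fun k _ => (hA i k).mul (hB k j)

theorem matVec (hA : MeasurableMat A) {f : X → Vec ι} (hf : Measurable f) :
    Measurable fun x => matVec (A x) (f x) :=
  measurable_vec fun i => by
    simp only [matVec_apply]
    exact Finset.measurable_sum _ fun j _ => (hA i j).mul (measurable_vec_apply hf j)

omit [Fintype ι] in
theorem outer {f g : X → Vec ι} (hf : Measurable f) (hg : Measurable g) :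
    MeasurableMat fun x => outer (f x) (g x) :=
  fun i j => (measurable_vec_apply hf i).mul (measurable_vec_apply hg j)

theorem frobInner (hA : MeasurableMat A) (hB : MeasurableMat B) :
    Measurable fun x => frobInner (A x) (B x) :=
  Finset.measurable_sum _ fun i _ => Finset.measurable_sum _ fun j _ => (hA i j).mul (hB i j)

omit [Fintype ι] in
theorem measurableSet_isSymm [Finite ι] (hA : MeasurableMat A) :
    MeasurableSet {x | (A x).IsSymm} := by
  have : {x | (A x).IsSymm} = ⋂ i, ⋂ j, {x | A x j i = A x i j} := by
    ext x
    simp only [Set.mem_ofPred_eq, Set.mem_iInter, Matrix.IsSymm.ext_iff]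
  rw [this]
  exact MeasurableSet.iInter fun i => MeasurableSet.iInter fun j =>
    measurableSet_eq_fun (hA j i) (hA i j)

end MeasurableMat

/-- A closed condition that holds on a dense sequence holds everywhere. -/
theorem measurableSet_forall_of_continuous {E : Type*} [TopologicalSpace E]
    [TopologicalSpace.SeparableSpace E] [Nonempty E] {f g : X → E → ℝ}
    (hf : ∀ x, Continuous (f x)) (hg : ∀ x, Continuous (g x))
    (hfm : ∀ y, Measurable fun x => f x y) (hgm : ∀ y, Measurable fun x => g x y) :
    MeasurableSet {x | ∀ y, f x y ≤ g x y} := by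
  have : {x | ∀ y, f x y ≤ g x y} =
      ⋂ n, {x | f x (TopologicalSpace.denseSeq E n) ≤ g x (TopologicalSpace.denseSeq E n)} := by
    ext x
    simp only [Set.mem_ofPred_eq, Set.mem_iInter]
    refine ⟨fun h n => h _, fun h y => ?_⟩
    have hcl : IsClosed {y | f x y ≤ g x y} := isClosed_le (hf x) (hg x)
    have := hcl.closure_subset_iff.2 (Set.range_subset_iff.2 h)
    rw [(TopologicalSpace.denseRange_denseSeq E).closure_range] at this
    exact this (Set.mem_univ y)
  rw [this]
  exact MeasurableSet.iInter fun n => measurableSet_le (hfm _) (hgm _)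

theorem continuous_matVec (A : Mat ι) : Continuous (matVec A) :=
  (matLin A).continuous_of_finiteDimensional

/-! ### Measurability of the linear solvers -/

/-- Componentwise measurability of a solver state. -/
structure MeasurableSolver (c : X → SolverState ι) : Prop where
  s : Measurable fun x => (c x).s
  r : Measurable fun x => (c x).r
  v : Measurable fun x => (c x).v
  p : Measurable fun x => (c x).p
  q : Measurable fun x => (c x).q
  γ : Measurable fun x => (c x).γ

theorem measurableSolver_cgls {A : X → Mat ι} {b : X → Vec ι} (hA : MeasurableMat A)
    (hb : Measurable b) (k : ℕ) : MeasurableSolver fun x => cgls (A x) (b x) k := by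
  induction k with
  | zero =>
    have hv := hA.transpose.matVec hb
    exact ⟨measurable_const, hb, hv, hv, hA.matVec hv, hv.inner hv⟩
  | succ k ih =>
    have hα := ih.γ.div (ih.q.norm.pow_const 2)
    have hr := ih.r.sub (hα.smul ih.q)
    have hv := hA.transpose.matVec hr
    have hγ := hv.norm.pow_const 2
    have hp := hv.add ((hγ.div ih.γ).smul ih.p)
    exact ⟨ih.s.add (hα.smul ih.p), hr, hv, hp, hA.matVec hp, hγ⟩

theorem measurableSolver_conjRes {A : X → Mat ι} {b : X → Vec ι} (hA : MeasurableMat A)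
    (hb : Measurable b) (k : ℕ) : MeasurableSolver fun x => conjRes (A x) (b x) k := by
  induction k with
  | zero =>
    have hv := hA.transpose.matVec hb
    exact ⟨measurable_const, hb, hv, hb, hv, hv.inner hb⟩
  | succ k ih =>
    have hα := ih.γ.div (ih.q.norm.pow_const 2)
    have hr := ih.r.sub (hα.smul ih.q)
    have hv := hA.matVec hr
    have hγ := hv.inner hr (𝕜 := ℝ)
    exact ⟨ih.s.add (hα.smul ih.p), hr, hv, hr.add ((hγ.div ih.γ).smul ih.p),
      hv.add ((hγ.div ih.γ).smul ih.q), hγ⟩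

theorem measurable_solverIter {A : X → Mat ι} {b : X → Vec ι} (hA : MeasurableMat A)
    (hb : Measurable b) (k : ℕ) : Measurable (fun x => (solverIter (A x) (b x) k).s) ∧
      Measurable fun x => (solverIter (A x) (b x) k).r := by
  classical
  have h1 := measurableSolver_conjRes hA hb k
  have h2 := measurableSolver_cgls hA hb k
  constructor
  · have : (fun x => (solverIter (A x) (b x) k).s) = fun x =>
        if (A x).IsSymm then (conjRes (A x) (b x) k).s else (cgls (A x) (b x) k).s := by
      ext1 x; unfold solverIter; split_ifs <;> rfl
    rw [this]
    exact Measurable.ite hA.measurableSet_isSymm h1.s h2.s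
  · have : (fun x => (solverIter (A x) (b x) k).r) = fun x =>
        if (A x).IsSymm then (conjRes (A x) (b x) k).r else (cgls (A x) (b x) k).r := by
      ext1 x; unfold solverIter; split_ifs <;> rfl
    rw [this]
    exact Measurable.ite hA.measurableSet_isSymm h1.r h2.r

theorem measurable_linearSolver {A : X → Mat ι} {b : X → Vec ι} {τ : X → ℝ} (hA : MeasurableMat A)
    (hb : Measurable b) (hτ : Measurable τ) :
    Measurable fun x => linearSolver (A x) (b x) (τ x) := by
  refine measurable_countable_index (f := fun k x => (solverIter (A x) (b x) k).s)
    (N := fun x => sInf (solverStops (A x) (b x) (τ x)))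
    (fun k => (measurable_solverIter hA hb k).1) (measurable_sInf_nat fun k => ?_)
  exact measurableSet_le (measurable_solverIter hA hb k).2.norm
    (hτ.mul (measurable_solverIter hA hb k).1.norm)

/-! ### Measurability of the Lanczos method -/

/-- Componentwise measurability of a Lanczos state. -/
structure MeasurableLanczos (c : X → LanczosState ι) : Prop where
  prev : Measurable fun x => (c x).prev
  cur : Measurable fun x => (c x).cur
  β : Measurable fun x => (c x).β

theorem MeasurableLanczos.α {c : X → LanczosState ι} (hc : MeasurableLanczos c) {M : X → Mat ι}
    (hM : MeasurableMat M) : Measurable fun x => (c x).α (M x) :=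
  ((hM.matVec hc.cur).sub (hc.β.smul hc.prev)).inner hc.cur

theorem measurableLanczos {M : X → Mat ι} {v : X → Vec ι} (hM : MeasurableMat M)
    (hv : Measurable v) (k : ℕ) : MeasurableLanczos fun x => lanczos (M x) (v x) k := by
  induction k with
  | zero => exact ⟨measurable_const, hv, measurable_const⟩
  | succ k ih =>
    have hw := ((hM.matVec ih.cur).sub (ih.β.smul ih.prev)).sub ((ih.α hM).smul ih.cur)
    exact ⟨ih.cur, hw.norm.inv.smul hw, hw.norm⟩

theorem measurableMat_lanczosT {M : X → Mat ι} {v : X → Vec ι} (hM : MeasurableMat M)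
    (hv : Measurable v) (N : ℕ) : MeasurableMat fun x => lanczosT (M x) (v x) N := fun i j => by
  simp only [lanczosT, Matrix.of_apply]
  split_ifs
  · exact (measurableLanczos hM hv _).α hM
  · exact (measurableLanczos hM hv _).β
  · exact (measurableLanczos hM hv _).β
  · exact measurable_const

/-- A sublevel set of the largest eigenvalue is cut out by inequalities between quadratic forms, and
by continuity a countable dense set of test vectors is enough. -/
theorem measurable_sSup_eigenvalueSet [DecidableEq ι] {T : X → Mat ι} (hT : MeasurableMat T)
    (hs : ∀ x, (T x).IsSymm) : Measurable fun x => sSup (eigenvalueSet (T x)) := by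
  rcases isEmpty_or_nonempty ι with h | h
  · have : (fun x => sSup (eigenvalueSet (T x))) = fun _ => sSup (eigenvalueSet (0 : Mat ι)) := by
      ext x; rw [Subsingleton.elim (T x) 0]
    rw [this]
    exact measurable_const
  · refine measurable_of_Iic fun a => ?_
    have : (fun x => sSup (eigenvalueSet (T x))) ⁻¹' Set.Iic a =
        {x | ∀ y, inner ℝ (matVec (T x) y) y ≤ a * ‖y‖ ^ 2} := by
      ext x
      exact sSup_eigenvalueSet_le_iff (hs x)
    rw [this]
    refine measurableSet_forall_of_continuous (fun x => (continuous_matVec _).inner continuous_id)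
      (fun x => by fun_prop) (fun y => (hT.matVec measurable_const).inner measurable_const)
      fun y => measurable_const

theorem measurable_lanczosMax {M : X → Mat ι} {v : X → Vec ι} (hM : MeasurableMat M)
    (hv : Measurable v) (N : ℕ) : Measurable fun x => lanczosMax (M x) (v x) N :=
  measurable_sSup_eigenvalueSet (measurableMat_lanczosT hM hv N) fun _ => lanczosT_isSymm _ _ _

theorem measurable_lanczosMin {M : X → Mat ι} {v : X → Vec ι} (hM : MeasurableMat M)
    (hv : Measurable v) (N : ℕ) : Measurable fun x => lanczosMin (M x) (v x) N := by
  simp only [lanczosMin, sInf_eigenvalueSet]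
  refine (measurable_sSup_eigenvalueSet (measurableMat_lanczosT hM hv N).neg fun x => ?_).neg
  rw [Matrix.IsSymm, Matrix.transpose_neg, (lanczosT_isSymm _ _ N).eq]

/-- The solution, normalized at index `0`, of the three-term recurrence satisfied by eigenvectors
of the Lanczos tridiagonal matrix. -/
def lanczosCoord (M : Mat ι) (v : Vec ι) (l : ℝ) : ℕ → ℝ
  | 0 => 1
  | 1 => (l - (lanczos M v 0).α M) / (lanczos M v 1).β
  | k + 2 => ((l - (lanczos M v (k + 1)).α M) * lanczosCoord M v l (k + 1) -
      (lanczos M v (k + 1)).β * lanczosCoord M v l k) / (lanczos M v (k + 2)).β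

theorem measurable_lanczosCoord {M : X → Mat ι} {v : X → Vec ι} {l : X → ℝ} (hM : MeasurableMat M)
    (hv : Measurable v) (hl : Measurable l) (k : ℕ) :
    Measurable fun x => lanczosCoord (M x) (v x) (l x) k := by
  induction k using Nat.twoStepInduction with
  | zero => exact measurable_const
  | one =>
    exact (hl.sub ((measurableLanczos hM hv 0).α hM)).div (measurableLanczos hM hv 1).β
  | more k h1 h2 =>
    exact (((hl.sub ((measurableLanczos hM hv (k + 1)).α hM)).mul h2).sub
      ((measurableLanczos hM hv (k + 1)).β.mul h1)).div (measurableLanczos hM hv (k + 2)).β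

omit [MeasurableSpace X] in
-- `unitEvec` is picked by choice, so measurability needs a formula. The rows of the tridiagonal
-- system determine all coordinates from the first. At breakdown the coordinate is zero because `l ≠
-- 0`, and division by `β = 0` gives zero on the other side too.
theorem eigenvector_eq_lanczosCoord {M : Mat ι} (hM : M.IsSymm) {v : Vec ι} (hv : ‖v‖ = 1) {N : ℕ}
    {l : ℝ} (hl : l ≠ 0) {z : Vec (Fin (N + 1))} (hz : matVec (lanczosT M v (N + 1)) z = l • z)
    (k : Fin (N + 1)) : z k = z 0 * lanczosCoord M v l k := by
  set y := ∑ j : Fin (N + 1), z j • (lanczos M v j).cur with hy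
  have hrow : ∀ i : Fin (N + 1), l * z i = inner ℝ (matVec M (lanczos M v i).cur) y := fun i => by
    have := congrArg (fun u => u i) hz
    simp only [matVec_apply, PiLp.smul_apply, smul_eq_mul] at this
    rw [← this, hy, inner_sum]
    refine Finset.sum_congr rfl fun j _ => ?_
    rw [inner_smul_right, inner_matVec_lanczos hM hv]
    ring
  have hcur : ∀ i : Fin (N + 1), inner ℝ (lanczos M v i).cur y = z i := fun i => by
    rcases lanczos_norm_cur (M := M) hv i with h | h
    · rw [hy, inner_sum, Finset.sum_eq_single i]
      · rw [inner_smul_right, real_inner_self_eq_norm_sq, h]; ring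
      · intro j _ hj
        rw [inner_smul_right,
          lanczos_orthogonal_of_ne hM hv (fun h => hj (Fin.ext h).symm), mul_zero]
      · simp
    · have := hrow i
      rw [h.1, matVec_vzero, inner_zero_left] at this
      rw [h.1, inner_zero_left]
      exact ((mul_eq_zero.1 this).resolve_left hl).symm
  have hrec : ∀ k (hk : k + 1 < N + 1), (lanczos M v (k + 1)).β * z ⟨k + 1, hk⟩ =
      (l - (lanczos M v k).α M) * z ⟨k, by omega⟩ -
        (lanczos M v k).β * inner ℝ (lanczos M v k).prev y := fun k hk => by
    have h1 := hrow ⟨k, by omega⟩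
    have h2 := hcur ⟨k, by omega⟩
    have h3 := hcur ⟨k + 1, hk⟩
    simp only at h1 h2 h3
    rw [matVec_lanczos, inner_add_left, inner_add_left, inner_smul_left, inner_smul_left,
      inner_smul_left, h2, h3] at h1
    simp only [conj_trivial] at h1
    linarith
  have hzero : ∀ k (hk : k + 1 < N + 1), (lanczos M v (k + 1)).β = 0 → z ⟨k + 1, hk⟩ = 0 :=
    fun k hk h => by
    have h3 := hcur ⟨k + 1, hk⟩
    have h4 : (lanczos M v (k + 1)).cur = 0 := by
      simp only [lanczos] at h ⊢
      rw [h, inv_zero, zero_smul]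
    rw [← h3]
    simp only
    rw [h4, inner_zero_left]
  obtain ⟨k, hk⟩ := k
  show z ⟨k, hk⟩ = z 0 * lanczosCoord M v l k
  induction k using Nat.twoStepInduction with
  | zero => simp [lanczosCoord]
  | one =>
    rw [lanczosCoord]
    by_cases h0 : (lanczos M v 1).β = 0
    · rw [h0, div_zero, mul_zero]; exact hzero 0 hk h0
    · have := hrec 0 hk
      rw [mul_div_assoc', eq_div_iff h0, mul_comm, this]
      simp [lanczos]
      ring
  | more k h1 h2 =>
    rw [lanczosCoord]
    by_cases h0 : (lanczos M v (k + 2)).β = 0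
    · rw [h0, div_zero, mul_zero]; exact hzero (k + 1) hk h0
    · have := hrec (k + 1) hk
      rw [mul_div_assoc', eq_div_iff h0, mul_comm, this, lanczos_prev_succ,
        hcur ⟨k, by omega⟩, h1 (by omega), h2 (by omega)]
      ring

/-- A sign-free expression for the Ritz vector, up to normalization. -/
def ritzDir (M : Mat ι) (v : Vec ι) (N : ℕ) (l : ℝ) : Vec ι :=
  ∑ k ∈ Finset.range N, lanczosCoord M v l k • (lanczos M v k).cur

/-- The squared length of the coordinate vector of `ritzDir`. -/
def ritzScale (M : Mat ι) (v : Vec ι) (N : ℕ) (l : ℝ) : ℝ :=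
  ∑ k ∈ Finset.range N, lanczosCoord M v l k ^ 2

omit [MeasurableSpace X] in
-- The chosen eigenvector is free only in its sign, which products of two entries do not see;
-- normalization gives `z 0 ^ 2 = 1 / ritzScale`.
theorem lanczosVec_mul {M : Mat ι} (hM : M.IsSymm) {v : Vec ι} (hv : ‖v‖ = 1) {N : ℕ}
    {l : ℝ} (hl : l ≠ 0) (hmem : l ∈ eigenvalueSet (lanczosT M v N)) (i j : ι) :
    lanczosVec M v N l i * lanczosVec M v N l j =
      (ritzScale M v N l)⁻¹ * (ritzDir M v N l i * ritzDir M v N l j) := by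
  have hex : ∃ z : Vec (Fin N), ‖z‖ = 1 ∧ matVec (lanczosT M v N) z = l • z := by
    obtain ⟨z, hz, h⟩ := mem_eigenvalueSet.1 hmem
    refine ⟨‖z‖⁻¹ • z, ?_, ?_⟩
    · rw [norm_smul, norm_inv, norm_norm, inv_mul_cancel₀ (norm_ne_zero_iff.2 hz)]
    · rw [matVec_vsmul, h, smul_comm]
  have hu : unitEvec (lanczosT M v N) l = hex.choose := by rw [unitEvec, dif_pos hex]
  obtain ⟨hz1, hz2⟩ := hex.choose_spec
  rw [← hu] at hz1 hz2
  unfold lanczosVec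
  set z := unitEvec (lanczosT M v N) l
  cases N with
  | zero =>
    exfalso
    rw [Subsingleton.elim z 0, norm_zero] at hz1
    exact zero_ne_one hz1
  | succ N =>
    have hc := eigenvector_eq_lanczosCoord hM hv hl hz2
    have h1 : z 0 ^ 2 * ritzScale M v (N + 1) l = 1 := by
      have : ‖z‖ ^ 2 = 1 := by rw [hz1, one_pow]
      rw [EuclideanSpace.norm_sq_eq] at this
      rw [← this, ritzScale, Finset.sum_range, Finset.mul_sum]
      refine Finset.sum_congr rfl fun k _ => ?_
      rw [hc k, norm_mul, mul_pow, Real.norm_eq_abs, Real.norm_eq_abs, sq_abs, sq_abs]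
    have h2 : ∑ k : Fin (N + 1), z k • (lanczos M v k).cur = z 0 • ritzDir M v (N + 1) l := by
      rw [ritzDir, Finset.sum_range, Finset.smul_sum]
      refine Finset.sum_congr rfl fun k _ => ?_
      rw [hc k, mul_smul]
    rw [h2]
    simp only [PiLp.smul_apply, smul_eq_mul]
    have h3 : ritzScale M v (N + 1) l ≠ 0 := fun h => by rw [h, mul_zero] at h1; exact zero_ne_one h1
    field_simp
    linear_combination (ritzDir M v (N + 1) l i * ritzDir M v (N + 1) l j) * h1

theorem measurable_ritzDir {M : X → Mat ι} {v : X → Vec ι} {l : X → ℝ} (hM : MeasurableMat M)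
    (hv : Measurable v) (hl : Measurable l) (N : ℕ) :
    Measurable fun x => ritzDir (M x) (v x) N (l x) :=
  Finset.measurable_sum _ fun k _ =>
    (measurable_lanczosCoord hM hv hl k).smul (measurableLanczos hM hv k).cur

theorem measurable_ritzScale {M : X → Mat ι} {v : X → Vec ι} {l : X → ℝ} (hM : MeasurableMat M)
    (hv : Measurable v) (hl : Measurable l) (N : ℕ) :
    Measurable fun x => ritzScale (M x) (v x) N (l x) :=
  Finset.measurable_sum _ fun k _ => (measurable_lanczosCoord hM hv hl k).pow_const 2

omit [MeasurableSpace X] in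
theorem lanczosMax_mem {M : Mat ι} {v : Vec ι} {N : ℕ} (h : lanczosMax M v N ≠ 0) :
    lanczosMax M v N ∈ eigenvalueSet (lanczosT M v N) := by
  refine Set.Nonempty.csSup_mem ?_ (finite_eigenvalueSet (lanczosT_isSymm M v N))
  by_contra h0
  rw [Set.not_nonempty_iff_eq_empty] at h0
  rw [lanczosMax, h0, Real.sSup_empty] at h
  exact h rfl

omit [MeasurableSpace X] in
theorem lanczosMin_mem {M : Mat ι} {v : Vec ι} {N : ℕ} (h : lanczosMin M v N ≠ 0) :
    lanczosMin M v N ∈ eigenvalueSet (lanczosT M v N) := by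
  refine Set.Nonempty.csInf_mem ?_ (finite_eigenvalueSet (lanczosT_isSymm M v N))
  by_contra h0
  rw [Set.not_nonempty_iff_eq_empty] at h0
  rw [lanczosMin, h0, Real.sInf_empty] at h
  exact h rfl

/-! ### Measurability of the separation oracles -/

variable {d : ℕ}

theorem measurable_extEvec {W : X → Mat (Fin d)} {v : X → Vec (Fin d)} (hW : MeasurableMat W)
    (hv : Measurable v) (hv1 : ∀ x, ‖v x‖ = 1) (δ q : ℝ) :
    Measurable (fun x => (extEvec (W x) δ q (v x)).1) ∧
      MeasurableMat fun x => (extEvec (W x) δ q (v x)).2 := by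
  have hM := hW.symPart
  set N := lanczosSteps d δ q with hN
  have h1 := measurable_lanczosMax hM hv N
  have h2 := measurable_lanczosMin hM hv N
  refine ⟨h1.max h2.neg, fun i j => ?_⟩
  have key : (fun x => (extEvec (W x) δ q (v x)).2 i j) = fun x =>
      if max (lanczosMax (symPart (W x)) (v x) N) (-lanczosMin (symPart (W x)) (v x) N) ≤ 1 then 0
      else if -lanczosMin (symPart (W x)) (v x) N ≤ lanczosMax (symPart (W x)) (v x) N then
        (ritzScale (symPart (W x)) (v x) N (lanczosMax (symPart (W x)) (v x) N))⁻¹ *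
          (ritzDir (symPart (W x)) (v x) N (lanczosMax (symPart (W x)) (v x) N) i *
            ritzDir (symPart (W x)) (v x) N (lanczosMax (symPart (W x)) (v x) N) j)
      else -((ritzScale (symPart (W x)) (v x) N (lanczosMin (symPart (W x)) (v x) N))⁻¹ *
          (ritzDir (symPart (W x)) (v x) N (lanczosMin (symPart (W x)) (v x) N) i *
            ritzDir (symPart (W x)) (v x) N (lanczosMin (symPart (W x)) (v x) N) j)) := by
    ext x
    simp only [extEvec]
    rw [← hN]
    split_ifs with ha hb
    · rfl
    · rw [max_eq_left hb] at ha
      -- Ritz vectors are used only when `γ > 1`, so the exceptional eigenvalue `0` never occurs.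
      have hne : lanczosMax (symPart (W x)) (v x) N ≠ 0 := fun h => ha (by rw [h]; exact zero_le_one)
      exact lanczosVec_mul (symPart_isSymm _) (hv1 x) hne (lanczosMax_mem hne) i j
    · rw [max_eq_right (not_le.1 hb).le] at ha
      have hne : lanczosMin (symPart (W x)) (v x) N ≠ 0 := fun h => ha (by rw [h]; simp)
      exact congrArg Neg.neg
        (lanczosVec_mul (symPart_isSymm _) (hv1 x) hne (lanczosMin_mem hne) i j)
  rw [key]
  refine Measurable.ite (measurableSet_le (h1.max h2.neg) measurable_const) measurable_const
    (Measurable.ite (measurableSet_le h2.neg h1) ?_ (Measurable.neg ?_))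
  · exact (measurable_ritzScale hM hv h1 N).inv.mul
      ((measurable_vec_apply (measurable_ritzDir hM hv h1 N) i).mul
        (measurable_vec_apply (measurable_ritzDir hM hv h1 N) j))
  · exact (measurable_ritzScale hM hv h2 N).inv.mul
      ((measurable_vec_apply (measurable_ritzDir hM hv h2 N) i).mul
        (measurable_vec_apply (measurable_ritzDir hM hv h2 N) j))

theorem measurableMat_dilation {W : X → Mat (Fin d)} (hW : MeasurableMat W) :
    MeasurableMat fun x => dilation (W x) := by
  rintro (i | i) (j | j)
  · exact measurable_const
  · exact hW i j
  · exact hW j i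
  · exact measurable_const

theorem measurable_maxSvec {W : X → Mat (Fin d)} {v : X → Vec (Fin d ⊕ Fin d)}
    (hW : MeasurableMat W) (hv : Measurable v) (hv1 : ∀ x, ‖v x‖ = 1) (δ q : ℝ) :
    Measurable (fun x => (maxSvec (W x) δ q (v x)).1) ∧
      MeasurableMat fun x => (maxSvec (W x) δ q (v x)).2 := by
  have hM := measurableMat_dilation hW
  set N := lanczosSteps (2 * d) δ q with hN
  have h1 := measurable_lanczosMax hM hv N
  refine ⟨h1.div_const 3, fun i j => ?_⟩
  have key : (fun x => (maxSvec (W x) δ q (v x)).2 i j) = fun x =>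
      if lanczosMax (dilation (W x)) (v x) N / 3 ≤ 1 then 0
      else 2 / 3 * ((ritzScale (dilation (W x)) (v x) N (lanczosMax (dilation (W x)) (v x) N))⁻¹ *
          (ritzDir (dilation (W x)) (v x) N (lanczosMax (dilation (W x)) (v x) N) (Sum.inl i) *
            ritzDir (dilation (W x)) (v x) N (lanczosMax (dilation (W x)) (v x) N) (Sum.inr j))) := by
    ext x
    simp only [maxSvec]
    rw [← hN]
    change (if lanczosMax (dilation (W x)) (v x) N / 3 ≤ 1 then (0 : Mat (Fin d)) else _) i j = _
    split_ifs with ha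
    · rfl
    · have hne : lanczosMax (dilation (W x)) (v x) N ≠ 0 := fun h => ha (by rw [h]; simp)
      exact congrArg (2 / 3 * ·)
        (lanczosVec_mul (dilation_isSymm _) (hv1 x) hne (lanczosMax_mem hne) (Sum.inl i) (Sum.inr j))
  rw [key]
  refine Measurable.ite (measurableSet_le (h1.div_const 3) measurable_const) measurable_const
    (measurable_const.mul ?_)
  exact (measurable_ritzScale hM hv h1 N).inv.mul
    ((measurable_vec_apply (measurable_ritzDir hM hv h1 N) _).mul
      (measurable_vec_apply (measurable_ritzDir hM hv h1 N) _))

theorem MeasurableMat.proj (cls : ProblemClass d) {W : X → Mat (Fin d)} (hW : MeasurableMat W) :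
    MeasurableMat fun x => cls.proj (W x) := by
  cases cls with
  | equation Ω =>
    intro i j
    simp only [ProblemClass.proj, Matrix.of_apply]
    split_ifs
    exacts [hW i j, measurable_const]
  | minimax m =>
    exact MeasurableMat.smul measurable_const
      (hW.add (((MeasurableMat.const _).mul hW.transpose).mul (MeasurableMat.const _)))
  | minimization Ω =>
    intro i j
    simp only [ProblemClass.proj, Matrix.of_apply]
    split_ifs
    exacts [((hW i j).add (hW j i)).div_const 2, measurable_const]

theorem measurable_sepOracle (I : Input d) {W : X → Mat (Fin d)} {ξ : X → Draw d}
    (hW : MeasurableMat W) (hξ : Measurable ξ) (t : ℕ) :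
    Measurable (fun x => (I.sepOracle (W x) t (ξ x)).1) ∧
      MeasurableMat fun x => (I.sepOracle (W x) t (ξ x)).2 := by
  classical
  have ho₁ := measurable_extEvec hW.symPart (measurable_subtype_coe.comp hξ.fst)
    (fun x => by simp) I.δ (I.q t / 2)
  have ho₂ := measurable_maxSvec hW (measurable_subtype_coe.comp hξ.snd)
    (fun x => by simp) I.δ (I.q t / 2)
  simp only [Function.comp_def] at ho₁ ho₂
  have hset : MeasurableSet {x | I.cls.IsMinimization ∨
      (maxSvec (W x) I.δ (I.q t / 2) (ξ x).2.val).1 ≤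
        (extEvec (symPart (W x)) I.δ (I.q t / 2) (ξ x).1.val).1} :=
    (MeasurableSet.const _).union (measurableSet_le ho₂.1 ho₁.1)
  constructor
  · have : (fun x => (I.sepOracle (W x) t (ξ x)).1) = fun x =>
        if I.cls.IsMinimization ∨ (maxSvec (W x) I.δ (I.q t / 2) (ξ x).2.val).1 ≤
          (extEvec (symPart (W x)) I.δ (I.q t / 2) (ξ x).1.val).1
        then (extEvec (symPart (W x)) I.δ (I.q t / 2) (ξ x).1.val).1
        else (maxSvec (W x) I.δ (I.q t / 2) (ξ x).2.val).1 := by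
      ext x
      simp only [Input.sepOracle]
      split_ifs <;> rfl
    rw [this]
    exact Measurable.ite hset ho₁.1 ho₂.1
  · have : (fun x => (I.sepOracle (W x) t (ξ x)).2) = fun x => I.cls.proj (
        if I.cls.IsMinimization ∨ (maxSvec (W x) I.δ (I.q t / 2) (ξ x).2.val).1 ≤
          (extEvec (symPart (W x)) I.δ (I.q t / 2) (ξ x).1.val).1
        then (extEvec (symPart (W x)) I.δ (I.q t / 2) (ξ x).1.val).2
        else (maxSvec (W x) I.δ (I.q t / 2) (ξ x).2.val).2) := by
      ext1 x
      simp only [Input.sepOracle]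
      split_ifs <;> rfl
    rw [this]
    exact (MeasurableMat.ite hset ho₁.2 ho₂.2).proj I.cls

end Measurability

end QNPE

/-! ### The run as a random process and the probability that some oracle call fails. -/

namespace QNPE

variable {d : ℕ}

/-! ### Measurability of the run -/

section StateMeasurability

variable {X : Type*} [MeasurableSpace X]

/-- Componentwise measurability of a state of the method. -/
structure MeasurableState (c : X → State d) : Prop where
  z : Measurable fun x => (c x).z
  σ : Measurable fun x => (c x).σ
  B : MeasurableMat fun x => (c x).B
  W : MeasurableMat fun x => (c x).W
  γ : Measurable fun x => (c x).γ
  S : MeasurableMat fun x => (c x).S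
  t : Measurable fun x => (c x).t

theorem MeasurableState.ite {p : X → Prop} [DecidablePred p] (hp : MeasurableSet {x | p x})
    {c c' : X → State d} (h : MeasurableState c) (h' : MeasurableState c') :
    MeasurableState fun x => if p x then c x else c' x where
  z := by
    have : (fun x => (if p x then c x else c' x).z) = fun x => if p x then (c x).z else (c' x).z := by
      ext1 x; split_ifs <;> rfl
    rw [this]; exact Measurable.ite hp h.z h'.z
  σ := by
    have : (fun x => (if p x then c x else c' x).σ) = fun x => if p x then (c x).σ else (c' x).σ := by
      ext1 x; split_ifs <;> rfl
    rw [this]; exact Measurable.ite hp h.σ h'.σ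
  B := by
    have : (fun x => (if p x then c x else c' x).B) = fun x => if p x then (c x).B else (c' x).B := by
      ext1 x; split_ifs <;> rfl
    rw [this]; exact MeasurableMat.ite hp h.B h'.B
  W := by
    have : (fun x => (if p x then c x else c' x).W) = fun x => if p x then (c x).W else (c' x).W := by
      ext1 x; split_ifs <;> rfl
    rw [this]; exact MeasurableMat.ite hp h.W h'.W
  γ := by
    have : (fun x => (if p x then c x else c' x).γ) = fun x => if p x then (c x).γ else (c' x).γ := by
      ext1 x; split_ifs <;> rfl
    rw [this]; exact Measurable.ite hp h.γ h'.γ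
  S := by
    have : (fun x => (if p x then c x else c' x).S) = fun x => if p x then (c x).S else (c' x).S := by
      ext1 x; split_ifs <;> rfl
    rw [this]; exact MeasurableMat.ite hp h.S h'.S
  t := by
    have : (fun x => (if p x then c x else c' x).t) = fun x => if p x then (c x).t else (c' x).t := by
      ext1 x; split_ifs <;> rfl
    rw [this]; exact Measurable.ite hp h.t h'.t

variable (I : Input d) {c : X → State d}

theorem measurable_trialStep (hc : MeasurableState c) (i : ℕ) :
    Measurable fun x => I.trialStep (c x) i := hc.σ.mul_const _

theorem measurable_trialPoint (hF : Continuous I.F) (hc : MeasurableState c) (i : ℕ) :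
    Measurable fun x => I.trialPoint (c x) i := by
  have hη := measurable_trialStep I hc i
  refine hc.z.add (measurable_linearSolver ?_ ?_ ?_)
  · exact (MeasurableMat.const 1).add (MeasurableMat.smul hη hc.B)
  · exact (hη.smul (hF.measurable.comp hc.z)).neg
  · exact measurable_const.mul ((measurable_const.add (hη.mul_const _)).sqrt)

theorem measurable_lsIndex (hF : Continuous I.F) (hc : MeasurableState c) :
    Measurable fun x => I.lsIndex (c x) := by
  refine measurable_sInf_nat fun i => ?_
  have hη := measurable_trialStep I hc i
  have hp := measurable_trialPoint I hF hc i
  exact measurableSet_lt ((hp.sub hc.z).add (hη.smul (hF.measurable.comp hp))).norm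
    ((measurable_const.mul ((measurable_const.add (hη.mul_const _)).sqrt)).mul (hp.sub hc.z).norm)

theorem measurable_lossGrad (hF : Continuous I.F) (hc : MeasurableState c) :
    MeasurableMat fun x => I.lossGrad (c x) := by
  have hzt : Measurable fun x => I.trialPoint (c x) (I.lsIndex (c x) - 1) :=
    measurable_countable_index (f := fun i x => I.trialPoint (c x) i)
      (N := fun x => I.lsIndex (c x) - 1) (measurable_trialPoint I hF hc)
      ((Measurable.of_discrete (f := fun n : ℕ => n - 1)).comp (measurable_lsIndex I hF hc))
  have hs := hzt.sub hc.z
  have hu := (hF.measurable.comp hzt).sub (hF.measurable.comp hc.z)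
  exact MeasurableMat.smul (measurable_const.div (hs.norm.pow_const 2))
    (MeasurableMat.outer (hu.sub (hc.B.matVec hs)) hs)

/-- The matrix `W_{t+1}` computed from a state whose line search backtracks. -/
def Input.nextW (I : Input d) (c : State d) : Mat (Fin d) :=
  let G := (1 / I.L₁) • I.cls.proj (I.lossGrad c)
  let Gt := if c.γ ≤ 1 then G else G + max 0 (-(1 / c.γ) * frobInner G c.W) • c.S
  let V := c.W - olStep • Gt
  (√d / max (√d) (frobNorm V)) • V

theorem measurable_nextW (hF : Continuous I.F) (hc : MeasurableState c) :
    MeasurableMat fun x => I.nextW (c x) := by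
  have hG : MeasurableMat fun x => (1 / I.L₁) • I.cls.proj (I.lossGrad (c x)) :=
    MeasurableMat.smul measurable_const ((measurable_lossGrad I hF hc).proj I.cls)
  have hm : Measurable fun x => max 0
      (-(1 / (c x).γ) * frobInner ((1 / I.L₁) • I.cls.proj (I.lossGrad (c x))) (c x).W) :=
    measurable_const.max ((measurable_const.div hc.γ).neg.mul (hG.frobInner hc.W))
  have hGt := MeasurableMat.ite (p := fun x => (c x).γ ≤ 1) (measurableSet_le hc.γ measurable_const)
    hG (hG.add (MeasurableMat.smul hm hc.S))
  have hV := hc.W.sub (MeasurableMat.smul (measurable_const (a := olStep)) hGt)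
  exact MeasurableMat.smul
    (measurable_const.div (measurable_const.max (hV.frobInner hV).sqrt)) hV

/-- The next iterate. -/
def Input.nextZ (I : Input d) (c : State d) : Vec (Fin d) :=
  let η := I.trialStep c (I.lsIndex c)
  let zh := I.trialPoint c (I.lsIndex c)
  let θ := 1 / (1 + 2 * η * I.μ)
  θ • (c.z - η • I.F zh) + (1 - θ) • zh

/-- The output of the separation oracle in a state whose line search backtracks. -/
def Input.nextOracle (I : Input d) (c : State d) (ξ : Draw d) : ℝ × Mat (Fin d) :=
  I.sepOracle (I.nextW c) (c.t + 1) ξ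

/-- The next Jacobian approximation in a state whose line search backtracks. -/
def Input.nextB (I : Input d) (c : State d) (ξ : Draw d) : Mat (Fin d) :=
  I.L₁ • (if (I.nextOracle c ξ).1 ≤ 1 then I.nextW c else (1 / (I.nextOracle c ξ).1) • I.nextW c) +
    (I.L₁ + I.μ) • (1 : Mat (Fin d))

theorem step_eq (c : State d) (ξ : Draw d) :
    I.step c ξ = if I.lsIndex c = 0 then
      { c with z := I.nextZ c, σ := I.trialStep c (I.lsIndex c) / I.β }
    else { z := I.nextZ c, σ := I.trialStep c (I.lsIndex c) / I.β, B := I.nextB c ξ,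
           W := I.nextW c, γ := (I.nextOracle c ξ).1, S := (I.nextOracle c ξ).2, t := c.t + 1 } :=
  rfl

theorem measurable_nextOracle (hF : Continuous I.F) (hc : MeasurableState c) {ξ : X → Draw d}
    (hξ : Measurable ξ) : Measurable (fun x => (I.nextOracle (c x) (ξ x)).1) ∧
      MeasurableMat fun x => (I.nextOracle (c x) (ξ x)).2 := by
  have h := fun t => measurable_sepOracle I (measurable_nextW I hF hc) hξ t
  have ht : Measurable fun x => (c x).t + 1 :=
    (Measurable.of_discrete (f := fun n : ℕ => n + 1)).comp hc.t
  exact ⟨measurable_countable_index (fun t => (h t).1) ht,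
    fun i j => measurable_countable_index (fun t => (h t).2 i j) ht⟩

theorem MeasurableState.step (hF : Continuous I.F) (hc : MeasurableState c) {ξ : X → Draw d}
    (hξ : Measurable ξ) : MeasurableState fun x => I.step (c x) (ξ x) := by
  simp only [step_eq]
  have hls := measurable_lsIndex I hF hc
  have hη : Measurable fun x => I.trialStep (c x) (I.lsIndex (c x)) :=
    measurable_countable_index (measurable_trialStep I hc) hls
  have hzh : Measurable fun x => I.trialPoint (c x) (I.lsIndex (c x)) :=
    measurable_countable_index (measurable_trialPoint I hF hc) hls
  have hθ := measurable_const.div (measurable_const.add ((hη.const_mul 2).mul_const I.μ))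
    (f := fun _ => (1 : ℝ)) (g := fun x => 1 + 2 * I.trialStep (c x) (I.lsIndex (c x)) * I.μ)
  have hz : Measurable fun x => I.nextZ (c x) :=
    (hθ.smul (hc.z.sub (hη.smul (hF.measurable.comp hzh)))).add ((measurable_const.sub hθ).smul hzh)
  have hσ := hη.div_const I.β
  obtain ⟨ho1, ho2⟩ := measurable_nextOracle I hF hc hξ
  have hW := measurable_nextW I hF hc
  have hB : MeasurableMat fun x => I.nextB (c x) (ξ x) :=
    (MeasurableMat.smul measurable_const (MeasurableMat.ite (measurableSet_le ho1 measurable_const)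
      hW (MeasurableMat.smul (measurable_const.div ho1) hW))).add (MeasurableMat.const _)
  exact MeasurableState.ite (hls (measurableSet_singleton 0))
    ⟨hz, hσ, hc.B, hc.W, hc.γ, hc.S, hc.t⟩
    ⟨hz, hσ, hB, hW, ho1, ho2, (Measurable.of_discrete (f := fun n : ℕ => n + 1)).comp hc.t⟩

theorem measurableState_run (hF : Continuous I.F) {ζ : ℕ → X → Draw d} (hζ : ∀ k, Measurable (ζ k))
    (n : ℕ) : MeasurableState fun x => I.run (fun k => ζ k x) n := by
  induction n with
  | zero =>
    exact ⟨measurable_const, measurable_const, .const _, .const _, measurable_const, .const _,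
      measurable_const⟩
  | succ n ih => exact ih.step I hF (hζ n)

end StateMeasurability

theorem run_congr (I : Input d) {ξ ξ' : ℕ → Draw d} {n : ℕ} (h : ∀ k < n, ξ k = ξ' k) :
    I.run ξ n = I.run ξ' n := by
  induction n with
  | zero => rfl
  | succ n ih =>
    rw [Input.run, Input.run, ih fun k hk => h k (by omega), h n (by omega)]

/-! ### Success of the separation oracles -/

/-- The separation oracle, called on `W` in round `t`, bounds the numerical radius and, unless the
problem is a minimization problem, the operator norm of `W`. -/
def Input.OracleSuccess (I : Input d) (W : Mat (Fin d)) (t : ℕ) (ξ : Draw d) : Prop :=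
  (∀ x, |inner ℝ (matVec W x) x| ≤ (1 + I.δ) * (extEvec W I.δ (I.q t / 2) ξ.1.val).1 * ‖x‖ ^ 2) ∧
    ∀ x, ‖matVec W x‖ ≤ (1 + I.δ) * (3 * (maxSvec W I.δ (I.q t / 2) ξ.2.val).1) * ‖x‖

theorem measurableSet_oracleSuccess {X : Type*} [MeasurableSpace X] (I : Input d)
    {W : X → Mat (Fin d)} {ξ : X → Draw d} (hW : MeasurableMat W) (hξ : Measurable ξ) (t : ℕ) :
    MeasurableSet {x | I.OracleSuccess (W x) t (ξ x)} := by
  have ho₁ := (measurable_extEvec hW (measurable_subtype_coe.comp hξ.fst)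
    (fun x => by simp) I.δ (I.q t / 2)).1
  have ho₂ := (measurable_maxSvec hW (measurable_subtype_coe.comp hξ.snd)
    (fun x => by simp) I.δ (I.q t / 2)).1
  refine MeasurableSet.inter
    (measurableSet_forall_of_continuous (fun x => ?_) (fun x => by fun_prop) (fun y => ?_)
      fun y => ?_)
    (measurableSet_forall_of_continuous (fun x => (continuous_matVec _).norm)
      (fun x => by fun_prop) (fun y => (hW.matVec measurable_const).norm) fun y => ?_)
  · exact ((continuous_matVec _).inner continuous_id).abs
  · exact ((hW.matVec measurable_const).inner measurable_const).abs
  · exact (measurable_const.mul ho₁).mul_const _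
  · exact (measurable_const.mul (measurable_const.mul ho₂)).mul_const _

/-- For a fixed `W`, each oracle can fail only on a slab of probability at most `q_t / 2`; these are
the halves in the oracle calls. -/
theorem drawLaw_not_oracleSuccess_le (hd : 0 < d) (I : Input d) (hδ : 0 < I.δ) (W : Mat (Fin d))
    {t : ℕ} (hq0 : 0 < I.q t) (hq1 : I.q t ≤ 1) :
    drawLaw d {ξ | ¬I.OracleSuccess W t ξ} ≤ ENNReal.ofReal (I.q t) := by
  have : Nonempty (Fin d) := ⟨⟨0, hd⟩⟩
  have hq0' : 0 < I.q t / 2 := by linarith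
  have hq1' : I.q t / 2 ≤ 1 := by linarith
  obtain ⟨e₁, he₁, h₁⟩ := extEvec_accuracy hd W hδ hq0' hq1'
  obtain ⟨e₂, he₂, h₂⟩ := maxSvec_accuracy hd W hδ hq0' hq1'
  set s₁ := {v : UnitSphere (Fin d) |
    |inner ℝ e₁ v.val| ≤ 2 * (I.q t / 2) / √(11 * Fintype.card (Fin d))} with hs₁
  set s₂ := {v : UnitSphere (Fin d ⊕ Fin d) |
    |inner ℝ e₂ v.val| ≤ 2 * (I.q t / 2) / √(11 * Fintype.card (Fin d ⊕ Fin d))} with hs₂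
  have hsub : {ξ : Draw d | ¬I.OracleSuccess W t ξ} ⊆ (s₁ ×ˢ Set.univ) ∪ (Set.univ ×ˢ s₂) := by
    intro ξ hξ
    by_contra hnot
    simp only [Set.mem_union, Set.mem_prod, Set.mem_univ, and_true, true_and, not_or] at hnot
    refine hξ ⟨h₁ _ (by simp) ?_, h₂ _ (by simp) ?_⟩
    · have := hnot.1
      rw [hs₁, Set.mem_ofPred_eq, not_le, Fintype.card_fin] at this
      exact this
    · have := hnot.2
      rw [hs₂, Set.mem_ofPred_eq, not_le, Fintype.card_sum, Fintype.card_fin, ← two_mul] at this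
      exact this
  calc drawLaw d {ξ | ¬I.OracleSuccess W t ξ}
      ≤ drawLaw d (s₁ ×ˢ Set.univ) + drawLaw d (Set.univ ×ˢ s₂) :=
        (measure_mono hsub).trans (measure_union_le _ _)
    _ = uniformSphere _ s₁ + uniformSphere _ s₂ := by
        rw [drawLaw, Measure.prod_prod, Measure.prod_prod, measure_univ, measure_univ, mul_one,
          one_mul]
    _ ≤ ENNReal.ofReal (I.q t / 2) + ENNReal.ofReal (I.q t / 2) :=
        add_le_add (uniformSphere_slab_le he₁ hq0'.le) (uniformSphere_slab_le he₂ hq0'.le)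
    _ = ENNReal.ofReal (I.q t) := by
        rw [← ENNReal.ofReal_add hq0'.le hq0'.le, add_halves]

/-- All oracle calls made along a run are successful. -/
def Input.AllOraclesSucceed (I : Input d) (ξ : ℕ → Draw d) : Prop :=
  ∀ k, I.lsIndex (I.run ξ k) ≠ 0 →
    I.OracleSuccess (I.nextW (I.run ξ k)) ((I.run ξ k).t + 1) (ξ k)

theorem run_t_mono (I : Input d) (ξ : ℕ → Draw d) : Monotone fun k => (I.run ξ k).t := by
  refine monotone_nat_of_le_succ fun k => ?_
  rw [Input.run, step_eq]
  split_ifs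
  · exact le_rfl
  · exact Nat.le_succ _

theorem run_t_succ (I : Input d) (ξ : ℕ → Draw d) {k : ℕ} (h : I.lsIndex (I.run ξ k) ≠ 0) :
    (I.run ξ (k + 1)).t = (I.run ξ k).t + 1 := by
  rw [Input.run, step_eq, if_neg h]

section Probability

variable {Ω : Type*} [MeasurableSpace Ω] {P : Measure Ω} [IsProbabilityMeasure P]
  {ξ : ℕ → Ω → Draw d}

/-- The state at iteration `k` is a function of the first `k` draws and so independent of `ξ k`.
Integrating over the earlier draws first reduces to a fixed matrix, and keeping the event that round
`j + 1` takes place at iteration `k` preserves its probability as a factor. -/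
theorem measure_round_failure_le (hd : 0 < d) (I : Input d) (hF : Continuous I.F) (hδ : 0 < I.δ)
    (hξ : ∀ k, Measurable (ξ k)) (hlaw : ∀ k, P.map (ξ k) = drawLaw d) (hind : iIndepFun ξ P)
    {j : ℕ} (hq0 : 0 < I.q (j + 1)) (hq1 : I.q (j + 1) ≤ 1) (k : ℕ) :
    P {ω | (I.lsIndex (I.run (fun i => ξ i ω) k) ≠ 0 ∧ (I.run (fun i => ξ i ω) k).t = j) ∧
        ¬I.OracleSuccess (I.nextW (I.run (fun i => ξ i ω) k)) (j + 1) (ξ k ω)} ≤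
      ENNReal.ofReal (I.q (j + 1)) *
        P {ω | I.lsIndex (I.run (fun i => ξ i ω) k) ≠ 0 ∧ (I.run (fun i => ξ i ω) k).t = j} := by
  classical
  have : Nonempty (Fin d) := ⟨⟨0, hd⟩⟩
  obtain ⟨ω₀⟩ : Nonempty Ω := nonempty_of_isProbabilityMeasure P
  set Y : Ω → (Finset.range k → Draw d) := fun ω i => ξ i ω with hY
  have hYm : Measurable Y := measurable_pi_iff.2 fun i => hξ i
  -- The run expects an infinite sequence; later entries are padded by a fixed draw, which
  -- `run_congr` shows to be irrelevant.
  set ζ : ℕ → (Finset.range k → Draw d) → Draw d := fun i y =>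
    if h : i ∈ Finset.range k then y ⟨i, h⟩ else ξ 0 ω₀ with hζ
  have hζm : ∀ i, Measurable (ζ i) := fun i => by
    rw [hζ]
    by_cases h : i ∈ Finset.range k
    · simp only [h, dif_pos]; exact measurable_pi_apply _
    · simp only [h, dif_neg, not_false_eq_true]; exact measurable_const
  set c : (Finset.range k → Draw d) → State d := fun y => I.run (fun i => ζ i y) k with hc
  have hcm : MeasurableState c := measurableState_run I hF hζm k
  have hrun : ∀ ω, I.run (fun i => ξ i ω) k = c (Y ω) := fun ω =>
    run_congr I fun i hi => by simp [hζ, hY, hi]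
  have hindep : IndepFun Y (ξ k) P := by
    have h := hind.indepFun_finset (Finset.range k) {k} (by simp) hξ
    exact h.comp (φ := id) (ψ := fun y : ({k} : Finset ℕ) → Draw d => y ⟨k, by simp⟩)
      measurable_id (measurable_pi_apply _)
  have hprod : P.map (fun ω => (Y ω, ξ k ω)) = (P.map Y).prod (drawLaw d) := by
    rw [(indepFun_iff_map_prod_eq_prod_map_map hYm.aemeasurable (hξ k).aemeasurable).1 hindep,
      hlaw k]
  have : IsProbabilityMeasure (P.map Y) := Measure.isProbabilityMeasure_map hYm.aemeasurable
  have : IsProbabilityMeasure (drawLaw d) := by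
    unfold drawLaw; infer_instance
  set A : Set (Finset.range k → Draw d) := {y | I.lsIndex (c y) ≠ 0 ∧ (c y).t = j} with hA
  have hAm : MeasurableSet A :=
    ((measurable_lsIndex I hF hcm) (measurableSet_singleton 0)).compl.inter
      (hcm.t (measurableSet_singleton j))
  set F : Set ((Finset.range k → Draw d) × Draw d) :=
    {p | ¬I.OracleSuccess (I.nextW (c p.1)) (j + 1) p.2} with hFdef
  have hFm : MeasurableSet F := by
    have hW : MeasurableMat fun p : (Finset.range k → Draw d) × Draw d => I.nextW (c p.1) :=
      fun a b => (measurable_nextW I hF hcm a b).comp measurable_fst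
    exact (measurableSet_oracleSuccess I hW measurable_snd (j + 1)).compl
  have hEm : MeasurableSet ((Prod.fst ⁻¹' A) ∩ F) := (measurable_fst hAm).inter hFm
  simp only [hrun]
  have e1 : {ω | (I.lsIndex (c (Y ω)) ≠ 0 ∧ (c (Y ω)).t = j) ∧
      ¬I.OracleSuccess (I.nextW (c (Y ω))) (j + 1) (ξ k ω)} =
      (fun ω => (Y ω, ξ k ω)) ⁻¹' ((Prod.fst ⁻¹' A) ∩ F) := rfl
  have e2 : {ω | I.lsIndex (c (Y ω)) ≠ 0 ∧ (c (Y ω)).t = j} = Y ⁻¹' A := rfl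
  rw [e1, e2, ← Measure.map_apply (hYm.prodMk (hξ k)) hEm, ← Measure.map_apply hYm hAm, hprod,
    Measure.prod_apply hEm]
  calc _ ≤ ∫⁻ y, A.indicator (fun _ => ENNReal.ofReal (I.q (j + 1))) y ∂(P.map Y) := by
        refine lintegral_mono fun y => ?_
        by_cases hy : y ∈ A
        · rw [Set.indicator_of_mem hy]
          refine (measure_mono ?_).trans (drawLaw_not_oracleSuccess_le hd I hδ (I.nextW (c y)) hq0 hq1)
          intro x hx
          exact hx.2
        · rw [Set.indicator_of_notMem hy]
          refine le_of_eq ?_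
          have : Prod.mk y ⁻¹' ((Prod.fst ⁻¹' A) ∩ F) = ∅ := by
            ext x; simp [hy]
          rw [this, measure_empty]
    _ = _ := by rw [lintegral_indicator_const hAm]

/-- The union is organized by rounds rather than iterations. For a given round the events `A j k`
are disjoint in `k`, since the counter increases when a round is played, so their probabilities sum
to at most one and the round costs at most `q_{j+1}`. -/
theorem measure_not_allOraclesSucceed_le (hd : 0 < d) (I : Input d) (hF : Continuous I.F)
    (hδ : 0 < I.δ) (hp0 : 0 < I.p) (hp1 : I.p ≤ 1)
    (hξ : ∀ k, Measurable (ξ k)) (hlaw : ∀ k, P.map (ξ k) = drawLaw d) (hind : iIndepFun ξ P) :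
    P {ω | ¬I.AllOraclesSucceed fun k => ξ k ω} ≤ ENNReal.ofReal I.p := by
  set A : ℕ → ℕ → Set Ω := fun j k =>
    {ω | I.lsIndex (I.run (fun i => ξ i ω) k) ≠ 0 ∧ (I.run (fun i => ξ i ω) k).t = j} with hA
  have hAm : ∀ j k, MeasurableSet (A j k) := fun j k => by
    have h := measurableState_run I hF hξ k
    exact ((measurable_lsIndex I hF h) (measurableSet_singleton 0)).compl.inter
      (h.t (measurableSet_singleton j))
  have hdisj : ∀ j, Pairwise (Function.onFun Disjoint (A j)) := fun j => by
    have key : ∀ k k', k < k' → Disjoint (A j k) (A j k') := fun k k' hkk => by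
      rw [Set.disjoint_left]
      rintro ω ⟨h1, h2⟩ ⟨-, h4⟩
      have h5 := run_t_succ I (fun i => ξ i ω) h1
      have h6 := run_t_mono I (fun i => ξ i ω) hkk
      simp only at h6
      rw [Nat.succ_eq_add_one, h5] at h6
      omega
    intro k k' hne
    rcases lt_or_gt_of_ne hne with h | h
    · exact key k k' h
    · exact (key k' k h).symm
  have hsub : {ω | ¬I.AllOraclesSucceed fun k => ξ k ω} ⊆ ⋃ j, ⋃ k,
      {ω | (I.lsIndex (I.run (fun i => ξ i ω) k) ≠ 0 ∧ (I.run (fun i => ξ i ω) k).t = j) ∧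
        ¬I.OracleSuccess (I.nextW (I.run (fun i => ξ i ω) k)) (j + 1) (ξ k ω)} := by
    intro ω hω
    rw [Set.mem_ofPred_eq, Input.AllOraclesSucceed] at hω
    push Not at hω
    obtain ⟨k, h1, h2⟩ := hω
    exact Set.mem_iUnion.2 ⟨_, Set.mem_iUnion.2 ⟨k, ⟨h1, rfl⟩, h2⟩⟩
  refine (measure_mono hsub).trans ((measure_iUnion_le _).trans ?_)
  refine (ENNReal.tsum_le_tsum fun j => ?_).trans (I.tsum_q_le hp0)
  refine (measure_iUnion_le _).trans ?_
  calc _ ≤ ∑' k, ENNReal.ofReal (I.q (j + 1)) * P (A j k) :=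
        ENNReal.tsum_le_tsum fun k => measure_round_failure_le hd I hF hδ hξ hlaw hind
          (I.q_succ_pos hp0 j) (I.q_succ_le_one hp0 hp1 j) k
    _ = ENNReal.ofReal (I.q (j + 1)) * P (⋃ k, A j k) := by
        rw [ENNReal.tsum_mul_left, measure_iUnion (hdisj j) (hAm j)]
    _ ≤ ENNReal.ofReal (I.q (j + 1)) * 1 := by gcongr; exact prob_le_one
    _ = _ := mul_one _

end Probability

end QNPE

/-! ### Deterministic consequences of oracle success for a single iteration. -/

namespace QNPE

variable {d : ℕ}

/-! ### Symmetric matrices and the numerical radius -/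

theorem norm_matVec_le_of_numericalRadius {T : Mat (Fin d)} (hT : T.IsSymm) {L : ℝ} (hL : 0 ≤ L)
    (h : ∀ x, |inner ℝ (matVec T x) x| ≤ L * ‖x‖ ^ 2) (x : Vec (Fin d)) :
    ‖matVec T x‖ ≤ L * ‖x‖ := by
  have := norm_aeval_le (matLin_isSymmetric hT) (P := Polynomial.X) (m := -L) (M := L)
    (fun x => by have := (abs_le.1 (h x)).1; rw [matLin_apply]; linarith)
    (fun x => (abs_le.1 (h x)).2) hL (fun t ht => by
      rw [Polynomial.eval_X]; exact abs_le.2 ht) x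
  simpa using this

theorem inner_nonneg_of_posSemidef {A : Mat (Fin d)} (hA : A.PosSemidef) (x : Vec (Fin d)) :
    0 ≤ inner ℝ (matVec A x) x := by
  have := hA.dotProduct_mulVec_nonneg x.ofLp
  rw [inner_eq_dotProduct, dotProduct_comm]
  simpa [matVec] using this

theorem proj_isSymm {cls : ProblemClass d} (h : cls.IsMinimization) (W : Mat (Fin d)) :
    (cls.proj W).IsSymm := by
  cases cls with
  | equation Ω => exact h.elim
  | minimax m => exact h.elim
  | minimization Ω =>
    ext i j
    simp only [ProblemClass.proj, Matrix.transpose_apply, Matrix.of_apply]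
    have : (((j, i) ∈ Ω ∧ (i, j) ∈ Ω) ∨ j = i) ↔ (((i, j) ∈ Ω ∧ (j, i) ∈ Ω) ∨ i = j) := by
      rw [and_comm, eq_comm]
    split_ifs with h1 h2 h2
    · rw [add_comm]
    · exact absurd (this.1 h1) h2
    · exact absurd (this.2 h2) h1
    · rfl

/-! ### Bounds on the Jacobian approximations -/

/-- The bounds on Jacobian approximations that hold as long as the oracles succeed. -/
structure Input.Regular (I : Input d) (B : Mat (Fin d)) : Prop where
  coercive : ∀ x, I.μ / 2 * ‖x‖ ^ 2 ≤ inner ℝ (matVec B x) x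
  bounded : ∀ x, ‖matVec B x‖ ≤ 7 * I.L₁ * ‖x‖
  symm : I.cls.IsMinimization → B.IsSymm

/-- The symmetry of the matrices of the online learning algorithm for minimization. -/
def Input.SymmState (I : Input d) (c : State d) : Prop :=
  I.cls.IsMinimization → c.W.IsSymm ∧ c.S.IsSymm

theorem nextW_isSymm (I : Input d) {c : State d} (hc : I.SymmState c)
    (h : I.cls.IsMinimization) : (I.nextW c).IsSymm := by
  obtain ⟨hW, hS⟩ := hc h
  have hG := Matrix.IsSymm.smul (proj_isSymm h (I.lossGrad c)) (1 / I.L₁)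
  refine Matrix.IsSymm.smul (hW.sub (Matrix.IsSymm.smul ?_ _)) _
  split_ifs
  · exact hG
  · exact hG.add (Matrix.IsSymm.smul hS _)

theorem symmState_step (I : Input d) {c : State d} (hc : I.SymmState c) (ξ : Draw d) :
    I.SymmState (I.step c ξ) := by
  intro h
  rw [step_eq]
  split_ifs
  · exact hc h
  · exact ⟨nextW_isSymm I hc h, proj_isSymm h _⟩

theorem matVec_mone_smul (a : ℝ) (x : Vec (Fin d)) : matVec (a • (1 : Mat (Fin d))) x = a • x := by
  rw [matVec_msmul, matVec_one]

/-- After division by `max 1 γ`, the matrix has numerical radius at most `1 + δ` and norm at most `3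
(1 + δ)`; for minimization symmetry gives the latter from the former. As `L₁ δ = μ / 2`, the shift
by `L₁ + μ` leaves coercivity `μ / 2`, and the norm is at most `4 L₁ + 5 μ / 2 ≤ 7 L₁`. -/
theorem nextB_regular (I : Input d) (hμ : 0 < I.μ) (hμL : I.μ ≤ I.L₁) {c : State d}
    (hc : I.SymmState c) {ξ : Draw d} (hs : I.OracleSuccess (I.nextW c) (c.t + 1) ξ) :
    I.Regular (I.nextB c ξ) := by
  have hL : 0 < I.L₁ := hμ.trans_le hμL
  have hδ : I.δ = I.μ / (2 * I.L₁) := rfl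
  have hδ0 : 0 < I.δ := by rw [hδ]; positivity
  have hδ1 : I.δ ≤ 1 / 2 := by
    rw [hδ, div_le_div_iff₀ (by positivity) (by norm_num)]; linarith
  have hδL : I.L₁ * I.δ = I.μ / 2 := by rw [hδ]; field_simp
  obtain ⟨h1, h2⟩ := hs
  set W := I.nextW c with hW
  set γ := (I.nextOracle c ξ).1 with hγ
  set g₁ := (extEvec W I.δ (I.q (c.t + 1) / 2) ξ.1.val).1 with hg₁
  set g₂ := (maxSvec W I.δ (I.q (c.t + 1) / 2) ξ.2.val).1 with hg₂
  -- The method passes `symPart W` to `extEvec`, which symmetrizes again; the second symmetrization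
  -- changes nothing.
  have hg₁' : (extEvec (symPart W) I.δ (I.q (c.t + 1) / 2) ξ.1.val).1 = g₁ := by
    simp only [hg₁, extEvec, symPart_eq_self (symPart_isSymm W)]
  have hγ₁ : g₁ ≤ γ := by
    rw [hγ]
    simp only [Input.nextOracle, Input.sepOracle]
    split_ifs with h
    · exact hg₁'.ge
    · push Not at h
      rw [← hg₁']
      exact h.2.le
  have hγ₂ : ¬I.cls.IsMinimization → g₂ ≤ γ := fun hmin => by
    rw [hγ]
    simp only [Input.nextOracle, Input.sepOracle]
    split_ifs with h
    · exact h.resolve_left hmin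
    · exact le_rfl
  set Bh := if γ ≤ 1 then W else (1 / γ) • W with hBh
  have hB : I.nextB c ξ = I.L₁ • Bh + (I.L₁ + I.μ) • (1 : Mat (Fin d)) := rfl
  have hBh1 : ∀ x, |inner ℝ (matVec Bh x) x| ≤ (1 + I.δ) * ‖x‖ ^ 2 := fun x => by
    have h3 : |inner ℝ (matVec W x) x| ≤ (1 + I.δ) * γ * ‖x‖ ^ 2 := (h1 x).trans (by gcongr)
    rw [hBh]
    split_ifs with h
    · refine h3.trans ?_
      gcongr
      nlinarith
    · have hγ0 : 0 < γ := by linarith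
      rw [matVec_msmul, inner_smul_left, conj_trivial, abs_mul, abs_of_pos (by positivity),
        one_div, inv_mul_le_iff₀ hγ0]
      linarith
  have hBh2 : ¬I.cls.IsMinimization → ∀ x, ‖matVec Bh x‖ ≤ 3 * (1 + I.δ) * ‖x‖ := fun hmin x => by
    have h3 : ‖matVec W x‖ ≤ (1 + I.δ) * (3 * γ) * ‖x‖ := by
      refine (h2 x).trans ?_
      have := hγ₂ hmin
      gcongr
    rw [hBh]
    split_ifs with h
    · refine h3.trans (mul_le_mul_of_nonneg_right ?_ (norm_nonneg x))
      nlinarith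
    · have hγ0 : 0 < γ := by linarith
      rw [matVec_msmul, norm_smul, Real.norm_of_nonneg (by positivity), one_div,
        inv_mul_le_iff₀ hγ0]
      linarith
  have hBhs : I.cls.IsMinimization → Bh.IsSymm := fun hmin => by
    have := nextW_isSymm I hc hmin
    rw [hBh]
    split_ifs
    · exact this
    · exact Matrix.IsSymm.smul this _
  have hBh3 : ∀ x, ‖matVec Bh x‖ ≤ 3 * (1 + I.δ) * ‖x‖ := fun x => by
    by_cases hmin : I.cls.IsMinimization
    · refine (norm_matVec_le_of_numericalRadius (hBhs hmin) (by positivity) hBh1 x).trans ?_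
      gcongr
      linarith
    · exact hBh2 hmin x
  refine ⟨fun x => ?_, fun x => ?_, fun hmin => ?_⟩
  · rw [hB, matVec_madd, matVec_msmul, matVec_mone_smul, inner_add_left, inner_smul_left,
      inner_smul_left, real_inner_self_eq_norm_sq, conj_trivial, conj_trivial]
    have := (abs_le.1 (hBh1 x)).1
    have h4 : I.L₁ * (-((1 + I.δ) * ‖x‖ ^ 2)) ≤ I.L₁ * inner ℝ (matVec Bh x) x := by gcongr
    have h5 : I.L₁ * (-((1 + I.δ) * ‖x‖ ^ 2)) = -(I.L₁ + I.μ / 2) * ‖x‖ ^ 2 := by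
      rw [← hδL]; ring
    linarith
  · rw [hB, matVec_madd, matVec_msmul, matVec_mone_smul]
    refine (norm_add_le _ _).trans ?_
    rw [norm_smul, norm_smul, Real.norm_of_nonneg hL.le, Real.norm_of_nonneg (by linarith)]
    have hx := norm_nonneg x
    calc I.L₁ * ‖matVec Bh x‖ + (I.L₁ + I.μ) * ‖x‖
        ≤ I.L₁ * (3 * (1 + I.δ) * ‖x‖) + (I.L₁ + I.μ) * ‖x‖ := by gcongr; exact hBh3 x
      _ = (3 * I.L₁ + 3 * (I.L₁ * I.δ) + I.L₁ + I.μ) * ‖x‖ := by ring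
      _ ≤ _ := by
        rw [hδL]
        gcongr
        linarith
  · rw [hB]
    exact (Matrix.IsSymm.smul (hBhs hmin) _).add (Matrix.IsSymm.smul Matrix.isSymm_one _)

theorem B₀_regular (I : Input d) (hμ : 0 < I.μ) (hμL : I.μ ≤ I.L₁)
    (hB : I.cls.MemZ I.μ I.L₁ I.B₀) : I.Regular I.B₀ := by
  have hL : 0 < I.L₁ := hμ.trans_le hμL
  obtain ⟨h1, h2, h3, h4⟩ := hB
  have hlow : ∀ x, I.μ * ‖x‖ ^ 2 ≤ inner ℝ (matVec I.B₀ x) x := fun x => by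
    have := inner_nonneg_of_posSemidef h1 x
    rw [matVec_msub, matVec_mone_smul, inner_sub_left, inner_symPart, inner_smul_left,
      real_inner_self_eq_norm_sq, conj_trivial] at this
    linarith
  have hup : ∀ x, inner ℝ (matVec I.B₀ x) x ≤ I.L₁ * ‖x‖ ^ 2 := fun x => by
    have := inner_nonneg_of_posSemidef h2 x
    rw [matVec_msub, matVec_mone_smul, inner_sub_left, inner_symPart, inner_smul_left,
      real_inner_self_eq_norm_sq, conj_trivial] at this
    linarith
  have hsymm : I.cls.IsMinimization → I.B₀.IsSymm := fun hmin => by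
    cases hcls : I.cls with
    | equation Ω => rw [hcls] at hmin; exact hmin.elim
    | minimax m => rw [hcls] at hmin; exact hmin.elim
    | minimization Ω => rw [hcls] at h4; exact h4.1
  refine ⟨fun x => ?_, fun x => ?_, hsymm⟩
  · refine le_trans ?_ (hlow x)
    gcongr
    linarith
  · have h5 : ‖matVec I.B₀ x‖ ≤ I.L₁ * ‖x‖ := by
      by_cases hmin : I.cls.IsMinimization
      · refine norm_matVec_le_of_numericalRadius (hsymm hmin) hL.le (fun y => ?_) x
        rw [abs_of_nonneg ((by positivity : 0 ≤ I.μ * ‖y‖ ^ 2).trans (hlow y))]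
        exact hup y
      · exact h3 hmin x
    refine h5.trans ?_
    gcongr
    linarith

theorem symmState_init (I : Input d) (hB : I.Regular I.B₀) : I.SymmState I.init := fun hmin =>
  ⟨Matrix.IsSymm.smul ((hB.symm hmin).sub (Matrix.IsSymm.smul Matrix.isSymm_one _)) _,
    Matrix.isSymm_zero⟩

theorem run_regular (I : Input d) (hμ : 0 < I.μ) (hμL : I.μ ≤ I.L₁)
    (hB : I.cls.MemZ I.μ I.L₁ I.B₀) {ξ : ℕ → Draw d} (hξ : I.AllOraclesSucceed ξ) (k : ℕ) :
    I.Regular (I.run ξ k).B ∧ I.SymmState (I.run ξ k) := by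
  induction k with
  | zero =>
    have h := B₀_regular I hμ hμL hB
    exact ⟨h, symmState_init I h⟩
  | succ k ih =>
    refine ⟨?_, symmState_step I ih.2 _⟩
    rw [Input.run, step_eq]
    split_ifs with h
    · exact ih.1
    · exact nextB_regular I hμ hμL ih.2 (hξ k h)

/-! ### One iteration -/

section Iteration

variable {I : Input d} {c : State d}

theorem trialA_bounds (hB : I.Regular c.B) {i : ℕ}
    (hη : 0 < I.trialStep c i) :
    (∀ x, (1 + I.trialStep c i * I.μ / 2) * ‖x‖ ^ 2 ≤ inner ℝ (matVec (I.trialA c i) x) x) ∧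
      ∀ x, ‖matVec (I.trialA c i) x‖ ≤ (1 + 7 * I.trialStep c i * I.L₁) * ‖x‖ := by
  refine ⟨fun x => ?_, fun x => ?_⟩
  · rw [Input.trialA, matVec_madd, matVec_one, matVec_msmul, inner_add_left, inner_smul_left,
      real_inner_self_eq_norm_sq, conj_trivial]
    have := mul_le_mul_of_nonneg_left (hB.coercive x) hη.le
    linarith
  · rw [Input.trialA, matVec_madd, matVec_one, matVec_msmul]
    refine (norm_add_le _ _).trans ?_
    rw [norm_smul, Real.norm_of_nonneg hη.le]
    have := mul_le_mul_of_nonneg_left (hB.bounded x) hη.le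
    linarith

/-- The condition number of the problem, up to the exponent `1 / 2` gained in minimization. -/
def Input.condFactor (I : Input d) : ℝ :=
  open scoped Classical in if I.cls.IsMinimization then √(I.L₁ / I.μ) else I.L₁ / I.μ

theorem one_le_condFactor (hμ : 0 < I.μ) (hμL : I.μ ≤ I.L₁) : 1 ≤ I.condFactor := by
  have h : 1 ≤ I.L₁ / I.μ := (one_le_div hμ).2 hμL
  unfold Input.condFactor
  split_ifs
  · exact Real.one_le_sqrt.2 h
  · exact h

/-- The ratio of `1 + 7 η L₁` to `1 + η μ / 2` is at most `14 L₁ / μ` whatever `η` is. Outside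
minimization a trial matrix may happen to be symmetric; the rate `√(m / M) ≥ m / M` is then only
better. -/
theorem trialA_rate (hμ : 0 < I.μ) (hμL : I.μ ≤ I.L₁) (hB : I.Regular c.B) {i : ℕ}
    (hη : 0 < I.trialStep c i) :
    1 ≤ 14 * I.condFactor * solverRate (I.trialA c i) (1 + I.trialStep c i * I.μ / 2)
      (1 + 7 * I.trialStep c i * I.L₁) := by
  set η := I.trialStep c i with hηdef
  have hL : 0 < I.L₁ := hμ.trans_le hμL
  set m := 1 + η * I.μ / 2 with hm
  set M := 1 + 7 * η * I.L₁ with hM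
  have hm0 : 0 < m := by positivity
  have hM0 : 0 < M := by positivity
  have hκ : 1 ≤ I.L₁ / I.μ := (one_le_div hμ).2 hμL
  have hMm : 1 ≤ 14 * (I.L₁ / I.μ) * (m / M) := by
    rw [mul_div_assoc', le_div_iff₀ hM0, hm, hM]
    have : 14 * (I.L₁ / I.μ) * (1 + η * I.μ / 2) = 14 * (I.L₁ / I.μ) + 7 * η * I.L₁ := by
      field_simp; ring
    rw [this]
    linarith
  have hmM : m / M ≤ 1 := by
    rw [div_le_one hM0, hm, hM]
    nlinarith [mul_pos hη hL, mul_le_mul_of_nonneg_left hμL hη.le]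
  have hsqrt : 1 ≤ 14 * √(I.L₁ / I.μ) * √(m / M) := by
    have h1 : 1 ≤ √(14 * (I.L₁ / I.μ) * (m / M)) := Real.one_le_sqrt.2 hMm
    rw [Real.sqrt_mul (by positivity), Real.sqrt_mul (by norm_num)] at h1
    refine h1.trans ?_
    gcongr
    rw [Real.sqrt_le_left (by norm_num)]
    norm_num
  unfold Input.condFactor solverRate
  by_cases hmin : I.cls.IsMinimization
  · have hA : (I.trialA c i).IsSymm :=
      Matrix.isSymm_one.add (Matrix.IsSymm.smul (hB.symm hmin) _)
    rw [if_pos hmin, if_pos hA]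
    exact hsqrt
  · rw [if_neg hmin]
    split_ifs
    · refine hMm.trans ?_
      gcongr
      exact Real.le_sqrt_of_sq_le (by nlinarith [div_pos hm0 hM0])
    · exact hMm

/-- At most `7 κ log Λ + 1` solver iterations, with `κ` the condition factor, at two products each,
plus the initial one. -/
theorem trial_cost (hμ : 0 < I.μ) (hμL : I.μ ≤ I.L₁) (hα₁ : 0 < I.α₁) (hB : I.Regular c.B) {i : ℕ}
    (hη : 0 < I.trialStep c i) {Λ : ℝ} (hΛ : 4 ≤ Λ)
    (hΛ' : 4 * (1 + 7 * I.trialStep c i * I.L₁) ≤ Λ * I.α₁) :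
    (solverStops (I.trialA c i) (I.trialRhs c i) (I.trialTol c i)).Nonempty ∧
      ∃ n : ℕ, linearSolverMV (I.trialA c i) (I.trialRhs c i) (I.trialTol c i) = n ∧
        (n : ℝ) ≤ 14 * I.condFactor * Real.log Λ + 3 := by
  have hL : 0 < I.L₁ := hμ.trans_le hμL
  obtain ⟨h1, h2⟩ := trialA_bounds hB hη
  have hτ : I.α₁ ≤ I.trialTol c i := by
    rw [Input.trialTol]
    refine le_mul_of_one_le_right hα₁.le (Real.one_le_sqrt.2 ?_)
    nlinarith [mul_pos hη hμ]
  have hm0 : 0 < 1 + I.trialStep c i * I.μ / 2 := by positivity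
  have hM0 : 0 < 1 + 7 * I.trialStep c i * I.L₁ := by positivity
  obtain ⟨hne, hle⟩ := solverStops_bound hm0 hM0 h1 h2 (I.trialRhs c i) (τ := I.trialTol c i) hΛ
    (hΛ'.trans (by gcongr))
  refine ⟨hne, _, by rw [linearSolverMV, if_pos hne], ?_⟩
  have hrate := trialA_rate hμ hμL hB hη
  set r := solverRate (I.trialA c i) (1 + I.trialStep c i * I.μ / 2)
      (1 + 7 * I.trialStep c i * I.L₁) with hr
  have hr0 : 0 < r := by
    rw [hr]; unfold solverRate; split_ifs <;> positivity
  have hlog : 0 ≤ Real.log Λ := Real.log_nonneg (by linarith)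
  have h3 : Real.log Λ / (2 * r) ≤ 7 * I.condFactor * Real.log Λ := by
    rw [div_le_iff₀ (by positivity)]
    nlinarith
  set n := sInf (solverStops (I.trialA c i) (I.trialRhs c i) (I.trialTol c i)) with hn
  have hn0 : (0 : ℝ) ≤ n := Nat.cast_nonneg n
  have h4 : ((1 + (if (I.trialA c i).IsSymm then 1 else 2) * n : ℕ) : ℝ) ≤ 1 + 2 * n := by
    split_ifs
    · push_cast; linarith
    · push_cast; linarith
  refine (le_trans (le_of_eq ?_) h4).trans (by linarith)
  congr 3

/-- The tested residual is minus the linear solver's residual plus `η (F ẑ - F z - B s)`. The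
solver's tolerance is the `α₁` part; the remainder is at most `η (L₁ + 7 L₁) ‖s‖`, below the `α₂`
part. Strictness needs `s ≠ 0`, which follows from `F z ≠ 0`. -/
theorem mem_accepted (hμ : 0 < I.μ)
    (hlip : ∀ z z', ‖I.F z - I.F z'‖ ≤ I.L₁ * ‖z - z'‖) (hB : I.Regular c.B) (hF : I.F c.z ≠ 0)
    {i : ℕ} (hη : 0 < I.trialStep c i)
    (hne : (solverStops (I.trialA c i) (I.trialRhs c i) (I.trialTol c i)).Nonempty)
    (hsmall : 8 * I.trialStep c i * I.L₁ < I.α₂) : i ∈ I.accepted c := by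
  set η := I.trialStep c i with hηdef
  set s := linearSolver (I.trialA c i) (I.trialRhs c i) (I.trialTol c i) with hs
  have hp : I.trialPoint c i - c.z = s := by rw [Input.trialPoint, add_sub_cancel_left]
  have hres := linearSolver_residual hne
  rw [← hs] at hres
  have hsqrt : 1 ≤ √(1 + η * I.μ) := Real.one_le_sqrt.2 (by nlinarith [mul_pos hη hμ])
  have hs0 : 0 < ‖s‖ := by
    rw [norm_pos_iff]
    intro h0
    rw [h0, matVec_vzero, norm_zero, mul_zero, sub_zero] at hres
    have hb : I.trialRhs c i = 0 := norm_eq_zero.1 (le_antisymm hres (norm_nonneg _))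
    rw [Input.trialRhs, neg_eq_zero, smul_eq_zero] at hb
    exact hb.elim hη.ne' hF
  have hdecomp : s + η • I.F (I.trialPoint c i) =
      -(I.trialRhs c i - matVec (I.trialA c i) s) +
        η • (I.F (I.trialPoint c i) - I.F c.z - matVec c.B s) := by
    rw [Input.trialRhs, Input.trialA, matVec_madd, matVec_one, matVec_msmul, ← hηdef]
    module
  have hlin : ‖I.F (I.trialPoint c i) - I.F c.z - matVec c.B s‖ ≤ 8 * I.L₁ * ‖s‖ := by
    refine (norm_sub_le _ _).trans ?_
    have h1 := hlip (I.trialPoint c i) c.z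
    rw [hp] at h1
    linarith [hB.bounded s]
  simp only [Input.accepted, Set.mem_ofPred_eq]
  rw [hp, hdecomp, ← hηdef]
  calc _ ≤ ‖I.trialRhs c i - matVec (I.trialA c i) s‖ +
        η * ‖I.F (I.trialPoint c i) - I.F c.z - matVec c.B s‖ := by
        refine (norm_add_le _ _).trans ?_
        rw [norm_neg, norm_smul, Real.norm_of_nonneg hη.le]
    _ ≤ I.α₁ * √(1 + η * I.μ) * ‖s‖ + η * (8 * I.L₁ * ‖s‖) := by
        gcongr
        exact hres
    _ < I.α₁ * √(1 + η * I.μ) * ‖s‖ + I.α₂ * √(1 + η * I.μ) * ‖s‖ := by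
        have hα₂ : 0 ≤ I.α₂ := by
          by_contra! h
          have h1 : 0 ≤ I.L₁ * ‖s‖ := by
            have := hlip (c.z + s) c.z
            rw [add_sub_cancel_left] at this
            exact (norm_nonneg _).trans this
          have h2 : 0 ≤ I.L₁ := nonneg_of_mul_nonneg_left h1 hs0
          nlinarith [mul_nonneg hη.le h2]
        have h1 : 8 * η * I.L₁ * ‖s‖ < I.α₂ * ‖s‖ := by gcongr
        have h2 : I.α₂ * ‖s‖ ≤ I.α₂ * √(1 + η * I.μ) * ‖s‖ := by
          gcongr
          exact le_mul_of_one_le_right hα₂ hsqrt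
        linarith
    _ = _ := by ring

/-- The hybrid proximal extragradient step contracts. -/
theorem contraction {E : Type*} [NormedAddCommGroup E] [InnerProductSpace ℝ E] {z zh F zs : E}
    {η μ α θ : ℝ} (hη : 0 < η) (hμ : 0 < μ) (hα : α ≤ 1)
    (hθ : θ = 1 / (1 + 2 * η * μ))
    (hmon : μ * ‖zh - zs‖ ^ 2 ≤ inner ℝ F (zh - zs))
    (hacc : ‖zh - z + η • F‖ ≤ α * √(1 + η * μ) * ‖zh - z‖) :
    (1 + 2 * η * μ) * ‖θ • (z - η • F) + (1 - θ) • zh - zs‖ ^ 2 ≤ ‖z - zs‖ ^ 2 := by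
  have hημ : 0 < η * μ := mul_pos hη hμ
  set e := zh - z + η • F with he
  set a := zh - zs with ha
  set b := zh - z with hb
  -- The new error is the error of the trial point minus `θ` times the acceptance residual, so
  -- expanding the square involves only `a`, `b`, `e` and strong monotonicity at the trial point.
  have hz' : θ • (z - η • F) + (1 - θ) • zh - zs = a - θ • e := by
    rw [ha, he, hb]; module
  have hzz : z - zs = a - b := by rw [ha, hb]; abel
  rw [hz', hzz, norm_sub_sq_real a (θ • e), norm_sub_sq_real a b, inner_smul_right, norm_smul, mul_pow,
    Real.norm_eq_abs, sq_abs]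
  have hea : inner ℝ a e = inner ℝ a b + η * inner ℝ F a := by
    rw [he, inner_add_right, inner_smul_right, real_inner_comm a F]
  have hesq : ‖e‖ ^ 2 ≤ (1 + η * μ) * ‖b‖ ^ 2 := by
    have h1 : ‖e‖ ≤ √(1 + η * μ) * ‖b‖ := by
      refine hacc.trans ?_
      gcongr
      exact mul_le_of_le_one_left (Real.sqrt_nonneg _) hα
    calc ‖e‖ ^ 2 ≤ (√(1 + η * μ) * ‖b‖) ^ 2 := by gcongr
      _ = _ := by rw [mul_pow, Real.sq_sqrt (by positivity)]
  have hθ0 : 0 < θ := by rw [hθ]; positivity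
  have hθ1 : (1 + 2 * η * μ) * θ = 1 := by rw [hθ]; field_simp
  have h1 : η * (μ * ‖a‖ ^ 2) ≤ η * inner ℝ F a := by gcongr
  have h2 : θ * ‖e‖ ^ 2 ≤ ‖b‖ ^ 2 := by
    -- The weight `θ` absorbs the factor `1 + η μ` that the acceptance test tolerates.
    have h3 : θ * (1 + η * μ) ≤ 1 := by nlinarith
    calc θ * ‖e‖ ^ 2 ≤ θ * ((1 + η * μ) * ‖b‖ ^ 2) := by gcongr
      _ = θ * (1 + η * μ) * ‖b‖ ^ 2 := by ring
      _ ≤ 1 * ‖b‖ ^ 2 := by gcongr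
      _ = _ := one_mul _
  rw [hea]
  have h4 : (1 + 2 * η * μ) * (‖a‖ ^ 2 - 2 * (θ * (inner ℝ a b + η * inner ℝ F a)) +
      θ ^ 2 * ‖e‖ ^ 2) = (1 + 2 * η * μ) * ‖a‖ ^ 2 - 2 * (inner ℝ a b + η * inner ℝ F a) +
      θ * ‖e‖ ^ 2 := by
    linear_combination (-2 * (inner ℝ a b + η * inner ℝ F a) + θ * ‖e‖ ^ 2) * hθ1
  rw [h4]
  linarith

end Iteration

end QNPE

/-! ### The whole run: step sizes, finite termination and total costs. -/

namespace QNPE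

variable {d : ℕ}

theorem Input.StronglyMonotoneSetting.μ_le_L₁ {I : Input d} {L₂ : ℝ}
    (hS : I.StronglyMonotoneSetting L₂) (hd : 0 < d) : I.μ ≤ I.L₁ := by
  set e : Vec (Fin d) := EuclideanSpace.single ⟨0, hd⟩ 1 with he
  have h1 : ‖e‖ = 1 := by simp [he]
  have h2 := hS.stronglyMonotone e 0
  have h3 := hS.lipschitz e 0
  rw [sub_zero, h1] at h2 h3
  have h4 := real_inner_le_norm (I.F e - I.F 0) e
  rw [h1] at h4
  linarith

theorem Input.StronglyMonotoneSetting.F_ne_zero {I : Input d} {L₂ : ℝ}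
    (hS : I.StronglyMonotoneSetting L₂) {zs z : Vec (Fin d)} (hzs : I.F zs = 0) (hz : z ≠ zs) :
    I.F z ≠ 0 := by
  intro h0
  have h1 := hS.stronglyMonotone z zs
  rw [h0, hzs, sub_zero, inner_zero_left] at h1
  have h2 : 0 < ‖z - zs‖ := norm_pos_iff.2 (sub_ne_zero.2 hz)
  have := mul_pos hS.μ_pos (pow_pos h2 2)
  linarith

/-- A lower bound on all accepted step sizes. -/
def Input.minStep (I : Input d) : ℝ := I.α₂ * I.β / (8 * I.L₁)

section Iteration

variable {I : Input d} {L₂ : ℝ} {c : State d}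

theorem minStep_pos (hd : 0 < d) (hS : I.StronglyMonotoneSetting L₂) (hV : I.ValidParameters) :
    0 < I.minStep := by
  have hL : 0 < I.L₁ := hS.μ_pos.trans_le (hS.μ_le_L₁ hd)
  have h1 := hV.α₂_mem.1
  have h2 := hV.β_mem.1
  unfold Input.minStep
  positivity

theorem trialStep_pos (hV : I.ValidParameters) (hσ : 0 < c.σ) (i : ℕ) : 0 < I.trialStep c i :=
  mul_pos hσ (pow_pos hV.β_mem.1 i)

theorem trialStep_le (hV : I.ValidParameters) (hσ : 0 < c.σ) (i : ℕ) : I.trialStep c i ≤ c.σ :=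
  mul_le_of_le_one_right hσ.le (pow_le_one₀ hV.β_mem.1.le hV.β_mem.2.le)

/-- The line search terminates, with a step size that is not too small. -/
theorem lineSearch (hd : 0 < d) (hS : I.StronglyMonotoneSetting L₂) (hV : I.ValidParameters)
    (hB : I.Regular c.B) (hσ : I.minStep ≤ c.σ) (hF : I.F c.z ≠ 0) :
    (I.accepted c).Nonempty ∧ I.minStep ≤ I.trialStep c (I.lsIndex c) := by
  have hμL := hS.μ_le_L₁ hd
  have hL : 0 < I.L₁ := hS.μ_pos.trans_le hμL
  have hσ0 : 0 < c.σ := (minStep_pos hd hS hV).trans_le hσ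
  have hα₁ := hV.α₁_mem.1
  have hβ := hV.β_mem.1
  have hacc : ∀ i, 8 * I.trialStep c i * I.L₁ < I.α₂ → i ∈ I.accepted c := fun i hi => by
    have hη := trialStep_pos hV hσ0 i
    refine mem_accepted hS.μ_pos hS.lipschitz hB hF hη ?_ hi
    -- Only termination of the solver is wanted here, so `Λ` may be as large as the trial requires.
    refine (trial_cost hS.μ_pos hμL hα₁ hB hη (le_max_left 4
      (4 * (1 + 7 * I.trialStep c i * I.L₁) / I.α₁)) ?_).1
    rw [← div_le_iff₀ hα₁]
    exact le_max_right _ _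
  have hne : (I.accepted c).Nonempty := by
    obtain ⟨i, hi⟩ := exists_pow_lt_of_lt_one
      (show 0 < I.α₂ / (8 * c.σ * I.L₁) by have := hV.α₂_mem.1; positivity) hV.β_mem.2
    refine ⟨i, hacc i ?_⟩
    rw [lt_div_iff₀ (by positivity)] at hi
    rw [Input.trialStep]
    linarith
  refine ⟨hne, ?_⟩
  rcases Nat.eq_zero_or_pos (I.lsIndex c) with h0 | h0
  · rw [h0, Input.trialStep, pow_zero, mul_one]
    exact hσ
  -- The last rejected step is at least `α₂ / (8 L₁)`, and the accepted one is `β` times that.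
  · have hrej : I.lsIndex c - 1 ∉ I.accepted c := Nat.notMem_of_lt_sInf (by
      show I.lsIndex c - 1 < I.lsIndex c
      omega)
    have h1 : I.α₂ ≤ 8 * I.trialStep c (I.lsIndex c - 1) * I.L₁ := by
      by_contra! h
      exact hrej (hacc _ h)
    have h2 : I.trialStep c (I.lsIndex c) = I.trialStep c (I.lsIndex c - 1) * I.β := by
      rw [Input.trialStep, Input.trialStep, mul_assoc, ← pow_succ, Nat.sub_add_cancel h0]
    rw [h2, Input.minStep, div_le_iff₀ (by positivity)]
    nlinarith

theorem step_σ (ξ : Draw d) : (I.step c ξ).σ = I.trialStep c (I.lsIndex c) / I.β := by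
  rw [step_eq]; split_ifs <;> rfl

theorem step_z (ξ : Draw d) : (I.step c ξ).z = I.nextZ c := by
  rw [step_eq]; split_ifs <;> rfl

theorem step_contraction (hd : 0 < d) (hS : I.StronglyMonotoneSetting L₂) (hV : I.ValidParameters)
    {zs : Vec (Fin d)} (hzs : I.F zs = 0) (hB : I.Regular c.B) (hσ : I.minStep ≤ c.σ)
    (hz : c.z ≠ zs) (ξ : Draw d) :
    (1 + 2 * I.trialStep c (I.lsIndex c) * I.μ) * ‖(I.step c ξ).z - zs‖ ^ 2 ≤ ‖c.z - zs‖ ^ 2 := by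
  obtain ⟨hne, hη⟩ := lineSearch hd hS hV hB hσ (hS.F_ne_zero hzs hz)
  have hmem : I.lsIndex c ∈ I.accepted c := Nat.sInf_mem hne
  rw [step_z]
  refine contraction ((minStep_pos hd hS hV).trans_le hη) hS.μ_pos (α := I.α₁ + I.α₂)
    (by linarith [hV.α₁_mem.2, hV.α₂_mem.2]) rfl ?_ (le_of_lt hmem)
  have := hS.stronglyMonotone (I.trialPoint c (I.lsIndex c)) zs
  rwa [hzs, sub_zero] at this

/-- The cost of the linear systems solved in one iteration. -/
theorem iterSolverMV_le (hd : 0 < d) (hS : I.StronglyMonotoneSetting L₂) (hV : I.ValidParameters)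
    (hB : I.Regular c.B) (hσ : I.minStep ≤ c.σ) (hF : I.F c.z ≠ 0) {Λ : ℝ} (hΛ : 4 ≤ Λ)
    (hΛ' : 4 * (1 + 7 * c.σ * I.L₁) ≤ Λ * I.α₁) :
    ∃ n : ℕ, I.iterSolverMV c = n ∧
      (n : ℝ) ≤ ((I.lsIndex c : ℝ) + 1) * (14 * I.condFactor * Real.log Λ + 3) := by
  have hμL := hS.μ_le_L₁ hd
  have hL : 0 < I.L₁ := hS.μ_pos.trans_le hμL
  have hσ0 : 0 < c.σ := (minStep_pos hd hS hV).trans_le hσ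
  have h1 := fun i => (trial_cost hS.μ_pos hμL hV.α₁_mem.1 hB (trialStep_pos hV hσ0 i) hΛ (by
    refine le_trans ?_ hΛ'
    have := trialStep_le hV hσ0 i
    gcongr)).2
  choose n hn hn' using h1
  refine ⟨∑ i ∈ Finset.range (I.lsIndex c + 1), n i, ?_, ?_⟩
  · rw [Input.iterSolverMV, if_pos (lineSearch hd hS hV hB hσ hF).1, Nat.cast_sum]
    exact Finset.sum_congr rfl fun i _ => hn i
  · push_cast
    refine (Finset.sum_le_sum fun i _ => hn' i).trans (le_of_eq ?_)
    simp
    ring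

end Iteration

/-! ### The whole run -/

section Run

variable {I : Input d} {L₂ : ℝ} {ξ : ℕ → Draw d} {zs : Vec (Fin d)}

/-- The next trial step is the accepted one divided by `β < 1`, so the lower bound propagates;
initially it holds because `7.5 ≤ 8`. Away from the solution `F` does not vanish, and the line
search applies. -/
theorem run_σ_ge (hd : 0 < d) (hS : I.StronglyMonotoneSetting L₂) (hV : I.ValidParameters)
    (hzs : I.F zs = 0) (hξ : I.AllOraclesSucceed ξ) {n : ℕ} (hn : ∀ k < n, (I.run ξ k).z ≠ zs) :
    I.minStep ≤ (I.run ξ n).σ := by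
  have hL : 0 < I.L₁ := hS.μ_pos.trans_le (hS.μ_le_L₁ hd)
  have h1 := hV.α₂_mem.1
  have h2 := hV.β_mem.1
  induction n with
  | zero =>
    refine le_trans ?_ hV.σ₀_ge
    unfold Input.minStep
    gcongr
    norm_num
  | succ n ih =>
    have ih' := ih fun k hk => hn k (by omega)
    have hB := (run_regular I hS.μ_pos (hS.μ_le_L₁ hd) hV.B₀_mem hξ n).1
    obtain ⟨-, hη⟩ := lineSearch hd hS hV hB ih' (hS.F_ne_zero hzs (hn n (by omega)))
    rw [Input.run, step_σ, le_div_iff₀ h2]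
    refine le_trans ?_ hη
    exact mul_le_of_le_one_right (minStep_pos hd hS hV).le hV.β_mem.2.le

theorem run_contraction (hd : 0 < d) (hS : I.StronglyMonotoneSetting L₂) (hV : I.ValidParameters)
    (hzs : I.F zs = 0) (hξ : I.AllOraclesSucceed ξ) {n : ℕ} (hn : ∀ k ≤ n, (I.run ξ k).z ≠ zs) :
    (1 + 2 * I.trialStep (I.run ξ n) (I.lsIndex (I.run ξ n)) * I.μ) *
      ‖(I.run ξ (n + 1)).z - zs‖ ^ 2 ≤ ‖(I.run ξ n).z - zs‖ ^ 2 :=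
  step_contraction hd hS hV hzs
    (run_regular I hS.μ_pos (hS.μ_le_L₁ hd) hV.B₀_mem hξ n).1
    (run_σ_ge hd hS hV hzs hξ fun k hk => hn k (by omega)) (hn n le_rfl) _

/-- If accuracy were never reached, every step would contract by the fixed ratio `1 + 2 η μ` at the
minimal `η`, and geometric decay would contradict `ε > 0`. -/
theorem exists_dist_le (hd : 0 < d) (hS : I.StronglyMonotoneSetting L₂) (hV : I.ValidParameters)
    (hzs : I.F zs = 0) (hξ : I.AllOraclesSucceed ξ) {ε : ℝ} (hε : 0 < ε) :
    ∃ n, ‖(I.run ξ n).z - zs‖ ^ 2 ≤ ε := by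
  by_contra! h
  have hne : ∀ k, (I.run ξ k).z ≠ zs := fun k hk => by
    have := h k
    rw [hk, sub_self, norm_zero] at this
    norm_num at this
    linarith
  set r := 1 + 2 * I.minStep * I.μ with hr
  have hm := minStep_pos hd hS hV
  have hr1 : 1 < r := by
    have := mul_pos hm hS.μ_pos
    rw [hr]; linarith
  have hdecay : ∀ n, r ^ n * ‖(I.run ξ n).z - zs‖ ^ 2 ≤ ‖I.z₀ - zs‖ ^ 2 := fun n => by
    induction n with
    | zero => rw [pow_zero, one_mul]; exact le_rfl
    | succ n ih =>
      refine le_trans ?_ ih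
      rw [pow_succ, mul_assoc]
      gcongr
      refine le_trans ?_ (run_contraction hd hS hV hzs hξ fun k _ => hne k)
      have := (lineSearch hd hS hV
        (run_regular I hS.μ_pos (hS.μ_le_L₁ hd) hV.B₀_mem hξ n).1
        (run_σ_ge hd hS hV hzs hξ fun k _ => hne k) (hS.F_ne_zero hzs (hne n))).2
      have hμ := hS.μ_pos
      rw [hr]
      gcongr
  obtain ⟨n, hn⟩ := pow_unbounded_of_one_lt (‖I.z₀ - zs‖ ^ 2 / ε) hr1
  rw [div_lt_iff₀ hε] at hn
  have h1 := hdecay n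
  have h2 : r ^ n * ε ≤ r ^ n * ‖(I.run ξ n).z - zs‖ ^ 2 := by
    have := (h n).le
    gcongr
  linarith

theorem run_dist_antitone (hd : 0 < d) (hS : I.StronglyMonotoneSetting L₂)
    (hV : I.ValidParameters) (hzs : I.F zs = 0) (hξ : I.AllOraclesSucceed ξ) {n : ℕ}
    (hn : ∀ k < n, (I.run ξ k).z ≠ zs) : ‖(I.run ξ n).z - zs‖ ^ 2 ≤ ‖I.z₀ - zs‖ ^ 2 := by
  induction n with
  | zero => exact le_rfl
  | succ n ih =>
    refine le_trans ?_ (ih fun k hk => hn k (by omega))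
    refine le_trans ?_ (run_contraction hd hS hV hzs hξ fun k hk => hn k (by omega))
    refine le_mul_of_one_le_left (sq_nonneg _) ?_
    have h1 := (minStep_pos hd hS hV).trans_le (run_σ_ge hd hS hV hzs hξ
      (n := n) fun k hk => hn k (by omega))
    have := mul_pos (trialStep_pos hV h1 (I.lsIndex (I.run ξ n))) hS.μ_pos
    linarith

/-- Before the accuracy is reached, the trial step sizes are controlled by the initial error. -/
theorem run_σ_le (hd : 0 < d) (hS : I.StronglyMonotoneSetting L₂) (hV : I.ValidParameters)
    (hzs : I.F zs = 0) (hξ : I.AllOraclesSucceed ξ) {R ε : ℝ} (hR : I.σ₀ * I.L₁ ≤ R) (hε : 0 < ε)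
    {n : ℕ} (hn : ∀ k ≤ n, ε < ‖(I.run ξ k).z - zs‖ ^ 2) :
    1 + (I.run ξ n).σ * I.μ ≤ (1 / I.β + 1 + R) * (‖I.z₀ - zs‖ ^ 2 / ε) := by
  have hne : ∀ k ≤ n, (I.run ξ k).z ≠ zs := fun k hk h0 => by
    have := hn k hk
    rw [h0, sub_self, norm_zero] at this
    norm_num at this
    linarith
  have hμ := hS.μ_pos
  have hμL := hS.μ_le_L₁ hd
  have hβ := hV.β_mem.1
  have hβ1 : 1 ≤ 1 / I.β := (one_le_div hβ).2 hV.β_mem.2.le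
  have hσ0 : 0 < I.σ₀ := (minStep_pos hd hS hV).trans_le
    (run_σ_ge hd hS hV hzs hξ (ξ := ξ) (n := 0) (by simp))
  have hσR : I.σ₀ * I.μ ≤ R := le_trans (by gcongr) hR
  have hR0 : 0 ≤ R := le_trans (by positivity) hσR
  have hρ : 1 ≤ ‖I.z₀ - zs‖ ^ 2 / ε := (one_le_div hε).2 (hn 0 (Nat.zero_le n)).le
  cases n with
  | zero =>
    change 1 + I.σ₀ * I.μ ≤ _
    nlinarith
  | succ n =>
    have h1 := run_contraction hd hS hV hzs hξ (n := n) fun k hk => hne k (by omega)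
    have h2 := run_dist_antitone hd hS hV hzs hξ (n := n) fun k hk => hne k (by omega)
    have hσn := (minStep_pos hd hS hV).trans_le (run_σ_ge hd hS hV hzs hξ
      (n := n) fun k hk => hne k (by omega))
    set η := I.trialStep (I.run ξ n) (I.lsIndex (I.run ξ n)) with hη
    have hη0 : 0 < η := trialStep_pos hV hσn _
    have hσ : (I.run ξ (n + 1)).σ = η / I.β := step_σ _
    -- A very long step would already have brought the error below `ε`.
    have h3 : 1 + 2 * η * I.μ ≤ ‖I.z₀ - zs‖ ^ 2 / ε := by
      rw [le_div_iff₀ hε]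
      have h4 := (hn (n + 1) le_rfl).le
      refine le_trans ?_ (h1.trans h2)
      gcongr
    have hημ := mul_pos hη0 hμ
    rw [hσ, show η / I.β * I.μ = 1 / I.β * (η * I.μ) by ring]
    have h5 : 1 / I.β * (η * I.μ) ≤ 1 / I.β * (‖I.z₀ - zs‖ ^ 2 / ε) := by
      gcongr
      linarith
    nlinarith

/-- The total number of backtracking steps, by telescoping. -/
theorem sum_lsIndex (hd : 0 < d) (hS : I.StronglyMonotoneSetting L₂) (hV : I.ValidParameters)
    (hzs : I.F zs = 0) (hξ : I.AllOraclesSucceed ξ) {n : ℕ} (hn : ∀ k < n, (I.run ξ k).z ≠ zs) :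
    (∑ k ∈ Finset.range n, (I.lsIndex (I.run ξ k) : ℝ)) * Real.log (1 / I.β) =
      Real.log I.σ₀ - Real.log (I.run ξ n).σ + n * Real.log (1 / I.β) := by
  have hβ := hV.β_mem.1
  induction n with
  | zero => simp [Input.run, Input.init]
  | succ n ih =>
    have hσn := (minStep_pos hd hS hV).trans_le (run_σ_ge hd hS hV hzs hξ
      (n := n) fun k hk => hn k (by omega))
    have hσ : (I.run ξ (n + 1)).σ =
        I.trialStep (I.run ξ n) (I.lsIndex (I.run ξ n)) / I.β := step_σ _
    have hlog : Real.log (I.run ξ (n + 1)).σ = Real.log (I.run ξ n).σ +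
        I.lsIndex (I.run ξ n) * Real.log I.β - Real.log I.β := by
      rw [hσ, Input.trialStep, Real.log_div (by positivity) hβ.ne',
        Real.log_mul hσn.ne' (by positivity), Real.log_pow]
    rw [Finset.sum_range_succ, add_mul, ih fun k hk => hn k (by omega), hlog, one_div,
      Real.log_inv]
    push_cast
    ring

/-- Beyond one backtrack per iteration, the method can only spend the initial surplus `log (σ₀ /
σ_n)`, which `minStep` and `σ₀ L₁ ≤ R` bound by a constant; `n ≥ 1` absorbs it. -/
theorem sum_lsIndex_le (hd : 0 < d) (hS : I.StronglyMonotoneSetting L₂) (hV : I.ValidParameters)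
    (hzs : I.F zs = 0) (hξ : I.AllOraclesSucceed ξ) {R : ℝ} (hR : I.σ₀ * I.L₁ ≤ R) {n : ℕ}
    (hn : ∀ k < n, (I.run ξ k).z ≠ zs) (hn0 : 1 ≤ n) :
    ∑ k ∈ Finset.range n, ((I.lsIndex (I.run ξ k) : ℝ) + 1) ≤
      (2 + |Real.log (8 * R / (I.α₂ * I.β))| / Real.log (1 / I.β)) * n := by
  have hL : 0 < I.L₁ := hS.μ_pos.trans_le (hS.μ_le_L₁ hd)
  have hβ := hV.β_mem.1
  have hα₂ := hV.α₂_mem.1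
  have hm := minStep_pos hd hS hV
  have hσ0 : 0 < I.σ₀ := hm.trans_le (run_σ_ge hd hS hV hzs hξ (ξ := ξ) (n := 0) (by simp))
  have hσn := run_σ_ge hd hS hV hzs hξ hn
  have hℓ : 0 < Real.log (1 / I.β) := Real.log_pos ((one_lt_div hβ).2 hV.β_mem.2)
  have hn1 : (1 : ℝ) ≤ n := by exact_mod_cast hn0
  have h1 : Real.log I.σ₀ - Real.log (I.run ξ n).σ ≤ |Real.log (8 * R / (I.α₂ * I.β))| := by
    refine le_trans ?_ (le_abs_self _)
    rw [← Real.log_div hσ0.ne' (hm.trans_le hσn).ne']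
    refine Real.log_le_log (div_pos hσ0 (hm.trans_le hσn)) ?_
    calc I.σ₀ / (I.run ξ n).σ ≤ I.σ₀ / I.minStep := by gcongr
      _ = 8 * (I.σ₀ * I.L₁) / (I.α₂ * I.β) := by rw [Input.minStep]; field_simp
      _ ≤ _ := by gcongr
  have h2 := sum_lsIndex hd hS hV hzs hξ hn
  have h3 : ∑ k ∈ Finset.range n, (I.lsIndex (I.run ξ k) : ℝ) ≤
      |Real.log (8 * R / (I.α₂ * I.β))| / Real.log (1 / I.β) + n := by
    rw [← sub_le_iff_le_add, le_div_iff₀ hℓ, sub_mul, h2]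
    linarith
  rw [Finset.sum_add_distrib]
  simp only [Finset.sum_const, Finset.card_range, nsmul_eq_mul, mul_one]
  have h4 : 0 ≤ |Real.log (8 * R / (I.α₂ * I.β))| / Real.log (1 / I.β) := by positivity
  nlinarith

/-- The constant in the bound on the linear solver's cost. -/
def solverConst (α₁ α₂ β R : ℝ) : ℝ :=
  (2 + |Real.log (8 * R / (α₂ * β))| / Real.log (1 / β)) *
    (20 + 28 * Real.log (28 * (1 / β + 1 + R) / α₁))

/-- A single `Λ`, a constant times the argument `x` of the logarithm, serves all trials: `run_σ_le`
bounds `σ μ` by the error ratio, and the factor `L₁ / μ` in `x` converts this to a bound on `σ L₁`.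
Equality with a natural number also records that every search and solve terminates. -/
theorem solverMV_le (hd : 0 < d) (hS : I.StronglyMonotoneSetting L₂) (hV : I.ValidParameters)
    (hzs : I.F zs = 0) (hξ : I.AllOraclesSucceed ξ) {R ε : ℝ} (hR : I.σ₀ * I.L₁ ≤ R) (hε : 0 < ε)
    {N : ℕ} (hN : ∀ k < N, ε < ‖(I.run ξ k).z - zs‖ ^ 2) :
    ∃ m : ℕ, I.solverMV ξ N = m ∧
      (2 ≤ I.L₁ * ‖I.z₀ - zs‖ ^ 2 / (I.μ * ε) →
        (m : ℝ) ≤ solverConst I.α₁ I.α₂ I.β R *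
          (N * I.condFactor * Real.log (I.L₁ * ‖I.z₀ - zs‖ ^ 2 / (I.μ * ε)))) := by
  rcases Nat.eq_zero_or_pos N with rfl | hN0
  · exact ⟨0, by simp [Input.solverMV], by simp⟩
  have hne : ∀ k < N, (I.run ξ k).z ≠ zs := fun k hk h0 => by
    have := hN k hk
    rw [h0, sub_self, norm_zero] at this
    norm_num at this
    linarith
  have hμ := hS.μ_pos
  have hμL := hS.μ_le_L₁ hd
  have hL : 0 < I.L₁ := hμ.trans_le hμL
  have hα₁ := hV.α₁_mem.1
  have hβ := hV.β_mem.1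
  set C₁ := 1 / I.β + 1 + R with hC₁
  set x := I.L₁ * ‖I.z₀ - zs‖ ^ 2 / (I.μ * ε) with hx
  have hxeq : x = I.L₁ / I.μ * (‖I.z₀ - zs‖ ^ 2 / ε) := by rw [hx, div_mul_div_comm]
  have hρ : 1 ≤ ‖I.z₀ - zs‖ ^ 2 / ε := (one_le_div hε).2 (hN 0 hN0).le
  have hκ : 1 ≤ I.L₁ / I.μ := (one_le_div hμ).2 hμL
  have hx1 : 1 ≤ x := by rw [hxeq]; nlinarith
  have hσ0 : 0 < I.σ₀ := (minStep_pos hd hS hV).trans_le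
    (run_σ_ge hd hS hV hzs hξ (ξ := ξ) (n := 0) (by simp))
  have hR0 : 0 < R := lt_of_lt_of_le (by positivity) hR
  have hC₁1 : 1 ≤ C₁ := by
    have : 0 < 1 / I.β := by positivity
    rw [hC₁]; linarith
  have hA : 4 ≤ 28 * C₁ / I.α₁ := by
    rw [le_div_iff₀ hα₁]
    linarith [hV.α₁_mem.2]
  set Λ := 28 * C₁ / I.α₁ * x with hΛ
  have hΛ4 : 4 ≤ Λ := by rw [hΛ]; nlinarith
  have hΛ' : ∀ k < N, 4 * (1 + 7 * (I.run ξ k).σ * I.L₁) ≤ Λ * I.α₁ := fun k hk => by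
    have h1 := run_σ_le hd hS hV hzs hξ hR hε (n := k) fun j hj => hN j (by omega)
    have h2 : Λ * I.α₁ = 28 * (I.L₁ / I.μ) * (C₁ * (‖I.z₀ - zs‖ ^ 2 / ε)) := by
      rw [hΛ, hxeq]; field_simp
    rw [h2]
    have h3 : 28 * (I.L₁ / I.μ) * (1 + (I.run ξ k).σ * I.μ) =
        28 * (I.L₁ / I.μ) + 28 * (I.run ξ k).σ * I.L₁ := by field_simp
    calc 4 * (1 + 7 * (I.run ξ k).σ * I.L₁)
        ≤ 28 * (I.L₁ / I.μ) * (1 + (I.run ξ k).σ * I.μ) := by rw [h3]; linarith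
      _ ≤ _ := by gcongr
  have hiter : ∀ k, ∃ n : ℕ, k < N → I.iterSolverMV (I.run ξ k) = n ∧
      (n : ℝ) ≤ ((I.lsIndex (I.run ξ k) : ℝ) + 1) * (14 * I.condFactor * Real.log Λ + 3) :=
    fun k => by
      by_cases hk : k < N
      · obtain ⟨n, hn⟩ := iterSolverMV_le hd hS hV
          (run_regular I hμ hμL hV.B₀_mem hξ k).1
          (run_σ_ge hd hS hV hzs hξ fun j hj => hne j (by omega))
          (hS.F_ne_zero hzs (hne k hk)) hΛ4 (hΛ' k hk)
        exact ⟨n, fun _ => hn⟩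
      · exact ⟨0, fun h => absurd h hk⟩
  choose n hn using hiter
  refine ⟨∑ k ∈ Finset.range N, n k, ?_, fun hx2 => ?_⟩
  · rw [Input.solverMV, Nat.cast_sum]
    exact Finset.sum_congr rfl fun k hk => (hn k (Finset.mem_range.1 hk)).1
  · have hlogx : 1 / 2 ≤ Real.log x := by
      have h1 := Real.log_two_gt_d9
      have h2 := Real.log_le_log (by norm_num) hx2
      linarith
    have hK := one_le_condFactor hμ hμL
    have hlA : 0 ≤ Real.log (28 * C₁ / I.α₁) := Real.log_nonneg (by linarith)
    have hlogΛ : Real.log Λ = Real.log (28 * C₁ / I.α₁) + Real.log x :=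
      Real.log_mul (by linarith) (by linarith)
    -- Since `x ≥ 2`, the product `κ log x` is at least `1/2`: this turns `3` into `6 κ log x` and
    -- doubles the coefficient of the constant logarithm.
    have hcost : 14 * I.condFactor * Real.log Λ + 3 ≤
        (20 + 28 * Real.log (28 * C₁ / I.α₁)) * (I.condFactor * Real.log x) := by
      have hKx : 1 / 2 ≤ I.condFactor * Real.log x := by nlinarith
      have h1 : I.condFactor * Real.log (28 * C₁ / I.α₁) ≤
          2 * Real.log (28 * C₁ / I.α₁) * (I.condFactor * Real.log x) := by
        have : 0 ≤ I.condFactor * Real.log (28 * C₁ / I.α₁) := by positivity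
        nlinarith
      rw [hlogΛ]
      linarith
    have hlogx0 : 0 < Real.log x := by linarith
    have hsum := sum_lsIndex_le hd hS hV hzs hξ hR hne hN0
    push_cast
    calc ∑ k ∈ Finset.range N, (n k : ℝ)
        ≤ ∑ k ∈ Finset.range N, ((I.lsIndex (I.run ξ k) : ℝ) + 1) *
            (14 * I.condFactor * Real.log Λ + 3) :=
          Finset.sum_le_sum fun k hk => (hn k (Finset.mem_range.1 hk)).2
      _ = (∑ k ∈ Finset.range N, ((I.lsIndex (I.run ξ k) : ℝ) + 1)) *
            (14 * I.condFactor * Real.log Λ + 3) := by rw [Finset.sum_mul]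
      _ ≤ ((2 + |Real.log (8 * R / (I.α₂ * I.β))| / Real.log (1 / I.β)) * N) *
            ((20 + 28 * Real.log (28 * C₁ / I.α₁)) * (I.condFactor * Real.log x)) := by
          refine mul_le_mul hsum hcost ?_ ?_
          · have : 0 ≤ Real.log Λ := by rw [hlogΛ]; linarith
            positivity
          · exact le_trans (Finset.sum_nonneg fun k _ => by positivity) hsum
      _ = _ := by rw [solverConst, hC₁]; ring

end Run

/-! ### The cost of the separation oracles -/

theorem run_t_le (I : Input d) (ξ : ℕ → Draw d) (k : ℕ) : (I.run ξ k).t ≤ k := by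
  induction k with
  | zero => exact le_rfl
  | succ k ih =>
    rw [Input.run, step_eq]
    split_ifs
    · exact ih.trans (Nat.le_succ k)
    · exact Nat.succ_le_succ ih

/-- From `j + 2 ≤ 2 N` and `log (j + 2) ≤ N` one gets `q ≥ p / (5 N³)`, so the argument of the
logarithm is at most `2200 x³ ≤ 2¹² x³` and its logarithm at most `15 log x`. Together with `√(2 (1
+ 1/δ)) ≤ 2.5 s`, rounding included, this stays below `13 s log x`. The range `n ≤ 2 d` covers both
oracles. -/
theorem lanczosSteps_le {I : Input d} (hd : 0 < d) (hμ : 0 < I.μ) (hμL : I.μ ≤ I.L₁)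
    (hp0 : 0 < I.p) (hp1 : I.p ≤ 1) {N j n : ℕ} (hj : j + 1 ≤ N) (hn0 : 0 < n) (hn : n ≤ 2 * d)
    (hx : 2 ≤ d * (N : ℝ) ^ 2 / I.p ^ 2) :
    (lanczosSteps n I.δ (I.q (j + 1) / 2) : ℝ) ≤
      13 * (√(I.L₁ / I.μ) * Real.log (d * (N : ℝ) ^ 2 / I.p ^ 2)) := by
  set x := d * (N : ℝ) ^ 2 / I.p ^ 2 with hxdef
  have hL : 0 < I.L₁ := hμ.trans_le hμL
  have hκ : 1 ≤ I.L₁ / I.μ := (one_le_div hμ).2 hμL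
  set s := √(I.L₁ / I.μ) with hs
  have hs1 : 1 ≤ s := Real.one_le_sqrt.2 hκ
  have hd1 : (1 : ℝ) ≤ d := by exact_mod_cast hd
  have hN1 : (1 : ℝ) ≤ N := by
    have : 1 ≤ N := by omega
    exact_mod_cast this
  have hlog2 := Real.log_two_gt_d9
  have hlogx : Real.log 2 ≤ Real.log x := Real.log_le_log (by norm_num) hx
  have hq0 := I.q_succ_pos hp0 j
  have hq1 := I.q_succ_le_one hp0 hp1 j
  have hj0 : (0 : ℝ) ≤ j := Nat.cast_nonneg j
  have hjN : (j : ℝ) + 1 ≤ N := by exact_mod_cast hj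
  have hlj0 : 0 < Real.log ((j : ℝ) + 2) := Real.log_pos (by linarith)
  have hlj : Real.log ((j : ℝ) + 2) ≤ N := by
    have := Real.log_le_sub_one_of_pos (x := (j : ℝ) + 2) (by linarith)
    linarith
  have hq : I.p / (5 * N ^ 3) ≤ I.q (j + 1) := by
    have h1 : I.q (j + 1) = I.p / (2.5 * ((j : ℝ) + 2) * Real.log ((j : ℝ) + 2) ^ 2) := by
      rw [Input.q]
      push_cast
      rw [show (j : ℝ) + 1 + 1 = j + 2 by ring]
    rw [h1]
    refine div_le_div_of_nonneg_left hp0.le (by positivity) ?_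
    calc 2.5 * ((j : ℝ) + 2) * Real.log ((j : ℝ) + 2) ^ 2 ≤ 2.5 * (2 * (N : ℝ)) * (N : ℝ) ^ 2 := by
          gcongr
          linarith
      _ = 5 * (N : ℝ) ^ 3 := by ring
  have hxN : (N : ℝ) ^ 2 ≤ x := by
    rw [hxdef, le_div_iff₀ (by positivity), mul_comm]
    have : I.p ^ 2 ≤ 1 := pow_le_one₀ hp0.le hp1
    gcongr
    linarith
  have harg : 11 * (n : ℝ) / (I.q (j + 1) / 2) ^ 2 ≤ 2 ^ 12 * x ^ 3 := by
    have hn' : (n : ℝ) ≤ 2 * d := by exact_mod_cast hn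
    calc 11 * (n : ℝ) / (I.q (j + 1) / 2) ^ 2
        ≤ 11 * (2 * d) / (I.p / (5 * N ^ 3) / 2) ^ 2 := by gcongr
      _ = 2200 * (x * ((N : ℝ) ^ 2) ^ 2) := by rw [hxdef]; field_simp; ring
      _ ≤ 2200 * (x * x ^ 2) := by gcongr
      _ ≤ 2 ^ 12 * x ^ 3 := by
        have : 0 ≤ x ^ 3 := by positivity
        nlinarith
  have hargpos : 1 ≤ 11 * (n : ℝ) / (I.q (j + 1) / 2) ^ 2 := by
    have hn1 : (1 : ℝ) ≤ n := by exact_mod_cast hn0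
    rw [le_div_iff₀ (by positivity)]
    nlinarith
  have hlogarg : Real.log (11 * (n : ℝ) / (I.q (j + 1) / 2) ^ 2) ≤ 15 * Real.log x := by
    refine (Real.log_le_log (by linarith) harg).trans ?_
    rw [Real.log_mul (by positivity) (by positivity), Real.log_pow, Real.log_pow]
    push_cast
    linarith
  have hlogarg0 : 0 ≤ Real.log (11 * (n : ℝ) / (I.q (j + 1) / 2) ^ 2) := Real.log_nonneg hargpos
  have hsq : √(2 * (1 + 1 / I.δ)) ≤ 2.5 * s := by
    rw [Real.sqrt_le_left (by positivity), mul_pow, hs, Real.sq_sqrt (by positivity)]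
    have h1 : 1 / I.δ = 2 * (I.L₁ / I.μ) := by rw [Input.δ]; field_simp
    rw [h1]
    linarith
  have hmain : 1 / 4 * √(2 * (1 + 1 / I.δ)) * Real.log (11 * n / (I.q (j + 1) / 2) ^ 2) + 1 / 2 ≤
      1 / 4 * (2.5 * s) * (15 * Real.log x) + 1 / 2 := by gcongr
  have hceil := Nat.ceil_lt_add_one (a := 1 / 4 * √(2 * (1 + 1 / I.δ)) *
    Real.log (11 * n / (I.q (j + 1) / 2) ^ 2) + 1 / 2) (by positivity)
  rw [lanczosSteps]
  have hsx : 1 / 2 ≤ s * Real.log x := by nlinarith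
  linarith

/-- `39 = 13 + 2 · 13`: one product per step in `ExtEvec` and two in `MaxSvec`. The round counter
never exceeds the iteration index, so every round played is at most `N`. -/
theorem oracleMV_le {I : Input d} (hd : 0 < d) (hμ : 0 < I.μ) (hμL : I.μ ≤ I.L₁)
    (hp0 : 0 < I.p) (hp1 : I.p ≤ 1) (ξ : ℕ → Draw d) {N : ℕ}
    (hx : 2 ≤ d * (N : ℝ) ^ 2 / I.p ^ 2) :
    (I.oracleMV ξ N : ℝ) ≤
      39 * (N * √(I.L₁ / I.μ) * Real.log (d * (N : ℝ) ^ 2 / I.p ^ 2)) := by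
  set y := √(I.L₁ / I.μ) * Real.log (d * (N : ℝ) ^ 2 / I.p ^ 2) with hy
  have hy0 : 0 ≤ y := mul_nonneg (Real.sqrt_nonneg _) (Real.log_nonneg (by linarith))
  rw [Input.oracleMV, Nat.cast_sum]
  calc ∑ k ∈ Finset.range N, (I.iterOracleMV (I.run ξ k) : ℝ)
      ≤ ∑ k ∈ Finset.range N, 39 * y := by
        refine Finset.sum_le_sum fun k hk => ?_
        have hj : (I.run ξ k).t + 1 ≤ N := by
          have := run_t_le I ξ k
          have := Finset.mem_range.1 hk
          omega
        have h1 := lanczosSteps_le hd hμ hμL hp0 hp1 hj hd (by omega) hx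
        have h2 := lanczosSteps_le hd hμ hμL hp0 hp1 hj (n := 2 * d) (by omega) le_rfl hx
        rw [← hy] at h1 h2
        rw [Input.iterOracleMV]
        split_ifs
        · simpa using hy0
        · rw [extEvecMV]; push_cast; linarith
        · rw [extEvecMV, maxSvecMV]; push_cast; linarith
    _ = _ := by
        rw [Finset.sum_const, Finset.card_range, nsmul_eq_mul, hy]
        ring

end QNPE

end

/-! ### Assembly: the failure event lies in the event that some oracle call fails. -/

theorem theorem6p6 :
    ∃ C₀ : ℝ, ∀ α₁ α₂ β R : ℝ, ∃ C : ℝ,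
      ∀ (d : ℕ) (I : QNPE.Input d) (L₂ ε : ℝ) (zs : QNPE.Vec (Fin d))
        (Ω : Type*) (_ : MeasurableSpace Ω) (P : Measure Ω) (_ : IsProbabilityMeasure P)
        (ξ : ℕ → Ω → QNPE.Draw d),
        0 < d → I.StronglyMonotoneSetting L₂ → I.ValidParameters →
        I.α₁ = α₁ → I.α₂ = α₂ → I.β = β → I.σ₀ * I.L₁ ≤ R →
        I.F zs = 0 → 0 < ε →
        (∀ k, Measurable (ξ k)) → (∀ k, P.map (ξ k) = QNPE.drawLaw d) → iIndepFun ξ P →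
        P {ω | ¬ ∃ N : ℕ,
            IsLeast {n : ℕ | ‖(I.run (fun k => ξ k ω) n).z - zs‖ ^ 2 ≤ ε} N ∧
            (∃ m : ℕ, I.solverMV (fun k => ξ k ω) N = (m : ℕ∞) ∧
              (2 ≤ I.L₁ * ‖I.z₀ - zs‖ ^ 2 / (I.μ * ε) →
                (¬ I.cls.IsMinimization →
                  (m : ℝ) ≤ C * (N * (I.L₁ / I.μ) *
                    Real.log (I.L₁ * ‖I.z₀ - zs‖ ^ 2 / (I.μ * ε)))) ∧
                (I.cls.IsMinimization →
                  (m : ℝ) ≤ C * (N * Real.sqrt (I.L₁ / I.μ) *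
                    Real.log (I.L₁ * ‖I.z₀ - zs‖ ^ 2 / (I.μ * ε)))))) ∧
            (2 ≤ d * (N : ℝ) ^ 2 / I.p ^ 2 →
              (I.oracleMV (fun k => ξ k ω) N : ℝ) ≤ C₀ * (N * Real.sqrt (I.L₁ / I.μ) *
                Real.log (d * (N : ℝ) ^ 2 / I.p ^ 2)))} ≤ ENNReal.ofReal I.p := by
  refine ⟨39, fun α₁ α₂ β R => ⟨QNPE.solverConst α₁ α₂ β R, ?_⟩⟩
  intro d I L₂ ε zs Ω _ P _ ξ hd hS hV hα₁ hα₂ hβ hR hzs hε hξ hlaw hind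
  subst hα₁ hα₂ hβ
  have hμ := hS.μ_pos
  have hμL := hS.μ_le_L₁ hd
  have hL : 0 < I.L₁ := hμ.trans_le hμL
  have hδ : 0 < I.δ := by unfold QNPE.Input.δ; positivity
  -- Monotonicity holds for arbitrary sets, so the event of the theorem need not be shown
  -- measurable.
  refine le_trans (measure_mono (t := {ω | ¬ I.AllOraclesSucceed fun k => ξ k ω}) ?_)
    (QNPE.measure_not_allOraclesSucceed_le hd I hS.contDiff.continuous hδ hV.p_mem.1
      hV.p_mem.2.le hξ hlaw hind)
  intro ω hω hgood
  refine hω ?_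
  classical
  have hex := QNPE.exists_dist_le hd hS hV hzs hgood hε
  -- Taking the least `N` supplies, for all earlier iterates, the lower bound `ε` on the error that
  -- the solver cost requires.
  refine ⟨Nat.find hex, ⟨Nat.find_spec hex, fun n hn => Nat.find_min' hex hn⟩, ?_,
    QNPE.oracleMV_le hd hμ hμL hV.p_mem.1 hV.p_mem.2.le _⟩
  obtain ⟨m, hm, hle⟩ := QNPE.solverMV_le hd hS hV hzs hgood hR hε (N := Nat.find hex)
    fun k hk => not_le.1 (Nat.find_min hex hk)
  refine ⟨m, hm, fun hx => ⟨fun hmin => ?_, fun hmin => ?_⟩⟩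
  · have := hle hx
    rwa [QNPE.Input.condFactor, if_neg hmin] at this
  · have := hle hx
    rwa [QNPE.Input.condFactor, if_pos hmin] at this
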